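/- Let $\alpha\in(1,2)$, $\beta=\alpha/2$, $L,T>0$ and $\Omega=[0,L]$. Let $-\Delta=-\partial_{xx}$ with Dirichlet boundary conditions, with eigenvalues $\lambda_n=(n\pi/L)^2$ and orthonormal eigenfunctions $\varphi_n(x)=\sqrt{2/L}\,\sin(n\pi x/L)$, $n\ge1$, and put $$(-\Delta)^\gamma\psi=\sum_{n\ge1}\lambda_n^\gamma(\psi,\varphi_n)\varphi_n,\qquad \mathcal D((-\Delta)^\gamma)=\Big\{\psi\in L^2(\Omega):\sum_{n\ge1}|\lambda_n^\gamma(\psi,\varphi_n)|^2<\infty\Big\},$$ so that $\mathcal D(-\Delta)=H^2(\Omega)\cap H^1_0(\Omega)$ and $\mathcal D((-\Delta)^{1/2})=H^1_0(\Omega)$. Write $\omega_\gamma(t)=t^{\gamma-1}/\Gamma(\gamma)$ and let $\partial_t^\beta v(t)=\int_0^t\omega_{1-\beta}(t-s)v'(s)\,ds$ be the Caputo derivative. Let $a_0,a_1,f\in L^2(\Omega)$ and let $(u,z)$ be a strong solution of $$\begin{cases}\partial_t^\beta z-u_{xx}=0, & \text{in }\Omega\times(0,T),\\ z=\partial_t^\beta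 u-[a_1+\Gamma(2-\alpha)f]\,\omega_{2-\alpha/2}(t), & \text{in }\Omega\times(0,T),\\ u(\cdot,0)=a_0,\quad z(\cdot,0)=0, & \text{in }\Omega,\\ u=z=0, & \text{on }\partial\Omega\times(0,T),\end{cases}$$ that is, $u,z\in C([0,T];L^2(\Omega))\cap C^1((0,T);L^2(\Omega))$ with $u',z'\in L^1(0,T;L^2(\Omega))$, $u(t)\in H^2(\Omega)\cap H^1_0(\Omega)$ and $z(t)\in H^1_0(\Omega)$ for $t\in(0,T)$, with $u_{xx}$ the weak derivative, the initial conditions holding in $L^2(\Omega)$, and the two equations holding in $L^2(\Omega)$ for every $t\in(0,T)$. (i) If $a_0\in\mathcal D(-\Delta)$ and $a_1,f\in\mathcal D((-\Delta)^{1/2})$, then $z\in C^3((0,T];L^2(\Omega))$ and, for $m=0,1,2,3$ and all $t\in(0,T]$, $$\|\partial_t^m z(t)\|_{L^2}\le C\,t^{\beta-m}\|(-\Delta)a_0\|_{L^2}+C\,t^{1-m}\Big(\|(-\Delta)^{1/2}a_1\|_{L^2}+\|(-\Delta)^{1/2}f\|_{L^2}\Big),$$ where $C>0$ depends only on $\alpha$.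 (ii) If $a_0\in\mathcal D((-\Delta)^{3/2})$ and $a_1,f\in\mathcal D(-\Delta)$, then $z(t)\in\mathcal D((-\Delta)^{1/2})$ for $t\in(0,T]$, $(-\Delta)^{1/2}z\in C^3((0,T];L^2(\Omega))$ and, for $m=0,1,2,3$ and all $t\in(0,T]$, $$\|\partial_t^m(-\Delta)^{1/2}z(t)\|_{L^2}\le C\,t^{\beta-m}\Big(\|(-\Delta)^{3/2}a_0\|_{L^2}+\|(-\Delta)a_1\|_{L^2}+\|(-\Delta)f\|_{L^2}\Big),$$ where $C>0$ depends only on $\alpha$ and $T$. -/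

import Mathlib

open MeasureTheory Set Filter Topology
open scoped ContDiff

noncomputable section

namespace DiffusionWave

/-- The real Hilbert space `L²(Ω)` for the interval `Ω` with end points `0` and `L`. -/
abbrev L2 (L : ℝ) : Type := Lp ℝ 2 (volume.restrict (Ioo (0 : ℝ) L))

/-! ### Sobolev spaces on the interval -/

/-- Test functions: `η ∈ C_c^∞(0, L)`. -/
def IsTest (L : ℝ) (η : ℝ → ℝ) : Prop :=
  ContDiff ℝ ∞ η ∧ HasCompactSupport η ∧ tsupport η ⊆ Ioo 0 L

/-- `g ∈ L²` is the weak derivative of `ψ ∈ L²` on `(0, L)`. -/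
def HasWeakDeriv {L : ℝ} (ψ g : L2 L) : Prop :=
  ∀ η : ℝ → ℝ, IsTest L η →
    ∫ x in Ioo 0 L, ψ x * deriv η x = -∫ x in Ioo 0 L, g x * η x

/-- `w ∈ L²` is the second weak derivative `ψ_xx` of `ψ`, and `ψ ∈ H²(0, L)`. -/
def HasSecondWeakDeriv {L : ℝ} (ψ w : L2 L) : Prop :=
  ∃ g : L2 L, HasWeakDeriv ψ g ∧ HasWeakDeriv g w

/-- `H¹₀(0, L)`: the closure of the test functions in `H¹(0, L)`. -/
def H10 (L : ℝ) : Set (L2 L) :=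
  {ψ | ∃ g : L2 L, HasWeakDeriv ψ g ∧ ∃ η : ℕ → ℝ → ℝ, (∀ k, IsTest L (η k)) ∧
    Tendsto (fun k => eLpNorm (fun x => ψ x - η k x) 2 (volume.restrict (Ioo 0 L)))
      atTop (𝓝 0) ∧
    Tendsto (fun k => eLpNorm (fun x => g x - deriv (η k) x) 2 (volume.restrict (Ioo 0 L)))
      atTop (𝓝 0)}

/-! ### Dirichlet eigensystem and fractional powers of `-Δ` -/

/-- The Dirichlet eigenvalues `(kπ/L)²`, `k = n + 1`, of `-Δ` on `(0, L)`. -/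
def eigenvalue (L : ℝ) (n : ℕ) : ℝ := (((n : ℝ) + 1) * Real.pi / L) ^ 2

/-- The normalized Dirichlet eigenfunctions `√(2/L) sin(kπx/L)`, `k = n + 1`. -/
def eigenfun (L : ℝ) (n : ℕ) (x : ℝ) : ℝ :=
  Real.sqrt (2 / L) * Real.sin (((n : ℝ) + 1) * Real.pi / L * x)

theorem memLp_eigenfun (L : ℝ) (n : ℕ) :
    MemLp (eigenfun L n) 2 (volume.restrict (Ioo 0 L)) := by
  refine MemLp.of_bound (C := Real.sqrt (2 / L)) ?_ (ae_of_all _ fun x => ?_)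
  · apply Continuous.aestronglyMeasurable
    unfold eigenfun
    fun_prop
  · rw [eigenfun, Real.norm_eq_abs, abs_mul, abs_of_nonneg (Real.sqrt_nonneg _)]
    exact mul_le_of_le_one_right (Real.sqrt_nonneg _) (Real.abs_sin_le_one _)

/-- The eigenfunction `φ_n` as an element of `L²`. -/
def eigenvec (L : ℝ) (n : ℕ) : L2 L := (memLp_eigenfun L n).toLp (eigenfun L n)

/-- `λ_n^γ (ψ, φ_n)`. -/
def powCoeff (L γ : ℝ) (ψ : L2 L) (n : ℕ) : ℝ :=
  eigenvalue L n ^ γ * inner ℝ ψ (eigenvec L n)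

/-- The domain `D((-Δ)^γ)`. -/
def powDomain (L γ : ℝ) : Set (L2 L) := {ψ | Summable fun n => |powCoeff L γ ψ n| ^ 2}

/-- `(-Δ)^γ ψ = ∑ λ_n^γ (ψ, φ_n) φ_n`, a convergent series in `L²` when `ψ ∈ D((-Δ)^γ)`. -/
def negLapPow (L γ : ℝ) (ψ : L2 L) : L2 L := ∑' n, powCoeff L γ ψ n • eigenvec L n

/-! ### Fractional calculus in time -/

/-- `ω_γ(t) = t^(γ-1) / Γ(γ)`. -/
def omega (γ t : ℝ) : ℝ := t ^ (γ - 1) / Real.Gamma γ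

/-- The Riemann–Liouville fractional integral of order `γ` of a vector-valued function. -/
def rlIntegral {E : Type*} [NormedAddCommGroup E] [NormedSpace ℝ E]
    (γ : ℝ) (v : ℝ → E) (t : ℝ) : E :=
  ∫ s in (0 : ℝ)..t, omega γ (t - s) • v s

/-- The Caputo derivative of order `β ∈ (0, 1)` of a vector-valued function. -/
def caputo {E : Type*} [NormedAddCommGroup E] [NormedSpace ℝ E]
    (β : ℝ) (v : ℝ → E) (t : ℝ) : E :=
  rlIntegral (1 - β) (deriv v) t

/-- The functions of time for which the Caputo derivatives are formed:
`C([0, T]; E) ∩ C¹((0, T); E)` with derivative in `L¹(0, T; E)`. For such functions the integral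
that defines the Caputo derivative converges absolutely at every `t ∈ (0, T)`. -/
structure CaputoRegular {E : Type*} [NormedAddCommGroup E] [NormedSpace ℝ E]
    (T : ℝ) (v : ℝ → E) : Prop where
  continuousOn : ContinuousOn v (Icc 0 T)
  contDiffOn : ContDiffOn ℝ 1 v (Ioo 0 T)
  integrableOn_deriv : IntegrableOn (deriv v) (Ioo 0 T)

/-- `(u, z)` is a strong solution on `(0, L) × (0, T)` of
`∂_t^β z - u_xx = 0`, `z = ∂_t^β u - [a₁ + Γ(2-α) f] ω_{2-α/2}(t)`,
`u(0) = a₀`, `z(0) = 0`, `u = z = 0` on the boundary, where `β = α/2`. -/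
structure IsSolution (L T α : ℝ) (a₀ a₁ f : L2 L) (u z : ℝ → L2 L) : Prop where
  regular_u : CaputoRegular T u
  regular_z : CaputoRegular T z
  eq_z : ∀ t ∈ Ioo 0 T, ∃ uxx : L2 L, HasSecondWeakDeriv (u t) uxx ∧
    caputo (α / 2) z t - uxx = 0
  eq_u : ∀ t ∈ Ioo 0 T,
    z t = caputo (α / 2) u t - omega (2 - α / 2) t • (a₁ + Real.Gamma (2 - α) • f)
  init_u : u 0 = a₀
  init_z : z 0 = 0
  boundary_u : ∀ t ∈ Ioo 0 T, u t ∈ H10 L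
  boundary_z : ∀ t ∈ Ioo 0 T, z t ∈ H10 L

end DiffusionWave

end

open DiffusionWave

namespace DiffusionWave

/-! ### The kernels `ω_γ` -/

/-! Put `g = a₁ + Γ(2-α) f`. Testing both equations against an eigenfunction `φ_n`
(`IsSolution.inner_eigenvec_eq`) leaves a scalar system. Applying the fractional integral `I^β`
(`rlIntegral_caputo`) turns it into `u = a + b t + I^β z`, `z = -λ I^β u`, with `a = (a₀, φ_n)`, `b
= (g, φ_n)` and `λ = λ_n`. Picard iteration (`volterra_solution`) solves it: `z = -λ (a F_{β+1} + b
F_{β+2})`, where `F_μ(t) = ∑ₖ (-λ)ᵏ ω_{2βk+μ}(t)` is a Mittag-Leffler series and differentiation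
lowers `μ` by one.

The theorem thus rests on bounds uniform in `λ` (`exists_mlSeries_le`): `|F_{β+1-m}(t)| ≤ C t^{β-m}`
and `λ^{1/2} |F_{β+2-m}(t)| ≤ C t^{1-m}` for `m ≤ 3`. The first costs a full power of `-Δ` on `a₀`,
the second only half a power on `g`, because `λ = λ^{1/2} λ^{1/2}`. Scaling in time reduces both to
`λ = 1`. There `t^m F_{β+1-m}` is a series in the fixed kernels `ω_{2βk+β+1}` whose coefficients are
`(-1)^k` times a polynomial in `k` of degree at most 3, hence a combination of four Prabhakar
functions.

These are bounded on the half line (`exists_prabhakar_le`): their Laplace transforms `s^{-β-1} (1 +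
s^{-2β})^{-(j+1)}` have no singularity in the right half plane, since `β < 1` keeps `s^{-2β}` away
from `-1`, and on every vertical line they have the same integrable majorant `min(|y|^{-β-1},
|y|^{β-1})`. The Bromwich line can therefore be pushed to the imaginary axis.

Finally the eigenfunctions form a Hilbert basis, and `ℓ²`-domination of the coefficients permits
termwise differentiation in `L²` (`regularity_of_coeff_bounds`). Part (i) is the case `γ = 0` and
part (ii) the case `γ = 1/2` of one estimate for `(-Δ)^γ z`. -/

theorem hasDerivAt_omega (γ : ℝ) {t : ℝ} (ht : 0 < t) :
    HasDerivAt (omega γ) (omega (γ - 1) t) t := by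
  have h := (Real.hasDerivAt_rpow_const (x := t) (p := γ - 1) (Or.inl ht.ne')).div_const
    (Real.Gamma γ)
  refine h.congr_deriv ?_
  unfold omega
  rcases eq_or_ne (γ - 1) 0 with h0 | h0
  -- Here `γ = 1`: the convention `Γ(0) = 0` makes `ω_0` vanish, as the derivative of a constant
  -- should.
  · simp [h0]
  · have := Real.Gamma_add_one h0
    rw [sub_add_cancel] at this
    rw [this, mul_div_mul_left _ _ h0]

/-- Trades a factor `t` for a factor linear in the order. This is what turns `t^m` times an `m`-th
derivative into a series with polynomial coefficients. -/
theorem omega_sub_one (γ : ℝ) {t : ℝ} (ht : 0 < t) :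
    t * omega (γ - 1) t = (γ - 1) * omega γ t := by
  unfold omega
  have ht' : t * t ^ (γ - 1 - 1) = t ^ (γ - 1) := by
    rw [Real.rpow_sub_one ht.ne']; field_simp
  rw [← mul_div_assoc, ht']
  rcases eq_or_ne (γ - 1) 0 with h0 | h0
  · simp [h0]
  · have := Real.Gamma_add_one h0
    rw [sub_add_cancel] at this
    rw [this, ← mul_div_assoc, mul_div_mul_left _ _ h0]

theorem omega_nonneg {γ : ℝ} (hγ : 0 < γ) {t : ℝ} (ht : 0 ≤ t) : 0 ≤ omega γ t :=
  div_nonneg (Real.rpow_nonneg ht _) (Real.Gamma_pos_of_pos hγ).le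

theorem omega_mul (γ : ℝ) {x t : ℝ} (hx : 0 ≤ x) (ht : 0 ≤ t) :
    omega γ (x * t) = x ^ (γ - 1) * omega γ t := by
  unfold omega
  rw [Real.mul_rpow hx ht, mul_div_assoc]

theorem omega_one (t : ℝ) : omega 1 t = 1 := by simp [omega]

theorem omega_two (t : ℝ) : omega 2 t = t := by
  norm_num [omega]

theorem omega_zero_right {γ : ℝ} (hγ : 1 < γ) : omega γ 0 = 0 := by
  rw [omega, Real.zero_rpow (by linarith), zero_div]

theorem continuous_omega {γ : ℝ} (hγ : 1 ≤ γ) : Continuous (omega γ) := by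
  unfold omega
  exact (Real.continuous_rpow_const (by linarith)).div_const _

theorem measurable_omega (γ : ℝ) : Measurable (omega γ) := by
  unfold omega; fun_prop

theorem intervalIntegrable_omega_mul_omega_one {a b : ℝ} (ha : 0 < a) (hb : 0 < b) :
    IntervalIntegrable (fun r => omega a (1 - r) * omega b r) volume 0 1 := by
  have h := Complex.betaIntegral_convergent (u := (b : ℂ)) (v := (a : ℂ)) (by simpa) (by simpa)
  have h2 : IntervalIntegrable (fun x : ℝ => x ^ (b - 1) * (1 - x) ^ (a - 1)) volume 0 1 := by
    rw [intervalIntegrable_iff_integrableOn_Ioo_of_le zero_le_one] at h ⊢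
    refine IntegrableOn.congr_fun (Integrable.re h) (fun x hx => ?_) measurableSet_Ioo
    have e1 : ((x : ℂ)) ^ ((b : ℂ) - 1) = ((x ^ (b - 1) : ℝ) : ℂ) := by
      rw [Complex.ofReal_cpow hx.1.le]; push_cast; rfl
    have e2 : ((1 - x : ℂ)) ^ ((a : ℂ) - 1) = (((1 - x) ^ (a - 1) : ℝ) : ℂ) := by
      rw [Complex.ofReal_cpow (by linarith [hx.2])]; push_cast; rfl
    simp only [e1, e2, ← Complex.ofReal_mul]
    simp
  have := h2.mul_const ((Real.Gamma a)⁻¹ * (Real.Gamma b)⁻¹)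
  refine this.congr (fun x _ => ?_)
  simp only [omega]; ring

/-- Euler's Beta integral `Γ(a)Γ(b)/Γ(a+b)`; the Gamma factors in `ω` cancel the numerator. -/
theorem integral_omega_mul_omega_one {a b : ℝ} (ha : 0 < a) (hb : 0 < b) :
    ∫ r in (0 : ℝ)..1, omega a (1 - r) * omega b r = (Real.Gamma (a + b))⁻¹ := by
  have h := ProbabilityTheory.beta_eq_betaIntegralReal b a hb ha
  have h2 : ((∫ r in (0 : ℝ)..1, r ^ (b - 1) * (1 - r) ^ (a - 1) : ℝ) : ℂ)
      = Complex.betaIntegral b a := by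
    rw [Complex.betaIntegral, ← intervalIntegral.integral_ofReal]
    refine intervalIntegral.integral_congr fun x hx => ?_
    rw [uIcc_of_le zero_le_one] at hx
    simp only [Complex.ofReal_mul]
    rw [Complex.ofReal_cpow hx.1, Complex.ofReal_cpow (by linarith [hx.2])]
    push_cast; rfl
  rw [← h2, Complex.ofReal_re] at h
  have e : (fun r => omega a (1 - r) * omega b r) = fun r =>
      (r ^ (b - 1) * (1 - r) ^ (a - 1)) * ((Real.Gamma a)⁻¹ * (Real.Gamma b)⁻¹) := by
    ext x; simp only [omega]; ring
  rw [e, intervalIntegral.integral_mul_const, ← h, ProbabilityTheory.beta, add_comm b a]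
  have := (Real.Gamma_pos_of_pos ha).ne'
  have := (Real.Gamma_pos_of_pos hb).ne'
  field_simp

theorem intervalIntegrable_omega_mul_omega {a b : ℝ} (ha : 0 < a) (hb : 0 < b) {t : ℝ}
    (ht : 0 < t) : IntervalIntegrable (fun r => omega a (t - r) * omega b r) volume 0 t := by
  have h := (intervalIntegrable_omega_mul_omega_one ha hb).comp_mul_left (c := t⁻¹)
  simp only [div_inv_eq_mul, one_mul, zero_mul] at h
  have h := h.const_mul (t ^ (a - 1) * t ^ (b - 1))
  rw [intervalIntegrable_iff_integrableOn_Ioo_of_le ht.le] at h ⊢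
  refine h.congr_fun (fun x hx => ?_) measurableSet_Ioo
  have e1 : t - x = t * (1 - t⁻¹ * x) := by field_simp
  have e2 : x = t * (t⁻¹ * x) := by field_simp
  have h1 : 0 ≤ t⁻¹ * x := mul_nonneg (inv_nonneg.2 ht.le) hx.1.le
  have h2 : 0 ≤ 1 - t⁻¹ * x := by
    rw [inv_mul_eq_div, sub_nonneg, div_le_one ht]; exact hx.2.le
  change _ = omega a (t - x) * omega b x
  rw [e1, omega_mul _ ht.le h2]
  conv_rhs => rw [e2, omega_mul _ ht.le h1]
  have e3 : t⁻¹ * (t * (t⁻¹ * x)) = t⁻¹ * x := by field_simp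
  rw [e3]
  ring

/-- The semigroup law `ω_a * ω_b = ω_{a+b}`, reduced to `t = 1` by homogeneity. -/
theorem integral_omega_mul_omega {a b : ℝ} (ha : 0 < a) (hb : 0 < b) {t : ℝ}
    (ht : 0 < t) : ∫ r in (0 : ℝ)..t, omega a (t - r) * omega b r = omega (a + b) t := by
  have h := intervalIntegral.integral_comp_mul_left
    (fun r => omega a (t - r) * omega b r) (a := 0) (b := 1) ht.ne'
  rw [mul_zero, mul_one, smul_eq_mul, eq_inv_mul_iff_mul_eq₀ ht.ne'] at h
  rw [← h]
  have e : ∀ r ∈ uIcc (0 : ℝ) 1, omega a (t - t * r) * omega b (t * r) =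
      (t ^ (a - 1) * t ^ (b - 1)) * (omega a (1 - r) * omega b r) := by
    intro r hr
    rw [uIcc_of_le zero_le_one] at hr
    have e1 : t - t * r = t * (1 - r) := by ring
    rw [e1, omega_mul _ ht.le (by linarith [hr.2]), omega_mul _ ht.le hr.1]
    ring
  rw [intervalIntegral.integral_congr e, intervalIntegral.integral_const_mul,
    integral_omega_mul_omega_one ha hb, omega, div_eq_mul_inv, ← mul_assoc, ← Real.rpow_add ht]
  congr 1
  rw [mul_comm, ← Real.rpow_add_one ht.ne']
  congr 1; ring

theorem intervalIntegrable_omega_sub {a : ℝ} (ha : 0 < a) {t : ℝ} (ht : 0 < t) :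
    IntervalIntegrable (fun r => omega a (t - r)) volume 0 t := by
  have := intervalIntegrable_omega_mul_omega ha one_pos ht
  simpa [omega_one] using this

/-- Shifted form: `∫_s^t ω_a(t-r) ω_b(r-s) dr = ω_{a+b}(t-s)`. -/
theorem integral_omega_mul_omega_shift {a b : ℝ} (ha : 0 < a) (hb : 0 < b) {s t : ℝ}
    (hst : s < t) : ∫ r in s..t, omega a (t - r) * omega b (r - s) = omega (a + b) (t - s) := by
  rw [← integral_omega_mul_omega ha hb (sub_pos.2 hst)]
  have := intervalIntegral.integral_comp_sub_right
    (fun r => omega a (t - s - r) * omega b r) (a := s) (b := t) s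
  rw [sub_self] at this
  rw [← this]
  congr 1; ext r; congr 2; ring

theorem intervalIntegrable_omega_mul_omega_shift {a b : ℝ} (ha : 0 < a) (hb : 0 < b) {s t : ℝ}
    (hst : s < t) : IntervalIntegrable (fun r => omega a (t - r) * omega b (r - s)) volume s t := by
  have := (intervalIntegrable_omega_mul_omega ha hb (sub_pos.2 hst)).comp_sub_right s
  simp only [zero_add, sub_add_cancel] at this
  convert this using 4; ring

/-! ### Growth of the Gamma function along arithmetic progressions -/

/-- Monotonicity of `Γ` is available on `[2, ∞)`, and `n + 1 ≥ 2` needs `n ≥ 1`; the term `n = 0` is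
absorbed afterwards in a constant. -/
theorem factorial_le_Gamma {α b : ℝ} (hα : 1 ≤ α) (hb : 0 ≤ b) {n : ℕ} (hn : 1 ≤ n) :
    (n.factorial : ℝ) ≤ Real.Gamma (α * n + b + 1) := by
  rw [← Real.Gamma_nat_eq_factorial]
  have hn' : (1 : ℝ) ≤ n := by exact_mod_cast hn
  have : (n : ℝ) ≤ α * n := le_mul_of_one_le_left (by linarith) hα
  exact Real.Gamma_strictMonoOn_Ici.monotoneOn (by simp; linarith) (by simp; linarith) (by linarith)

theorem exists_factorial_le_Gamma {α b : ℝ} (hα : 1 ≤ α) (hb : 0 ≤ b) :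
    ∃ c : ℝ, 0 < c ∧ ∀ n : ℕ, c * (n.factorial : ℝ) ≤ Real.Gamma (α * n + b + 1) := by
  refine ⟨min 1 (Real.Gamma (b + 1)), lt_min one_pos (Real.Gamma_pos_of_pos (by linarith)),
    fun n => ?_⟩
  rcases Nat.eq_zero_or_pos n with rfl | hn
  · simp
  · exact (mul_le_of_le_one_left (by positivity) (min_le_left _ _)).trans
      (factorial_le_Gamma hα hb hn)

/-- Uniform bound for the terms of Mittag-Leffler type series with exponentially bounded
coefficients. -/
theorem exists_summable_omega_bound {α b : ℝ} (hα : 1 ≤ α) (hb : 0 ≤ b) (A : ℝ) (hA : 0 ≤ A)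
    {R : ℝ} (hR : 0 ≤ R) :
    ∃ w : ℕ → ℝ, Summable w ∧ ∀ n : ℕ, ∀ t ∈ Icc 0 R,
      A ^ n * omega (α * n + b + 1) t ≤ t ^ b * w n := by
  obtain ⟨c, hc, h⟩ := exists_factorial_le_Gamma hα hb
  refine ⟨fun n => c⁻¹ * ((A * R ^ α) ^ n / n.factorial),
    (Real.summable_pow_div_factorial _).mul_left _, fun n t ht => ?_⟩
  have hG := h n
  have hf : (0 : ℝ) < n.factorial := by positivity
  have hα0 : 0 ≤ α := by linarith
  -- Only the powers growing with `n` are estimated by `R`; the factor `t ^ b` survives and supplies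
  -- the decay as `t → 0`.
  have e : t ^ (α * n + b + 1 - 1) ≤ t ^ b * (R ^ α) ^ n := by
    rw [add_sub_cancel_right, add_comm, Real.rpow_add_of_nonneg ht.1 hb (by positivity),
      Real.rpow_mul_natCast ht.1]
    have := ht.1
    gcongr
    exact ht.2
  unfold omega
  calc A ^ n * (t ^ (α * n + b + 1 - 1) / Real.Gamma (α * n + b + 1))
      ≤ A ^ n * ((t ^ b * (R ^ α) ^ n) / (c * n.factorial)) := by
        have := Real.rpow_nonneg ht.1 b
        gcongr
    _ = _ := by simp only [mul_pow]; field_simp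

/-! ### Laplace transform of the kernels -/

theorem integrableOn_rpow_mul_exp_neg {a r : ℝ} (ha : 0 < a) (hr : 0 < r) :
    IntegrableOn (fun t : ℝ => t ^ (a - 1) * Real.exp (-(r * t))) (Ioi 0) := by
  have := integrableOn_rpow_mul_exp_neg_mul_rpow (p := 1) (s := a - 1) (b := r)
    (by linarith) one_pos hr
  simpa using this

theorem norm_ofReal_rpow_mul_cexp {a t : ℝ} (ht : 0 < t) (s : ℂ) :
    ‖((t ^ (a - 1) : ℝ) : ℂ) * Complex.exp (-(s * t))‖ =
      t ^ (a - 1) * Real.exp (-(s.re * t)) := by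
  rw [norm_mul, Complex.norm_real, Real.norm_of_nonneg (Real.rpow_nonneg ht.le _),
    Complex.norm_exp]
  simp

theorem aestronglyMeasurable_rpow_mul_cexp (a : ℝ) (s : ℂ) (μ : Measure ℝ) :
    AEStronglyMeasurable
      (fun t : ℝ => ((t ^ (a - 1) : ℝ) : ℂ) * Complex.exp (-(s * t))) μ := by
  apply Measurable.aestronglyMeasurable
  fun_prop

theorem integrableOn_rpow_mul_cexp {a : ℝ} (ha : 0 < a) {s : ℂ} (hs : 0 < s.re) :
    IntegrableOn (fun t : ℝ => ((t ^ (a - 1) : ℝ) : ℂ) * Complex.exp (-(s * t))) (Ioi 0) := by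
  refine Integrable.mono' (integrableOn_rpow_mul_exp_neg ha hs)
    (aestronglyMeasurable_rpow_mul_cexp _ _ _) ?_
  filter_upwards [ae_restrict_mem measurableSet_Ioi] with t ht
  exact (norm_ofReal_rpow_mul_cexp ht s).le

theorem differentiableAt_laplace_rpow {a : ℝ} (ha : 0 < a) {s : ℂ} (hs : 0 < s.re) :
    DifferentiableAt ℂ
      (fun z : ℂ => ∫ t in Ioi (0 : ℝ), ((t ^ (a - 1) : ℝ) : ℂ) * Complex.exp (-(z * t))) s := by
  have hopen : {z : ℂ | s.re / 2 < z.re} ∈ 𝓝 s :=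
    (isOpen_lt continuous_const Complex.continuous_re).mem_nhds (by simp; linarith)
  have key := hasDerivAt_integral_of_dominated_loc_of_deriv_le
    (μ := volume.restrict (Ioi (0 : ℝ)))
    (F := fun (z : ℂ) (t : ℝ) => ((t ^ (a - 1) : ℝ) : ℂ) * Complex.exp (-(z * t)))
    (F' := fun (z : ℂ) (t : ℝ) => ((t ^ (a - 1) : ℝ) : ℂ) * (Complex.exp (-(z * t)) * (-(1 * t))))
    (bound := fun t => t ^ (a + 1 - 1) * Real.exp (-(s.re / 2 * t)))
    hopen (Eventually.of_forall fun z => aestronglyMeasurable_rpow_mul_cexp _ _ _)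
    (integrableOn_rpow_mul_cexp ha hs) ?_ ?_
    (integrableOn_rpow_mul_exp_neg (by linarith) (by linarith)) ?_
  · exact key.2.differentiableAt
  · apply Measurable.aestronglyMeasurable
    fun_prop
  · filter_upwards [ae_restrict_mem measurableSet_Ioi] with t ht z hz
    have ht : 0 < t := ht
    rw [← mul_assoc, norm_mul, norm_ofReal_rpow_mul_cexp ht]
    have e1 : ‖(-(1 * (t : ℂ)))‖ = t := by simp [abs_of_pos ht]
    have e2 : t ^ (a + 1 - 1) = t ^ (a - 1) * t := by
      rw [add_sub_cancel_right, ← Real.rpow_add_one ht.ne', sub_add_cancel]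
    rw [e1, e2, mul_right_comm]
    have : s.re / 2 < z.re := hz
    gcongr
  · refine ae_of_all _ fun t z _ => ?_
    exact ((((hasDerivAt_id z).mul_const (t : ℂ)).neg).cexp).const_mul _

/-- Both sides are holomorphic on the right half plane and agree for positive real `s` by Euler's
integral, so the identity theorem at the accumulation point `1` applies. -/
theorem laplace_rpow {a : ℝ} (ha : 0 < a) {s : ℂ} (hs : 0 < s.re) :
    ∫ t in Ioi (0 : ℝ), ((t ^ (a - 1) : ℝ) : ℂ) * Complex.exp (-(s * t)) =
      Real.Gamma a * s ^ (-a : ℂ) := by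
  have hopen : IsOpen {z : ℂ | 0 < z.re} := isOpen_lt continuous_const Complex.continuous_re
  have hconv : Convex ℝ {z : ℂ | 0 < z.re} := convex_halfSpace_re_gt 0
  have h1 : AnalyticOnNhd ℂ
      (fun z : ℂ => ∫ t in Ioi (0 : ℝ), ((t ^ (a - 1) : ℝ) : ℂ) * Complex.exp (-(z * t)))
      {z : ℂ | 0 < z.re} :=
    DifferentiableOn.analyticOnNhd
      (fun z hz => (differentiableAt_laplace_rpow ha hz).differentiableWithinAt) hopen
  have h2 : AnalyticOnNhd ℂ (fun z : ℂ => (Real.Gamma a : ℂ) * z ^ (-a : ℂ)) {z : ℂ | 0 < z.re} := by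
    refine DifferentiableOn.analyticOnNhd (fun z hz => ?_) hopen
    exact ((differentiableAt_id.cpow_const (Or.inl hz)).const_mul _).differentiableWithinAt
  refine h1.eqOn_of_preconnected_of_frequently_eq h2 hconv.isPreconnected
    (z₀ := 1) (by simp) ?_ hs
  have htend : Tendsto (fun x : ℝ => (x : ℂ)) (𝓝[≠] 1) (𝓝[≠] 1) := by
    refine tendsto_nhdsWithin_iff.2 ⟨?_, ?_⟩
    · have : Tendsto (fun x : ℝ => (x : ℂ)) (𝓝 1) (𝓝 ((1 : ℝ) : ℂ)) :=
        Complex.continuous_ofReal.tendsto 1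
      rw [Complex.ofReal_one] at this
      exact this.mono_left nhdsWithin_le_nhds
    · filter_upwards [self_mem_nhdsWithin] with x hx
      simpa using hx
  refine htend.frequently (Eventually.frequently ?_)
  have : ∀ᶠ x : ℝ in 𝓝[≠] 1, 0 < x := nhdsWithin_le_nhds (lt_mem_nhds one_pos)
  filter_upwards [this] with r hr
  have h3 := Real.integral_rpow_mul_exp_neg_mul_Ioi ha hr
  have h4 : ∫ t in Ioi (0 : ℝ), ((t ^ (a - 1) : ℝ) : ℂ) * Complex.exp (-(r * t)) =
      ((∫ t in Ioi (0 : ℝ), t ^ (a - 1) * Real.exp (-(r * t)) : ℝ) : ℂ) := by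
    rw [← integral_complex_ofReal]
    congr 1; ext t; push_cast; rfl
  rw [h4, h3, one_div, Real.inv_rpow hr.le, ← Real.rpow_neg hr.le, Complex.ofReal_mul,
    Complex.ofReal_cpow hr.le, mul_comm]
  simp

theorem integrableOn_omega_mul_cexp {a : ℝ} (ha : 0 < a) {s : ℂ} (hs : 0 < s.re) :
    IntegrableOn (fun t : ℝ => (omega a t : ℂ) * Complex.exp (-(s * t))) (Ioi 0) := by
  have := (integrableOn_rpow_mul_cexp ha hs).const_mul ((Real.Gamma a)⁻¹ : ℂ)
  refine this.congr (ae_of_all _ fun t => ?_)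
  simp only [omega, Complex.ofReal_div]; ring

theorem laplace_omega {a : ℝ} (ha : 0 < a) {s : ℂ} (hs : 0 < s.re) :
    ∫ t in Ioi (0 : ℝ), (omega a t : ℂ) * Complex.exp (-(s * t)) = s ^ (-a : ℂ) := by
  have hG : (Real.Gamma a : ℂ) ≠ 0 := by exact_mod_cast (Real.Gamma_pos_of_pos ha).ne'
  have e : (fun t : ℝ => (omega a t : ℂ) * Complex.exp (-(s * t))) =
      fun t : ℝ => (Real.Gamma a : ℂ)⁻¹ *
        (((t ^ (a - 1) : ℝ) : ℂ) * Complex.exp (-(s * t))) := by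
    ext t; simp only [omega, Complex.ofReal_div]; ring
  rw [e, integral_const_mul, laplace_rpow ha hs, inv_mul_cancel_left₀ hG]

theorem integral_norm_omega_mul_cexp {a : ℝ} (ha : 0 < a) {s : ℂ} (hs : 0 < s.re) :
    ∫ t in Ioi (0 : ℝ), ‖(omega a t : ℂ) * Complex.exp (-(s * t))‖ = s.re ^ (-a) := by
  have hG := (Real.Gamma_pos_of_pos ha).ne'
  have e : ∀ t ∈ Ioi (0 : ℝ), ‖(omega a t : ℂ) * Complex.exp (-(s * t))‖ =
      (Real.Gamma a)⁻¹ * (t ^ (a - 1) * Real.exp (-(s.re * t))) := by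
    intro t ht
    rw [norm_mul, Complex.norm_real, Real.norm_of_nonneg (omega_nonneg ha (le_of_lt ht)),
      Complex.norm_exp]
    simp [omega]; ring
  rw [setIntegral_congr_fun measurableSet_Ioi e, integral_const_mul,
    Real.integral_rpow_mul_exp_neg_mul_Ioi ha hs, one_div, Real.inv_rpow hs.le,
    ← Real.rpow_neg hs.le]
  field_simp

/-! ### The symbol `s^{-β-1} (1 + s^{-2β})^{-(j+1)}` on the right half plane -/

/-- The Laplace transform of `∑ₙ C(n+j,j) (-1)ⁿ ω_{2βn+β+1}`. -/
noncomputable def symbol (β : ℝ) (j : ℕ) (s : ℂ) : ℂ :=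
  s ^ (-(β + 1 : ℝ) : ℂ) / (1 + s ^ (-(2 * β : ℝ) : ℂ)) ^ (j + 1)

/-- Expand `‖1 + w‖² = 1 + 2 Re w + ‖w‖²` and use `2‖w‖ ≤ 1 + ‖w‖²`. -/
theorem norm_sq_one_add_ge {κ : ℝ} (hκ0 : 0 ≤ κ) {w : ℂ} (h : -κ * ‖w‖ ≤ w.re) :
    (1 - κ) * (1 + ‖w‖ ^ 2) ≤ ‖1 + w‖ ^ 2 := by
  have e : ‖1 + w‖ ^ 2 = 1 + 2 * w.re + ‖w‖ ^ 2 := by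
    rw [← Complex.normSq_eq_norm_sq, ← Complex.normSq_eq_norm_sq, Complex.normSq_apply,
      Complex.normSq_apply]
    simp; ring
  rw [e]
  nlinarith [mul_nonneg hκ0 (sq_nonneg (1 - ‖w‖))]

/-- For `Re s > 0` the argument of `s^{-2β}` is less than `πβ < π` in modulus, so this number stays
in a sector avoiding the negative axis. The constant `κ` measures the opening of that sector;
`norm_sq_one_add_ge` then bounds `|1 + w|` below by multiples of both `1` and `|w|`. -/
theorem exists_norm_one_add_cpow_ge {β : ℝ} (hβ0 : 0 < β) (hβ1 : β < 1) :
    ∃ δ : ℝ, 0 < δ ∧ ∀ s : ℂ, 0 < s.re →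
      δ ≤ ‖1 + s ^ (-(2 * β : ℝ) : ℂ)‖ ∧
      δ * ‖s‖ ^ (-(2 * β)) ≤ ‖1 + s ^ (-(2 * β : ℝ) : ℂ)‖ := by
  set κ := max 0 (-Real.cos (Real.pi * β)) with hκ
  have hpi := Real.pi_pos
  have hκ1 : κ < 1 := by
    refine max_lt one_pos ?_
    rw [neg_lt, ← Real.cos_pi]
    refine Real.cos_lt_cos_of_nonneg_of_le_pi (by positivity) le_rfl ?_
    nlinarith
  have hκ0 : 0 ≤ κ := le_max_left _ _
  refine ⟨√(1 - κ), Real.sqrt_pos.2 (by linarith), fun s hs => ?_⟩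
  have hs0 : s ≠ 0 := by rintro rfl; simp at hs
  have hsn : 0 < ‖s‖ := norm_pos_iff.2 hs0
  set w := s ^ (-(2 * β : ℝ) : ℂ) with hw
  have hw_norm : ‖w‖ = ‖s‖ ^ (-(2 * β)) := by
    rw [hw, ← Complex.ofReal_neg, Complex.norm_cpow_real]
  have hre : w.re = ‖w‖ * Real.cos (2 * β * s.arg) := by
    rw [hw_norm, hw, Complex.cpow_def_of_ne_zero hs0, Complex.exp_re,
      ← Complex.ofReal_neg, Complex.re_mul_ofReal, Complex.im_mul_ofReal, Complex.log_re,
      Complex.log_im, Real.rpow_def_of_pos hsn]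
    congr 1
    rw [← Real.cos_neg]; congr 1; ring
  have harg : |s.arg| < Real.pi / 2 := Complex.abs_arg_lt_pi_div_two_iff.2 (Or.inl hs)
  have hcos : -κ ≤ Real.cos (2 * β * s.arg) := by
    have h1 : -κ ≤ Real.cos (Real.pi * β) := by
      have := le_max_right 0 (-Real.cos (Real.pi * β)); linarith
    refine h1.trans ?_
    rw [← Real.cos_abs (2 * β * s.arg), abs_mul, abs_of_pos (by linarith : 0 < 2 * β)]
    refine Real.cos_le_cos_of_nonneg_of_le_pi (by positivity) (by nlinarith) (by nlinarith)
  have hmain := norm_sq_one_add_ge hκ0 (w := w) (by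
    rw [hre, mul_comm]
    exact mul_le_mul_of_nonneg_left hcos (norm_nonneg _))
  have h1κ : 0 ≤ 1 - κ := by linarith
  constructor
  · refine (Real.sqrt_le_left (norm_nonneg _)).2 ?_
    nlinarith [mul_nonneg h1κ (sq_nonneg ‖w‖)]
  · rw [← hw_norm]
    refine abs_le_of_sq_le_sq' ?_ (norm_nonneg _) |>.2
    rw [mul_pow, Real.sq_sqrt h1κ]
    nlinarith

/-- For large `|s|` the denominator is bounded below by a constant. For small `|s|` one of its `j +
1` factors is of size `|s|^{-2β}`, which improves the exponent `-β-1` to `β-1`. The majorant depends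
on `Im s` alone, uniformly in `Re s`. -/
theorem exists_norm_symbol_le {β : ℝ} (hβ0 : 0 < β) (hβ1 : β < 1) (j : ℕ) :
    ∃ C : ℝ, 0 < C ∧ ∀ s : ℂ, 0 < s.re → ∀ y : ℝ, y ≠ 0 → |y| ≤ ‖s‖ →
      ‖symbol β j s‖ ≤ C * min (|y| ^ (-β - 1)) (|y| ^ (β - 1)) := by
  obtain ⟨δ, hδ, h⟩ := exists_norm_one_add_cpow_ge hβ0 hβ1
  refine ⟨(δ ^ (j + 1))⁻¹, by positivity, fun s hs y hy hys => ?_⟩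
  obtain ⟨h1, h2⟩ := h s hs
  have hy0 : 0 < |y| := abs_pos.2 hy
  have hsn : 0 < ‖s‖ := hy0.trans_le hys
  have hnum : ‖s ^ (-(β + 1 : ℝ) : ℂ)‖ = ‖s‖ ^ (-β - 1) := by
    rw [← Complex.ofReal_neg, Complex.norm_cpow_real]; congr 1; ring
  have hpow : 0 ≤ ‖s‖ ^ (-β - 1) := Real.rpow_nonneg hsn.le _
  rw [symbol, norm_div, norm_pow, hnum, mul_min_of_nonneg _ _ (by positivity)]
  refine le_min ?_ ?_
  · rw [div_eq_inv_mul]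
    have : ‖s‖ ^ (-β - 1) ≤ |y| ^ (-β - 1) :=
      Real.rpow_le_rpow_of_nonpos hy0 hys (by linarith)
    gcongr
  · have e : ‖s‖ ^ (-β - 1) = ‖s‖ ^ (-(2 * β)) * ‖s‖ ^ (β - 1) := by
      rw [← Real.rpow_add hsn]; congr 1; ring
    have h3 : δ ^ (j + 1) * ‖s‖ ^ (-(2 * β)) ≤ ‖1 + s ^ (-(2 * β : ℝ) : ℂ)‖ ^ (j + 1) := by
      rw [pow_succ, pow_succ, mul_assoc]
      gcongr
    have : ‖s‖ ^ (β - 1) ≤ |y| ^ (β - 1) :=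
      Real.rpow_le_rpow_of_nonpos hy0 hys (by linarith)
    rw [e, div_le_iff₀ (pow_pos (hδ.trans_le h1) _)]
    calc ‖s‖ ^ (-(2 * β)) * ‖s‖ ^ (β - 1)
        = (δ ^ (j + 1))⁻¹ * ‖s‖ ^ (β - 1) * (δ ^ (j + 1) * ‖s‖ ^ (-(2 * β))) := by field_simp
      _ ≤ _ := by gcongr

theorem differentiableAt_symbol {β : ℝ} (hβ0 : 0 < β) (hβ1 : β < 1) (j : ℕ) {s : ℂ}
    (hs : 0 < s.re) : DifferentiableAt ℂ (symbol β j) s := by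
  obtain ⟨δ, hδ, h⟩ := exists_norm_one_add_cpow_ge hβ0 hβ1
  have hne : (1 + s ^ (-(2 * β : ℝ) : ℂ)) ≠ 0 := norm_pos_iff.1 (hδ.trans_le (h s hs).1)
  have h1 (c : ℂ) : DifferentiableAt ℂ (fun z : ℂ => z ^ c) s :=
    differentiableAt_id.cpow_const (Or.inl hs)
  exact (h1 _).div (((h1 _).const_add 1).pow _) (pow_ne_zero _ hne)

theorem integrable_of_even_of_integrableOn_Ioi {f : ℝ → ℝ} (heven : ∀ x, f (-x) = f x)
    (h : IntegrableOn f (Ioi 0)) : Integrable f := by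
  have h2 := h.comp_neg
  simp only [heven, neg_Ioi, neg_zero] at h2
  rw [← integrableOn_univ, ← Iic_union_Ioi (a := (0 : ℝ)), integrableOn_union]
  exact ⟨(integrableOn_Iic_iff_integrableOn_Iio).2 h2, h⟩

/-- `β - 1 > -1` serves near `0`, and `-β - 1 < -1` at infinity. -/
theorem integrable_min_rpow {β : ℝ} (hβ0 : 0 < β) :
    Integrable (fun y : ℝ => min (|y| ^ (-β - 1)) (|y| ^ (β - 1))) := by
  refine integrable_of_even_of_integrableOn_Ioi (by simp) ?_
  have hm : Measurable (fun y : ℝ => min (|y| ^ (-β - 1)) (|y| ^ (β - 1))) := by fun_prop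
  rw [← Ioc_union_Ioi_eq_Ioi (zero_le_one' ℝ), integrableOn_union]
  constructor
  · have h1 : IntegrableOn (fun y : ℝ => y ^ (β - 1)) (Ioc 0 1) :=
      (intervalIntegrable_iff_integrableOn_Ioc_of_le zero_le_one).1
        (intervalIntegral.intervalIntegrable_rpow' (by linarith))
    refine Integrable.mono' h1 hm.aestronglyMeasurable ?_
    filter_upwards [ae_restrict_mem measurableSet_Ioc] with y hy
    rw [Real.norm_of_nonneg (by positivity), abs_of_pos hy.1]
    exact min_le_right _ _
  · have h1 := integrableOn_Ioi_rpow_of_lt (a := -β - 1) (by linarith) one_pos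
    refine Integrable.mono' h1 hm.aestronglyMeasurable ?_
    filter_upwards [ae_restrict_mem measurableSet_Ioi] with y hy
    have hy : 1 < y := hy
    rw [Real.norm_of_nonneg (by positivity), abs_of_pos (by linarith)]
    exact min_le_left _ _

/-! ### Boundedness of the functions `∑ₙ C(n+j,j) (-1)ⁿ ω_{2βn+β+1}` -/

/-- `∑ₙ C(n+j,j) (-1)ⁿ ω_{2βn+β+1}(t)`, a Prabhakar function. -/
noncomputable def prabhakar (β : ℝ) (j : ℕ) (t : ℝ) : ℝ :=
  ∑' n : ℕ, ((n + j).choose j : ℝ) * (-1) ^ n * omega (2 * β * n + β + 1) t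

theorem choose_le_two_pow_mul (n j : ℕ) : ((n + j).choose j : ℝ) ≤ 2 ^ j * 2 ^ n := by
  rw [← pow_add, add_comm j n]
  exact_mod_cast Nat.choose_le_two_pow (n + j) j

theorem exists_prabhakar_bound {β : ℝ} (hβ : β ∈ Ioo (1 / 2 : ℝ) 1) (j : ℕ) {R : ℝ} (hR : 0 ≤ R) :
    ∃ w : ℕ → ℝ, Summable w ∧ ∀ n : ℕ, ∀ t ∈ Icc 0 R,
      ‖((n + j).choose j : ℝ) * (-1) ^ n * omega (2 * β * n + β + 1) t‖ ≤ t ^ β * w n := by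
  obtain ⟨w, hw, h⟩ := exists_summable_omega_bound (α := 2 * β) (b := β) (by linarith [hβ.1])
    (by linarith [hβ.1]) 2 zero_le_two hR
  refine ⟨fun n => 2 ^ j * w n, hw.mul_left _, fun n t ht => ?_⟩
  have hb : 0 < β := by linarith [hβ.1]
  have ho : 0 ≤ omega (2 * β * n + β + 1) t := omega_nonneg (by positivity) ht.1
  rw [norm_mul, norm_mul, norm_pow, norm_neg, norm_one, one_pow, mul_one, Real.norm_of_nonneg ho,
    Real.norm_of_nonneg (by positivity)]
  calc _ ≤ (2 ^ j * 2 ^ n) * omega (2 * β * n + β + 1) t :=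
        mul_le_mul_of_nonneg_right (choose_le_two_pow_mul n j) ho
    _ = 2 ^ j * (2 ^ n * omega (2 * β * n + β + 1) t) := by ring
    _ ≤ 2 ^ j * (t ^ β * w n) := mul_le_mul_of_nonneg_left (h n t ht) (by positivity)
    _ = _ := by ring

theorem summable_prabhakar {β : ℝ} (hβ : β ∈ Ioo (1 / 2 : ℝ) 1) (j : ℕ) {t : ℝ} (ht : 0 ≤ t) :
    Summable fun n : ℕ => ((n + j).choose j : ℝ) * (-1) ^ n * omega (2 * β * n + β + 1) t := by
  obtain ⟨w, hw, h⟩ := exists_prabhakar_bound hβ j ht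
  exact Summable.of_norm_bounded (hw.mul_left (t ^ β)) fun n => h n t ⟨ht, le_rfl⟩

/-- Since the series vanishes at `0`, replacing `t` by `max t 0` is extension by zero to the line;
Fourier inversion needs its continuity. -/
theorem continuous_prabhakar_max {β : ℝ} (hβ : β ∈ Ioo (1 / 2 : ℝ) 1) (j : ℕ) :
    Continuous fun t => prabhakar β j (max t 0) := by
  have hb : 0 < β := by linarith [hβ.1]
  rw [continuous_iff_continuousAt]
  intro t₀
  set R := max (t₀ + 1) 0 with hR
  have hR0 : 0 ≤ R := le_max_right _ _
  obtain ⟨w, hw, h⟩ := exists_prabhakar_bound hβ j hR0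
  have hc : ContinuousOn (fun t => prabhakar β j (max t 0)) (Iio (t₀ + 1)) := by
    refine continuousOn_tsum (u := fun n => R ^ β * w n) (fun n => ?_) (hw.mul_left _) ?_
    · refine Continuous.continuousOn (continuous_const.mul ?_)
      exact (continuous_omega (by nlinarith [mul_nonneg hb.le (Nat.cast_nonneg (α := ℝ) n)])).comp
        (continuous_id.max continuous_const)
    · intro n t ht
      have ht' : max t 0 ∈ Icc 0 R := ⟨le_max_right _ _, max_le_max (le_of_lt ht) le_rfl⟩
      refine (h n _ ht').trans ?_
      have hwn : 0 ≤ R ^ β * w n := (norm_nonneg _).trans (h n R ⟨hR0, le_rfl⟩)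
      rcases hR0.eq_or_lt with h0 | h0
      · have : max t 0 = R := le_antisymm ht'.2 (h0 ▸ ht'.1)
        rw [this]
      · have hw0 : 0 ≤ w n := nonneg_of_mul_nonneg_right hwn (Real.rpow_pos_of_pos h0 _)
        exact mul_le_mul_of_nonneg_right (Real.rpow_le_rpow ht'.1 ht'.2 hb.le) hw0
  exact hc.continuousAt (Iio_mem_nhds (by linarith))

theorem prabhakar_zero {β : ℝ} (hβ : β ∈ Ioo (1 / 2 : ℝ) 1) (j : ℕ) : prabhakar β j 0 = 0 := by
  have hb : 0 < β := by linarith [hβ.1]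
  rw [prabhakar]
  convert tsum_zero with n
  rw [omega_zero_right, mul_zero]
  nlinarith [mul_nonneg hb.le (Nat.cast_nonneg (α := ℝ) n)]

/-- Negative binomial series in `-s^{-2β}`. The condition `Re s > 1` forces `|s^{-2β}| < 1`; this
restricts where the Laplace transform is computed directly. -/
theorem hasSum_symbol {β : ℝ} (hβ : β ∈ Ioo (1 / 2 : ℝ) 1) (j : ℕ) {s : ℂ} (hs : 1 < s.re) :
    HasSum (fun n : ℕ => (((n + j).choose j : ℝ) * (-1) ^ n : ℝ) *
      s ^ (-(2 * β * n + β + 1 : ℝ) : ℂ)) (symbol β j s) := by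
  have hb : 0 < β := by linarith [hβ.1]
  have hs0 : s ≠ 0 := by rintro rfl; simp at hs; linarith
  have hsn : 1 < ‖s‖ := hs.trans_le (Complex.re_le_norm s)
  have hw : ‖-s ^ (-(2 * β : ℝ) : ℂ)‖ < 1 := by
    rw [norm_neg, ← Complex.ofReal_neg, Complex.norm_cpow_real]
    exact Real.rpow_lt_one_of_one_lt_of_neg hsn (by linarith)
  have h := (hasSum_choose_mul_geometric_of_norm_lt_one j hw).mul_left (s ^ (-(β + 1 : ℝ) : ℂ))
  rw [sub_neg_eq_add, mul_one_div] at h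
  refine h.congr_fun ?_
  intro n
  have e : (-(2 * β * n + β + 1 : ℝ) : ℂ) = (-(β + 1 : ℝ) : ℂ) + (n : ℂ) * (-(2 * β : ℝ) : ℂ) := by
    push_cast; ring
  rw [e, Complex.cpow_add _ _ hs0, Complex.cpow_nat_mul, neg_pow (s ^ _)]
  push_cast; ring

theorem summable_choose_mul_rpow {β : ℝ} (hβ : β ∈ Ioo (1 / 2 : ℝ) 1) (j : ℕ) {σ : ℝ} (hσ : 1 < σ) :
    Summable fun n : ℕ => ((n + j).choose j : ℝ) * σ ^ (-(2 * β * n + β + 1)) := by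
  have hb : 0 < β := by linarith [hβ.1]
  have hσ0 : 0 < σ := by linarith
  have hr : ‖σ ^ (-(2 * β))‖ < 1 := by
    rw [Real.norm_of_nonneg (by positivity)]
    exact Real.rpow_lt_one_of_one_lt_of_neg hσ (by linarith)
  have h := (summable_choose_mul_geometric_of_norm_lt_one j hr).mul_right (σ ^ (-(β + 1)))
  refine h.congr fun n => ?_
  rw [mul_assoc, ← Real.rpow_mul_natCast hσ0.le, ← Real.rpow_add hσ0]
  congr 2; ring

theorem integrable_tsum_of_summable_integral_norm {X E : Type*} [MeasurableSpace X]
    {μ : Measure X} [NormedAddCommGroup E] {F : ℕ → X → E}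
    (hF : ∀ i, Integrable (F i) μ) (hs : Summable fun i => ∫ a, ‖F i a‖ ∂μ)
    (hm : AEStronglyMeasurable (fun a => ∑' i, F i a) μ) :
    Integrable (fun a => ∑' i, F i a) μ := by
  refine ⟨hm, ?_⟩
  calc ∫⁻ a, ‖∑' i, F i a‖ₑ ∂μ ≤ ∫⁻ a, ∑' i, ‖F i a‖ₑ ∂μ :=
        lintegral_mono fun a => enorm_tsum_le_tsum_enorm
    _ = ∑' i, ∫⁻ a, ‖F i a‖ₑ ∂μ := lintegral_tsum fun i => (hF i).1.enorm
    _ = ∑' i, ENNReal.ofReal (∫ a, ‖F i a‖ ∂μ) := by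
        simp only [ofReal_integral_norm_eq_lintegral_enorm (hF _)]
    _ < ⊤ := hs.tsum_ofReal_lt_top

theorem laplace_prabhakar {β : ℝ} (hβ : β ∈ Ioo (1 / 2 : ℝ) 1) (j : ℕ) {s : ℂ} (hs : 1 < s.re) :
    IntegrableOn (fun t : ℝ => (prabhakar β j t : ℂ) * Complex.exp (-(s * t))) (Ioi 0) ∧
    ∫ t in Ioi (0 : ℝ), (prabhakar β j t : ℂ) * Complex.exp (-(s * t)) = symbol β j s := by
  have hb : 0 < β := by linarith [hβ.1]
  have hs0 : 0 < s.re := by linarith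
  have ha (n : ℕ) : 0 < 2 * β * n + β + 1 := by positivity
  set F : ℕ → ℝ → ℂ := fun n t => (((n + j).choose j : ℝ) * (-1) ^ n : ℝ) *
    ((omega (2 * β * n + β + 1) t : ℂ) * Complex.exp (-(s * t))) with hF
  have hint (n : ℕ) : Integrable (F n) (volume.restrict (Ioi 0)) :=
    (integrableOn_omega_mul_cexp (ha n) hs0).const_mul _
  have hnorm (n : ℕ) : ∫ t in Ioi (0 : ℝ), ‖F n t‖ =
      ((n + j).choose j : ℝ) * s.re ^ (-(2 * β * n + β + 1)) := by
    simp only [hF, norm_mul (α := ℂ) (((((n + j).choose j : ℝ) * (-1) ^ n : ℝ)) : ℂ)]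
    rw [integral_const_mul, integral_norm_omega_mul_cexp (ha n) hs0]
    simp
  have hsumm : Summable fun n => ∫ t in Ioi (0 : ℝ), ‖F n t‖ := by
    simp only [hnorm]
    exact summable_choose_mul_rpow hβ j hs
  have htsum : ∀ t ∈ Ioi (0 : ℝ), ∑' n, F n t =
      (prabhakar β j t : ℂ) * Complex.exp (-(s * t)) := by
    intro t ht
    simp only [hF, ← mul_assoc]
    rw [tsum_mul_right, prabhakar, Complex.ofReal_tsum]
    simp only [Complex.ofReal_mul]
  have hmeas : AEStronglyMeasurable (fun t => ∑' n, F n t) (volume.restrict (Ioi 0)) := by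
    have h1 : Continuous fun t : ℝ =>
        (prabhakar β j (max t 0) : ℂ) * Complex.exp (-(s * t)) :=
      (Complex.continuous_ofReal.comp (continuous_prabhakar_max hβ j)).mul (by fun_prop)
    refine h1.aestronglyMeasurable.congr ?_
    filter_upwards [ae_restrict_mem measurableSet_Ioi] with t ht
    rw [htsum t ht, max_eq_left (le_of_lt ht)]
  constructor
  · have h1 : Integrable (fun t => ∑' n, F n t) (volume.restrict (Ioi 0)) :=
      integrable_tsum_of_summable_integral_norm hint hsumm hmeas
    exact h1.congr ((ae_restrict_mem measurableSet_Ioi).mono fun t ht => htsum t ht)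
  · have h1 := hasSum_integral_of_summable_integral_norm hint hsumm
    rw [setIntegral_congr_fun measurableSet_Ioi htsum] at h1
    refine h1.unique ((hasSum_symbol hβ j hs).congr_fun fun n => ?_)
    simp only [hF]
    rw [integral_const_mul, laplace_omega (ha n) hs0]

/-- The integrand of the Bromwich integral of `symbol β j`. -/
noncomputable def bromwich (β : ℝ) (j : ℕ) (t : ℝ) (s : ℂ) : ℂ :=
  Complex.exp (s * t) * symbol β j s

theorem differentiableAt_bromwich {β : ℝ} (hβ : β ∈ Ioo (1 / 2 : ℝ) 1) (j : ℕ) (t : ℝ) {s : ℂ}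
    (hs : 0 < s.re) : DifferentiableAt ℂ (bromwich β j t) s := by
  have := differentiableAt_symbol (by linarith [hβ.1]) hβ.2 j hs
  unfold bromwich
  fun_prop

theorem exists_norm_bromwich_le {β : ℝ} (hβ : β ∈ Ioo (1 / 2 : ℝ) 1) (j : ℕ) :
    ∃ C : ℝ, 0 < C ∧ ∀ t σ y : ℝ, 0 < σ → y ≠ 0 →
      ‖bromwich β j t (σ + y * Complex.I)‖ ≤
        Real.exp (σ * t) * (C * min (|y| ^ (-β - 1)) (|y| ^ (β - 1))) := by
  obtain ⟨C, hC, h⟩ := exists_norm_symbol_le (by linarith [hβ.1]) hβ.2 j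
  refine ⟨C, hC, fun t σ y hσ hy => ?_⟩
  have h1 := h (σ + y * Complex.I) (by simpa) y hy (by
    have := Complex.abs_im_le_norm (σ + y * Complex.I); simpa using this)
  rw [bromwich, norm_mul, Complex.norm_exp]
  have e : ((σ + y * Complex.I : ℂ) * t).re = σ * t := by simp
  rw [e]
  gcongr

theorem continuous_bromwich_line {β : ℝ} (hβ : β ∈ Ioo (1 / 2 : ℝ) 1) (j : ℕ) (t : ℝ) {σ : ℝ}
    (hσ : 0 < σ) : Continuous fun y : ℝ => bromwich β j t (σ + y * Complex.I) := by
  rw [continuous_iff_continuousAt]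
  intro y
  have h1 : ContinuousAt (bromwich β j t) (σ + y * Complex.I) :=
    (differentiableAt_bromwich hβ j t (by simpa)).continuousAt
  exact ContinuousAt.comp (f := fun y : ℝ => (σ + y * Complex.I : ℂ)) h1
    (by fun_prop : Continuous fun y : ℝ => (σ + y * Complex.I : ℂ)).continuousAt

theorem integrable_bromwich_line {β : ℝ} (hβ : β ∈ Ioo (1 / 2 : ℝ) 1) (j : ℕ) (t : ℝ) {σ : ℝ}
    (hσ : 0 < σ) : Integrable fun y : ℝ => bromwich β j t (σ + y * Complex.I) := by
  obtain ⟨C, hC, h⟩ := exists_norm_bromwich_le hβ j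
  refine Integrable.mono' (((integrable_min_rpow (β := β) (by linarith [hβ.1])).const_mul C).const_mul
    (Real.exp (σ * t))) (continuous_bromwich_line hβ j t hσ).aestronglyMeasurable ?_
  filter_upwards [Measure.ae_ne volume (0 : ℝ)] with y hy
  exact h t σ y hσ hy

theorem tendsto_bromwich_horizontal {β : ℝ} (hβ : β ∈ Ioo (1 / 2 : ℝ) 1) (j : ℕ) {t : ℝ}
    (ht : 0 < t) {σ τ : ℝ} (hσ : 0 < σ) (hστ : σ ≤ τ) (ε : ℝ) (hε : |ε| = 1) :
    Tendsto (fun R : ℝ => ∫ x in σ..τ, bromwich β j t (x + (ε * R : ℝ) * Complex.I))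
      atTop (𝓝 0) := by
  obtain ⟨C, hC, h⟩ := exists_norm_bromwich_le hβ j
  have hb : 0 < β := by linarith [hβ.1]
  have hlim : Tendsto (fun R : ℝ => (Real.exp (τ * t) * (C * R ^ (-(β + 1)))) * |τ - σ|)
      atTop (𝓝 0) := by
    have := (((tendsto_rpow_neg_atTop (y := β + 1) (by linarith)).const_mul C).const_mul
      (Real.exp (τ * t))).mul_const |τ - σ|
    simpa using this
  refine squeeze_zero_norm' ?_ hlim
  filter_upwards [eventually_gt_atTop 0] with R hR
  refine intervalIntegral.norm_integral_le_of_norm_le_const fun x hx => ?_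
  rw [uIoc_of_le hστ] at hx
  have hx0 : 0 < x := hσ.trans hx.1
  have habs : |ε * R| = R := by rw [abs_mul, hε, one_mul, abs_of_pos hR]
  refine (h t x (ε * R) hx0 (abs_pos.1 (habs.symm ▸ hR : 0 < |ε * R|))).trans ?_
  rw [habs]
  have h1 : min (R ^ (-β - 1)) (R ^ (β - 1)) ≤ R ^ (-(β + 1)) := by
    refine (min_le_left _ _).trans_eq ?_
    congr 1; ring
  have hx2 := hx.2
  have : 0 ≤ min (R ^ (-β - 1)) (R ^ (β - 1)) := by positivity
  gcongr

/-- Cauchy's theorem on rectangles between the two lines: the integrand is holomorphic for `Re s >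
0`, and the horizontal sides are `O(R^{-β-1})`. -/
theorem integral_bromwich_line_eq {β : ℝ} (hβ : β ∈ Ioo (1 / 2 : ℝ) 1) (j : ℕ) {t : ℝ}
    (ht : 0 < t) {σ τ : ℝ} (hσ : 0 < σ) (hστ : σ ≤ τ) :
    ∫ y : ℝ, bromwich β j t (σ + y * Complex.I) = ∫ y : ℝ, bromwich β j t (τ + y * Complex.I) := by
  have hrect (R : ℝ) := Complex.integral_boundary_rect_eq_zero_of_differentiableOn
    (bromwich β j t) (σ + (-1 * R : ℝ) * Complex.I) (τ + (1 * R : ℝ) * Complex.I) (by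
      intro z hz
      have hz1 : z.re ∈ uIcc σ τ := by simpa using hz.1
      rw [uIcc_of_le hστ] at hz1
      exact (differentiableAt_bromwich hβ j t (hσ.trans_le hz1.1)).differentiableWithinAt)
  have hl : Tendsto (fun R : ℝ => -1 * R) atTop atBot := by
    simpa using tendsto_neg_atTop_atBot
  have hr : Tendsto (fun R : ℝ => 1 * R) atTop atTop := by
    simp only [one_mul]; exact tendsto_id
  have hlim := (((tendsto_bromwich_horizontal hβ j ht hσ hστ (-1) (by simp)).sub
    (tendsto_bromwich_horizontal hβ j ht hσ hστ 1 (by simp))).add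
    ((intervalIntegral_tendsto_integral
      (integrable_bromwich_line hβ j t (hσ.trans_le hστ)) hl hr).const_smul Complex.I)).sub
    ((intervalIntegral_tendsto_integral
      (integrable_bromwich_line hβ j t hσ) hl hr).const_smul Complex.I)
  have hzero : Tendsto (fun _ : ℝ => (0 : ℂ)) atTop (𝓝 0) := tendsto_const_nhds
  have huniq := tendsto_nhds_unique (hlim.congr fun R => ?_) hzero
  · rw [sub_zero, zero_add, sub_eq_zero] at huniq
    have := mul_left_cancel₀ Complex.I_ne_zero huniq
    exact this.symm
  · have := hrect R
    simpa using this

/-- Laplace inversion as Fourier inversion of `e^{-2t}` times the function extended by zero. The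
abscissa `2` is a choice exceeding `1`, where `laplace_prabhakar` holds. -/
theorem prabhakar_eq_integral {β : ℝ} (hβ : β ∈ Ioo (1 / 2 : ℝ) 1) (j : ℕ) {t : ℝ} (ht : 0 < t) :
    (prabhakar β j t : ℂ) =
      (2 * Real.pi)⁻¹ • ∫ y : ℝ, bromwich β j t ((2 : ℝ) + y * Complex.I) := by
  set f : ℝ → ℂ := fun t => (prabhakar β j (max t 0) : ℂ) * Complex.exp (-(2 * t)) with hf
  have hcont : Continuous f :=
    (Complex.continuous_ofReal.comp (continuous_prabhakar_max hβ j)).mul (by fun_prop)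
  have hf0 : ∀ x ∉ Ioi (0 : ℝ), f x = 0 := by
    intro x hx
    simp only [hf]
    rw [max_eq_right (not_lt.1 hx), prabhakar_zero hβ]; simp
  have hfint : Integrable f := by
    have h1 := (laplace_prabhakar hβ j (s := 2) (by simp)).1
    refine (integrableOn_iff_integrable_of_support_subset (s := Ioi 0) ?_).1
      (h1.congr_fun (fun x hx => ?_) measurableSet_Ioi)
    · intro x hx
      by_contra h
      exact hx (hf0 x h)
    · simp only [hf]
      rw [max_eq_left (le_of_lt hx)]
  have hfour : FourierTransform.fourier f =
      fun ξ : ℝ => symbol β j ((2 : ℝ) + (2 * Real.pi * ξ : ℝ) * Complex.I) := by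
    ext ξ
    rw [Real.fourier_eq', ← setIntegral_eq_integral_of_forall_compl_eq_zero (s := Ioi 0)
      (fun x hx => by rw [hf0 x hx, smul_zero]),
      ← (laplace_prabhakar hβ j (s := (2 : ℝ) + (2 * Real.pi * ξ : ℝ) * Complex.I) (by simp)).2]
    refine setIntegral_congr_fun measurableSet_Ioi fun x hx => ?_
    simp only [hf, smul_eq_mul]
    rw [max_eq_left (le_of_lt hx), mul_left_comm, ← Complex.exp_add]
    congr 2
    simp; ring
  have hbr (ξ : ℝ) : symbol β j ((2 : ℝ) + (2 * Real.pi * ξ : ℝ) * Complex.I) =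
      bromwich β j 0 ((2 : ℝ) + (2 * Real.pi * ξ : ℝ) * Complex.I) := by
    simp [bromwich]
  have hfourint : Integrable (FourierTransform.fourier f) := by
    rw [hfour]
    simp only [hbr]
    exact (integrable_bromwich_line hβ j 0 two_pos).comp_mul_left' (R := 2 * Real.pi)
      (by positivity)
  have hinv := congrFun (hcont.fourierInv_fourier_eq hfint hfourint) t
  rw [Real.fourierInv_eq', hfour] at hinv
  have hft : f t = (prabhakar β j t : ℂ) * Complex.exp (-(2 * t)) := by
    simp only [hf]; rw [max_eq_left ht.le]
  have hpt (ξ : ℝ) : Complex.exp (2 * t) * (Complex.exp ((2 * Real.pi * inner ℝ ξ t : ℝ) * Complex.I) •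
      symbol β j ((2 : ℝ) + (2 * Real.pi * ξ : ℝ) * Complex.I)) =
      bromwich β j t ((2 : ℝ) + (2 * Real.pi * ξ : ℝ) * Complex.I) := by
    rw [bromwich, smul_eq_mul, ← mul_assoc, ← Complex.exp_add]
    congr 2
    simp; ring
  have h1 : (prabhakar β j t : ℂ) = Complex.exp (2 * t) * f t := by
    rw [hft, mul_left_comm, ← Complex.exp_add]; simp
  rw [h1, ← hinv, ← integral_const_mul]
  simp only [hpt]
  have := Measure.integral_comp_mul_left
    (fun y : ℝ => bromwich β j t ((2 : ℝ) + y * Complex.I)) (2 * Real.pi)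
  rw [this, abs_of_pos (by positivity)]

/-- The Prabhakar functions are bounded on the half line. -/
theorem exists_prabhakar_le {β : ℝ} (hβ : β ∈ Ioo (1 / 2 : ℝ) 1) (j : ℕ) :
    ∃ C : ℝ, 0 < C ∧ ∀ t : ℝ, 0 < t → |prabhakar β j t| ≤ C := by
  obtain ⟨C, hC, h⟩ := exists_norm_bromwich_le hβ j
  set I : ℝ := ∫ y : ℝ, min (|y| ^ (-β - 1)) (|y| ^ (β - 1)) with hI
  have hI0 : 0 ≤ I := integral_nonneg fun y => by positivity
  refine ⟨(2 * Real.pi)⁻¹ * (C * I) + 1, by positivity, fun t ht => ?_⟩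
  -- After shifting from abscissa `2` to `σ`, the bound depends on `σ` through `e^{σt}` only; `σ →
  -- 0` removes all growth in `t`. The `+ 1` in the constant only secures positivity.
  have key (σ : ℝ) (hσ : σ ∈ Ioc (0 : ℝ) 2) :
      |prabhakar β j t| ≤ (2 * Real.pi)⁻¹ * (Real.exp (σ * t) * (C * I)) := by
    rw [← Real.norm_eq_abs, ← Complex.norm_real, prabhakar_eq_integral hβ j ht,
      ← integral_bromwich_line_eq hβ j ht hσ.1 hσ.2, norm_smul,
      Real.norm_of_nonneg (by positivity)]
    gcongr
    rw [hI, ← integral_const_mul, ← integral_const_mul]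
    refine norm_integral_le_of_norm_le
      (((integrable_min_rpow (β := β) (by linarith [hβ.1])).const_mul C).const_mul _) ?_
    filter_upwards [Measure.ae_ne volume (0 : ℝ)] with y hy
    exact h t σ y hσ.1 hy
  have hlim : Tendsto (fun σ : ℝ => (2 * Real.pi)⁻¹ * (Real.exp (σ * t) * (C * I))) (𝓝[>] 0)
      (𝓝 ((2 * Real.pi)⁻¹ * (Real.exp (0 * t) * (C * I)))) := by
    refine tendsto_nhdsWithin_of_tendsto_nhds (Continuous.tendsto ?_ 0)
    fun_prop
  have := ge_of_tendsto hlim (by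
    filter_upwards [Ioc_mem_nhdsGT (two_pos (α := ℝ))] with σ hσ
    exact key σ hσ)
  rw [zero_mul, Real.exp_zero, one_mul] at this
  linarith

/-- For `t ≤ 1` the bound `C t^β` is read off the series; for `t ≥ 1` it follows from boundedness.
-/
theorem exists_prabhakar_le_rpow {β : ℝ} (hβ : β ∈ Ioo (1 / 2 : ℝ) 1) (j : ℕ) :
    ∃ C : ℝ, 0 ≤ C ∧ ∀ t : ℝ, 0 < t → |prabhakar β j t| ≤ C ∧ |prabhakar β j t| ≤ C * t ^ β := by
  have hb : 0 < β := by linarith [hβ.1]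
  obtain ⟨C, hC, h⟩ := exists_prabhakar_le hβ j
  obtain ⟨w, hw, h1⟩ := exists_prabhakar_bound hβ j zero_le_one
  refine ⟨max C (∑' n, w n), hC.le.trans (le_max_left _ _), fun t ht => ⟨(h t ht).trans
    (le_max_left _ _), ?_⟩⟩
  rcases le_total t 1 with h2 | h2
  · have h3 : |prabhakar β j t| ≤ ∑' n, t ^ β * w n :=
      tsum_of_norm_bounded (hw.mul_left _).hasSum fun n => h1 n t ⟨ht.le, h2⟩
    rw [tsum_mul_left, mul_comm] at h3
    exact h3.trans (mul_le_mul_of_nonneg_right (le_max_right _ _) (by positivity))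
  · refine ((h t ht).trans (le_max_left C (∑' n, w n))).trans ?_
    exact le_mul_of_one_le_right (hC.le.trans (le_max_left _ _)) (Real.one_le_rpow h2 hb.le)

theorem cast_add_choose_one (n : ℕ) : ((n + 1).choose 1 : ℝ) = n + 1 := by simp

theorem cast_add_choose_two (n : ℕ) : ((n + 2).choose 2 : ℝ) = (n + 1) * (n + 2) / 2 := by
  have := Nat.ascFactorial_eq_factorial_mul_choose n 2
  simp only [Nat.ascFactorial, Nat.factorial] at this
  have h : (((n + 1 + 1) * ((n + 1 + 0) * 1) : ℕ) : ℝ) = ((2 * (1 * 1) * (n + 2).choose 2 : ℕ) : ℝ) := by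
    exact_mod_cast this
  push_cast at h
  linarith

theorem cast_add_choose_three (n : ℕ) :
    ((n + 3).choose 3 : ℝ) = (n + 1) * (n + 2) * (n + 3) / 6 := by
  have := Nat.ascFactorial_eq_factorial_mul_choose n 3
  simp only [Nat.ascFactorial, Nat.factorial] at this
  have h : (((n + 1 + 2) * ((n + 1 + 1) * ((n + 1 + 0) * 1)) : ℕ) : ℝ) =
      ((3 * (2 * (1 * 1)) * (n + 3).choose 3 : ℕ) : ℝ) := by
    exact_mod_cast this
  push_cast at h
  linarith

/-- Series `∑ₙ q(n) (-1)ⁿ ω_{2βn+β+1}` with a cubic polynomial `q` are bounded. -/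
theorem exists_cubic_series_le {β : ℝ} (hβ : β ∈ Ioo (1 / 2 : ℝ) 1) (a₀ a₁ a₂ a₃ : ℝ) :
    ∃ C : ℝ, 0 ≤ C ∧ ∀ t : ℝ, 0 < t → ∀ S : ℝ,
      HasSum (fun n : ℕ => (a₀ + a₁ * n + a₂ * n ^ 2 + a₃ * n ^ 3) * (-1) ^ n *
        omega (2 * β * n + β + 1) t) S → |S| ≤ C ∧ |S| ≤ C * t ^ β := by
  obtain ⟨C₀, hC₀, h₀⟩ := exists_prabhakar_le_rpow hβ 0
  obtain ⟨C₁, hC₁, h₁⟩ := exists_prabhakar_le_rpow hβ 1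
  obtain ⟨C₂, hC₂, h₂⟩ := exists_prabhakar_le_rpow hβ 2
  obtain ⟨C₃, hC₃, h₃⟩ := exists_prabhakar_le_rpow hβ 3
  -- Coordinates of the cubic in the basis `C(n+j, j)`, `j = 0, 1, 2, 3`.
  set b₀ := a₀ - a₁ + a₂ - a₃
  set b₁ := a₁ - 3 * a₂ + 7 * a₃
  set b₂ := 2 * a₂ - 12 * a₃
  set b₃ := 6 * a₃
  refine ⟨|b₀| * C₀ + |b₁| * C₁ + |b₂| * C₂ + |b₃| * C₃, by positivity, fun t ht S hS => ?_⟩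
  have e : S = b₀ * prabhakar β 0 t + b₁ * prabhakar β 1 t + b₂ * prabhakar β 2 t +
      b₃ * prabhakar β 3 t := by
    have hs (j : ℕ) := (summable_prabhakar hβ j ht.le).hasSum
    refine hS.unique ((((((hs 0).mul_left b₀).add ((hs 1).mul_left b₁)).add
      ((hs 2).mul_left b₂)).add ((hs 3).mul_left b₃)).congr_fun fun n => ?_)
    rw [cast_add_choose_three, cast_add_choose_two, cast_add_choose_one, add_zero,
      Nat.choose_zero_right]
    simp only [b₀, b₁, b₂, b₃]
    push_cast
    ring
  have habs : |S| ≤ |b₀| * |prabhakar β 0 t| + |b₁| * |prabhakar β 1 t| +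
      |b₂| * |prabhakar β 2 t| + |b₃| * |prabhakar β 3 t| := by
    rw [e, ← abs_mul, ← abs_mul, ← abs_mul, ← abs_mul]
    exact (abs_add_le _ _).trans (add_le_add_left ((abs_add_le _ _).trans
      (add_le_add_left (abs_add_le _ _) _)) _)
  constructor
  · refine habs.trans ?_
    gcongr
    exacts [(h₀ t ht).1, (h₁ t ht).1, (h₂ t ht).1, (h₃ t ht).1]
  · refine habs.trans ?_
    rw [add_mul, add_mul, add_mul, mul_assoc, mul_assoc, mul_assoc, mul_assoc]
    gcongr
    exacts [(h₀ t ht).2, (h₁ t ht).2, (h₂ t ht).2, (h₃ t ht).2]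

/-! ### Mittag-Leffler type series -/

/-- `∑ₖ (-lam)ᵏ ω_{2βk+μ}(t) = t^{μ-1} E_{2β,μ}(-lam t^{2β})`. -/
noncomputable def mlSeries (β μ lam t : ℝ) : ℝ :=
  ∑' k : ℕ, (-lam) ^ k * omega (2 * β * k + μ) t

/-- Iterates `omega_sub_one`: each lowering of the order costs a factor `|x - i| / t ≤ (x + m) / t`.
The induction keeps the bound `M` separate from the running index `i`. -/
theorem abs_omega_sub_nat_le {x t : ℝ} (hx : 0 ≤ x) (ht : 0 < t) (m : ℕ) :
    |omega (x + 1 - m) t| ≤ (t ^ m)⁻¹ * (x + m) ^ m * omega (x + 1) t := by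
  have hgen (M : ℕ) (i : ℕ) (hi : i ≤ M) :
      |omega (x + 1 - i) t| ≤ (t ^ i)⁻¹ * (x + M) ^ i * omega (x + 1) t := by
    induction i with
    | zero => simp [abs_of_nonneg (omega_nonneg (by linarith : 0 < x + 1) ht.le)]
    | succ i ih =>
      have h := omega_sub_one (x + 1 - i) ht
      have e : x + 1 - (i + 1 : ℕ) = x + 1 - i - 1 := by push_cast; ring
      rw [e]
      have h2 : t * |omega (x + 1 - i - 1) t| = |x - i| * |omega (x + 1 - i) t| := by
        rw [← abs_of_pos ht, ← abs_mul, abs_of_pos ht, h, abs_mul]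
        congr 2; ring
      have hi' : (i : ℝ) + 1 ≤ M := by exact_mod_cast hi
      have h3 : |x - i| ≤ x + M := by
        rw [abs_le]; constructor <;> linarith
      have h4 := ih (by omega)
      have h5 : t * |omega (x + 1 - i - 1) t| ≤
          (x + M) * ((t ^ i)⁻¹ * (x + M) ^ i * omega (x + 1) t) := by
        rw [h2]
        exact mul_le_mul h3 h4 (abs_nonneg _) (by positivity)
      rw [← le_div_iff₀' ht] at h5
      refine h5.trans_eq ?_
      field_simp
      ring
  exact hgen m m le_rfl

/-- The polynomial loss `(2βk+b+m)^m` is at most `m! e^{b+m} (e^{2β})^k`, so it is absorbed by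
enlarging the base `|lam|` to `|lam| e^{2β}`. Lowered orders may be singular at `0`, whence `r > 0`.
-/
theorem exists_mlSeries_bound {β b : ℝ} (hβ : 1 / 2 ≤ β) (hb : 0 ≤ b) (m : ℕ) (lam : ℝ)
    {r R : ℝ} (hr : 0 < r) :
    ∃ w : ℕ → ℝ, Summable w ∧ ∀ k : ℕ, ∀ t ∈ Icc r R,
      ‖(-lam) ^ k * omega (2 * β * k + (b + 1 - m)) t‖ ≤ w k := by
  rcases lt_or_ge R r with hR | hrR
  · exact ⟨0, summable_zero, fun k t ht => absurd (ht.1.trans ht.2) (not_le.2 hR)⟩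
  have hR : 0 ≤ R := hr.le.trans hrR
  obtain ⟨w, hw, h⟩ := exists_summable_omega_bound (α := 2 * β) (b := b) (by linarith) hb
    (|lam| * Real.exp (2 * β)) (by positivity) hR
  refine ⟨fun k => (r ^ m)⁻¹ * (m.factorial * Real.exp (b + m)) * (R ^ b * w k),
    (hw.mul_left _).mul_left _, fun k t ht => ?_⟩
  have ht0 : 0 < t := hr.trans_le ht.1
  have hx : 0 ≤ 2 * β * k + b := by positivity
  have h1 := abs_omega_sub_nat_le hx ht0 m
  have e : 2 * β * k + b + 1 - m = 2 * β * k + (b + 1 - m) := by ring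
  rw [e] at h1
  have h2 : (2 * β * k + b + m) ^ m ≤
      m.factorial * Real.exp (b + m) * Real.exp (2 * β) ^ k := by
    have := Real.pow_div_factorial_le_exp (2 * β * k + b + m) (by positivity) m
    rw [div_le_iff₀ (by positivity)] at this
    refine this.trans_eq ?_
    rw [← Real.exp_nat_mul, show 2 * β * k + b + m = (b + m) + k * (2 * β) by ring, Real.exp_add]
    ring
  have ho : 0 ≤ omega (2 * β * k + b + 1) t := omega_nonneg (by linarith) ht0.le
  have h3 := h k t ⟨ht0.le, ht.2⟩
  have hwk : 0 ≤ w k := by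
    have : 0 ≤ t ^ b * w k := le_trans (by positivity) h3
    exact nonneg_of_mul_nonneg_right this (by positivity)
  rw [norm_mul, norm_pow, norm_neg, Real.norm_eq_abs, Real.norm_eq_abs]
  calc |lam| ^ k * |omega (2 * β * k + (b + 1 - m)) t|
      ≤ |lam| ^ k * ((t ^ m)⁻¹ * (m.factorial * Real.exp (b + m) * Real.exp (2 * β) ^ k) *
          omega (2 * β * k + b + 1) t) := by
        refine mul_le_mul_of_nonneg_left (h1.trans ?_) (by positivity)
        gcongr
    _ = (t ^ m)⁻¹ * (m.factorial * Real.exp (b + m)) *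
          ((|lam| * Real.exp (2 * β)) ^ k * omega (2 * β * k + b + 1) t) := by
        rw [mul_pow]; ring
    _ ≤ (r ^ m)⁻¹ * (m.factorial * Real.exp (b + m)) * (R ^ b * w k) := by
        have h4 : t ^ b * w k ≤ R ^ b * w k := by
          gcongr; exact ht.2
        have h5 := ht.1
        exact mul_le_mul (by gcongr) (h3.trans h4) (by positivity) (by positivity)

theorem summable_mlSeries {β b : ℝ} (hβ : 1 / 2 ≤ β) (hb : 0 ≤ b) (m : ℕ) (lam : ℝ)
    {t : ℝ} (ht : 0 < t) :
    Summable fun k : ℕ => (-lam) ^ k * omega (2 * β * k + (b + 1 - m)) t := by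
  obtain ⟨w, hw, h⟩ := exists_mlSeries_bound hβ hb m lam (R := t) ht
  exact Summable.of_norm_bounded hw fun k => h k t ⟨le_rfl, le_rfl⟩

/-- Orders are written `b + 1 - m` so that differentiation is `m ↦ m + 1` with the same `b`; the
cases needed are `b = β` and `b = β + 1`. -/
theorem hasDerivAt_mlSeries {β b : ℝ} (hβ : 1 / 2 ≤ β) (hb : 0 ≤ b) (m : ℕ) (lam : ℝ)
    {t : ℝ} (ht : 0 < t) :
    HasDerivAt (mlSeries β (b + 1 - m) lam) (mlSeries β (b + 1 - (m + 1 : ℕ)) lam t) t := by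
  obtain ⟨w, hw, h⟩ := exists_mlSeries_bound hβ hb (m + 1) lam (r := t / 2) (R := 2 * t)
    (by linarith)
  have hmem : t ∈ Ioo (t / 2) (2 * t) := ⟨by linarith, by linarith⟩
  refine hasDerivAt_tsum_of_isPreconnected (t := Ioo (t / 2) (2 * t)) hw isOpen_Ioo
    isPreconnected_Ioo (fun k y hy => ?_) (fun k y hy => h k y (Ioo_subset_Icc_self hy)) hmem
    (summable_mlSeries hβ hb m lam ht) hmem
  have hy0 : 0 < y := by linarith [hy.1]
  have := (hasDerivAt_omega (2 * β * k + (b + 1 - m)) hy0).const_mul ((-lam) ^ k)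
  rwa [show 2 * β * k + (b + 1 - m) - 1 = 2 * β * k + (b + 1 - (m + 1 : ℕ)) by
    push_cast; ring] at this

/-- Homogeneity of the kernels: time is rescaled so that `lam t^{2β}` becomes `τ^{2β}`. It reduces
bounds uniform in the eigenvalue to `lam = 1`. -/
theorem mlSeries_eq_scaled {β : ℝ} (hβ : 0 < β) (μ : ℝ) {lam t : ℝ} (hl : 0 < lam) (ht : 0 < t) :
    mlSeries β μ lam t =
      lam ^ (-((μ - 1) / (2 * β))) * mlSeries β μ 1 (lam ^ (1 / (2 * β)) * t) := by
  rw [mlSeries, mlSeries, ← tsum_mul_left]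
  congr 1; ext k
  rw [omega_mul _ (by positivity) ht.le, neg_pow lam, ← Real.rpow_mul hl.le]
  have e : lam ^ k = lam ^ (-((μ - 1) / (2 * β))) * lam ^ (1 / (2 * β) * (2 * β * k + μ - 1)) := by
    rw [← Real.rpow_add hl, ← Real.rpow_natCast]
    congr 1; field_simp; ring
  rw [e]; ring

/-- Multiplying by `t^m` restores all kernels to order `2βk + β + 1` at the price of a polynomial in
`k` of degree `m`; `m ≤ 3` keeps it within reach of `exists_cubic_series_le`. -/
theorem exists_pow_mul_mlSeries_one_le {β : ℝ} (hβ : β ∈ Ioo (1 / 2 : ℝ) 1) {m : ℕ} (hm : m ≤ 3) :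
    ∃ C : ℝ, 0 ≤ C ∧ ∀ t : ℝ, 0 < t →
      t ^ m * |mlSeries β (β + 1 - m) 1 t| ≤ C ∧
      t ^ m * |mlSeries β (β + 1 - m) 1 t| ≤ C * t ^ β := by
  have hb : 0 < β := by linarith [hβ.1]
  have key : ∃ a₀ a₁ a₂ a₃ : ℝ, ∀ t : ℝ, 0 < t → ∀ k : ℕ,
      t ^ m * omega (2 * β * k + (β + 1 - m)) t =
        (a₀ + a₁ * k + a₂ * k ^ 2 + a₃ * k ^ 3) * omega (2 * β * k + β + 1) t := by
    have h1 (t : ℝ) (ht : 0 < t) (k : ℕ) : t * omega (2 * β * k + β) t =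
        (2 * β * k + β) * omega (2 * β * k + β + 1) t := by
      have := omega_sub_one (2 * β * k + β + 1) ht
      simpa using this
    have h2 (t : ℝ) (ht : 0 < t) (k : ℕ) : t * omega (2 * β * k + β - 1) t =
        (2 * β * k + β - 1) * omega (2 * β * k + β) t := omega_sub_one _ ht
    have h3 (t : ℝ) (ht : 0 < t) (k : ℕ) : t * omega (2 * β * k + β - 2) t =
        (2 * β * k + β - 2) * omega (2 * β * k + β - 1) t := by
      have := omega_sub_one (2 * β * k + β - 1) ht
      rw [show 2 * β * k + β - 1 - 1 = 2 * β * k + β - 2 by ring] at this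
      exact this
    -- The witnesses are the coefficients in `k` of the product of `2βk + β - i` over `i < m`.
    interval_cases m
    · refine ⟨1, 0, 0, 0, fun t ht k => ?_⟩
      rw [show 2 * β * k + (β + 1 - (0 : ℕ)) = 2 * β * k + β + 1 by push_cast; ring]
      ring
    · refine ⟨β, 2 * β, 0, 0, fun t ht k => ?_⟩
      rw [show 2 * β * k + (β + 1 - (1 : ℕ)) = 2 * β * k + β by push_cast; ring, pow_one, h1 t ht]
      ring
    · refine ⟨β * (β - 1), 2 * β * (2 * β - 1), 4 * β ^ 2, 0, fun t ht k => ?_⟩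
      rw [show 2 * β * k + (β + 1 - (2 : ℕ)) = 2 * β * k + β - 1 by push_cast; ring]
      linear_combination t * h2 t ht k + (2 * β * k + β - 1) * h1 t ht k
    · refine ⟨β * (β - 1) * (β - 2), 2 * β * (3 * β ^ 2 - 6 * β + 2), 4 * β ^ 2 * (3 * β - 3),
        8 * β ^ 3, fun t ht k => ?_⟩
      rw [show 2 * β * k + (β + 1 - (3 : ℕ)) = 2 * β * k + β - 2 by push_cast; ring]
      linear_combination t ^ 2 * h3 t ht k + t * (2 * β * k + β - 2) * h2 t ht k +
        (2 * β * k + β - 2) * (2 * β * k + β - 1) * h1 t ht k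
  obtain ⟨a₀, a₁, a₂, a₃, hk⟩ := key
  obtain ⟨C, hC, h⟩ := exists_cubic_series_le hβ a₀ a₁ a₂ a₃
  refine ⟨C, hC, fun t ht => ?_⟩
  have hs := ((summable_mlSeries hβ.1.le hb.le m 1 ht).hasSum).mul_left (t ^ m)
  have := h t ht (t ^ m * mlSeries β (β + 1 - m) 1 t) (hs.congr_fun fun k => by
    rw [mul_left_comm, hk t ht k]; ring)
  rwa [abs_mul, abs_of_pos (by positivity : 0 < t ^ m)] at this

/-- The order `β + 2` lies above the family already bounded. The function vanishes at `0+` and its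
derivative, of order `β + 1`, is bounded, so the mean value inequality gives linear growth. -/
theorem exists_mlSeries_two_le {β : ℝ} (hβ : β ∈ Ioo (1 / 2 : ℝ) 1) :
    ∃ C : ℝ, 0 ≤ C ∧ ∀ t : ℝ, 0 < t → |mlSeries β (β + 2) 1 t| ≤ C * t := by
  have hb : 0 < β := by linarith [hβ.1]
  obtain ⟨C, hC, h⟩ := exists_pow_mul_mlSeries_one_le hβ (m := 0) (by norm_num)
  refine ⟨C, hC, fun t ht => ?_⟩
  obtain ⟨w, hw, hbd⟩ := exists_summable_omega_bound (α := 2 * β) (b := β + 1) (by linarith [hβ.1])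
    (by linarith) 1 zero_le_one ht.le
  have h0 : Tendsto (mlSeries β (β + 2) 1) (𝓝[>] 0) (𝓝 0) := by
    have hlim : Tendsto (fun s : ℝ => s ^ (β + 1) * ∑' n, w n) (𝓝[>] 0)
        (𝓝 ((0 : ℝ) ^ (β + 1) * ∑' n, w n)) :=
      (((Real.continuous_rpow_const (by linarith : 0 ≤ β + 1)).tendsto 0).mul_const _).mono_left
        nhdsWithin_le_nhds
    rw [Real.zero_rpow (by linarith), zero_mul] at hlim
    refine squeeze_zero_norm' ?_ hlim
    filter_upwards [Ioc_mem_nhdsGT ht] with s hs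
    rw [← tsum_mul_left]
    refine tsum_of_norm_bounded (hw.mul_left _).hasSum fun k => ?_
    have hsb := hbd k s ⟨hs.1.le, hs.2⟩
    rw [norm_mul, norm_pow, norm_neg, norm_one]
    rw [show 2 * β * k + (β + 2) = 2 * β * k + (β + 1) + 1 by ring,
      Real.norm_of_nonneg (omega_nonneg (by positivity) hs.1.le)]
    exact hsb
  have hder (s : ℝ) (hs : 0 < s) :
      HasDerivAt (mlSeries β (β + 2) 1) (mlSeries β (β + 1 - (0 : ℕ)) 1 s) s := by
    have := hasDerivAt_mlSeries hβ.1.le (by linarith : 0 ≤ β + 1) 0 1 hs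
    convert this using 2 <;> push_cast <;> ring
  have hdiff (s : ℝ) (hs : s ∈ Ioc 0 t) :
      |mlSeries β (β + 2) 1 t - mlSeries β (β + 2) 1 s| ≤ C * t := by
    have := (convex_Icc s t).norm_image_sub_le_of_norm_hasDerivWithin_le (C := C)
      (f := mlSeries β (β + 2) 1) (f' := fun s => mlSeries β (β + 1 - (0 : ℕ)) 1 s)
      (fun x hx => (hder x (hs.1.trans_le hx.1)).hasDerivWithinAt)
      (fun x hx => by have := (h x (hs.1.trans_le hx.1)).1; simpa using this)
      (left_mem_Icc.2 hs.2) (right_mem_Icc.2 hs.2)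
    refine this.trans ?_
    rw [Real.norm_of_nonneg (by linarith [hs.2])]
    exact mul_le_mul_of_nonneg_left (by linarith [hs.1]) hC
  have hlim2 := (tendsto_const_nhds (x := mlSeries β (β + 2) 1 t)).sub h0 |>.abs
  rw [sub_zero] at hlim2
  exact le_of_tendsto hlim2 (by
    filter_upwards [Ioc_mem_nhdsGT ht] with s hs using hdiff s hs)

/-- The estimates of the Mittag-Leffler type series, uniform in `lam`. -/
theorem exists_mlSeries_le {β : ℝ} (hβ : β ∈ Ioo (1 / 2 : ℝ) 1) :
    ∃ C : ℝ, 0 < C ∧ ∀ lam t : ℝ, 0 < lam → 0 < t → ∀ m : ℕ, m ≤ 3 →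
      |mlSeries β (β + 1 - m) lam t| ≤ C * t ^ (β - m) ∧
      lam ^ (1 / 2 : ℝ) * |mlSeries β (β + 2 - m) lam t| ≤ C * t ^ (1 - m : ℝ) := by
  have hb : 0 < β := by linarith [hβ.1]
  obtain ⟨C₀, hC₀, h₀⟩ := exists_pow_mul_mlSeries_one_le hβ (m := 0) (by norm_num)
  obtain ⟨C₁, hC₁, h₁⟩ := exists_pow_mul_mlSeries_one_le hβ (m := 1) (by norm_num)
  obtain ⟨C₂, hC₂, h₂⟩ := exists_pow_mul_mlSeries_one_le hβ (m := 2) (by norm_num)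
  obtain ⟨C₃, hC₃, h₃⟩ := exists_pow_mul_mlSeries_one_le hβ (m := 3) (by norm_num)
  obtain ⟨C₄, hC₄, h₄⟩ := exists_mlSeries_two_le hβ
  set C := C₀ + C₁ + C₂ + C₃ + C₄ + 1 with hCdef
  have hC : 0 < C := by positivity
  have hall (m : ℕ) (hm : m ≤ 3) (τ : ℝ) (hτ : 0 < τ) :
      τ ^ m * |mlSeries β (β + 1 - m) 1 τ| ≤ C ∧
      τ ^ m * |mlSeries β (β + 1 - m) 1 τ| ≤ C * τ ^ β := by
    have hτβ : 0 < τ ^ β := by positivity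
    interval_cases m
    · exact ⟨(h₀ τ hτ).1.trans (by linarith),
        (h₀ τ hτ).2.trans (mul_le_mul_of_nonneg_right (by linarith) hτβ.le)⟩
    · exact ⟨(h₁ τ hτ).1.trans (by linarith),
        (h₁ τ hτ).2.trans (mul_le_mul_of_nonneg_right (by linarith) hτβ.le)⟩
    · exact ⟨(h₂ τ hτ).1.trans (by linarith),
        (h₂ τ hτ).2.trans (mul_le_mul_of_nonneg_right (by linarith) hτβ.le)⟩
    · exact ⟨(h₃ τ hτ).1.trans (by linarith),
        (h₃ τ hτ).2.trans (mul_le_mul_of_nonneg_right (by linarith) hτβ.le)⟩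
  refine ⟨C, hC, fun lam t hl ht m hm => ?_⟩
  set τ := lam ^ (1 / (2 * β)) * t with hτdef
  have hτ : 0 < τ := by positivity
  have hτpow (x : ℝ) : τ ^ x = lam ^ (x / (2 * β)) * t ^ x := by
    rw [hτdef, Real.mul_rpow (by positivity) ht.le, ← Real.rpow_mul hl.le]
    congr 2; ring
  have hdiv (i : ℕ) (X Y : ℝ) (hX : τ ^ i * X ≤ Y) : X ≤ Y * τ ^ (-(i : ℝ)) := by
    rw [Real.rpow_neg hτ.le, Real.rpow_natCast, ← div_eq_mul_inv, le_div_iff₀ (by positivity)]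
    linarith
  constructor
  -- The `τ^β` form of the bound is the one required: the power of `lam` inside `τ^{β-m}` cancels
  -- exactly the prefactor from scaling.
  · have h := hdiv m _ _ (hall m hm τ hτ).2
    rw [mlSeries_eq_scaled hb _ hl ht, abs_mul, abs_of_pos (by positivity)]
    rw [mul_assoc C, ← Real.rpow_add hτ, hτpow] at h
    calc _ ≤ lam ^ (-((β + 1 - m - 1) / (2 * β))) *
          (C * (lam ^ ((β + -(m : ℝ)) / (2 * β)) * t ^ (β + -(m : ℝ)))) :=
          mul_le_mul_of_nonneg_left h (by positivity)
      _ = (lam ^ (-((β + 1 - m - 1) / (2 * β))) * lam ^ ((β + -(m : ℝ)) / (2 * β))) *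
          (C * t ^ (β + -(m : ℝ))) := by ring
      _ = _ := by
        rw [← Real.rpow_add hl, show -((β + 1 - m - 1) / (2 * β)) + (β + -(m : ℝ)) / (2 * β) = 0 by
          ring, Real.rpow_zero, one_mul, ← sub_eq_add_neg]
  -- For `m = i + 1` the order is `β + 1 - i`, and now the constant bound is used; only `m = 0`
  -- needs the linear growth estimate.
  · have hbase : |mlSeries β (β + 2 - m) 1 τ| ≤ C * τ ^ (1 - m : ℝ) := by
      rcases m with _ | i
      · have := h₄ τ hτ
        simp only [Nat.cast_zero, sub_zero, Real.rpow_one]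
        exact this.trans (mul_le_mul_of_nonneg_right (by linarith) hτ.le)
      · have h := hdiv i _ _ (hall i (by omega) τ hτ).1
        rw [show β + 2 - ((i + 1 : ℕ) : ℝ) = β + 1 - i by push_cast; ring,
          show (1 : ℝ) - ((i + 1 : ℕ) : ℝ) = -i by push_cast; ring]
        exact h
    rw [hτpow] at hbase
    rw [mlSeries_eq_scaled hb _ hl ht, abs_mul, abs_of_pos (by positivity)]
    calc _ ≤ lam ^ (1 / 2 : ℝ) * (lam ^ (-((β + 2 - m - 1) / (2 * β))) *
          (C * (lam ^ ((1 - m : ℝ) / (2 * β)) * t ^ (1 - m : ℝ)))) := by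
          gcongr
      _ = (lam ^ (1 / 2 : ℝ) * lam ^ (-((β + 2 - m - 1) / (2 * β))) *
          lam ^ ((1 - m : ℝ) / (2 * β))) * (C * t ^ (1 - m : ℝ)) := by ring
      _ = _ := by
        rw [← Real.rpow_add hl, ← Real.rpow_add hl,
          show (1 / 2 : ℝ) + -((β + 2 - m - 1) / (2 * β)) + (1 - m : ℝ) / (2 * β) = 0 by
            field_simp; ring, Real.rpow_zero, one_mul]

/-! ### Fractional calculus -/

theorem setIntegral_omega_mul_omega {a b : ℝ} (ha : 0 < a) (hb : 0 < b) {s t : ℝ} (hst : s < t) :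
    IntegrableOn (fun r => omega a (t - r) * omega b (r - s)) (Ioo s t) ∧
    ∫ r in Ioo s t, omega a (t - r) * omega b (r - s) = omega (a + b) (t - s) := by
  constructor
  · exact (intervalIntegrable_iff_integrableOn_Ioo_of_le hst.le).1
      (intervalIntegrable_omega_mul_omega_shift ha hb hst)
  · rw [← integral_omega_mul_omega_shift ha hb hst, intervalIntegral.integral_of_le hst.le,
      integral_Ioc_eq_integral_Ioo]

/-- The composition of the Riemann–Liouville integrals of orders `a` and `b = 1 - a`. -/
theorem integral_omega_mul_integral_omega {a b : ℝ} (ha : 0 < a) (hb : 0 < b) (hab : a + b = 1)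
    {t : ℝ} {h : ℝ → ℝ} (hm : Measurable h) (hi : IntegrableOn h (Ioo 0 t)) :
    ∫ r in Ioo 0 t, omega a (t - r) * ∫ s in Ioo 0 r, omega b (r - s) * h s =
      ∫ s in Ioo 0 t, h s := by
  -- The triangle `s < r` is encoded by an indicator, so that Fubini applies on the square `(0,
  -- t)²`.
  set F : ℝ → ℝ → ℝ := fun r s =>
    (Ioi s).indicator (fun r => omega a (t - r) * omega b (r - s) * h s) r with hF
  have hFmeas : Measurable (Function.uncurry F) := by
    have e : Function.uncurry F = {p : ℝ × ℝ | p.2 < p.1}.indicator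
        (fun p => omega a (t - p.1) * omega b (p.1 - p.2) * h p.2) := by
      ext ⟨r, s⟩
      simp only [hF, Function.uncurry, indicator, mem_Ioi, mem_ofPred_eq]
    rw [e]
    refine Measurable.indicator ?_ (measurableSet_lt measurable_snd measurable_fst)
    have h1 := measurable_omega a
    have h2 := measurable_omega b
    fun_prop
  have hinter (s : ℝ) (hs : s ∈ Ioo 0 t) : Ioo 0 t ∩ Ioi s = Ioo s t := by
    ext x; simp only [mem_inter_iff, mem_Ioo, mem_Ioi]
    exact ⟨fun h => ⟨h.2, h.1.2⟩, fun h => ⟨⟨hs.1.trans h.1, h.2⟩, h.1⟩⟩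
  have hFr (s : ℝ) (hs : s ∈ Ioo 0 t) : IntegrableOn (fun r => F r s) (Ioo 0 t) ∧
      ∫ r in Ioo 0 t, F r s = h s ∧ ∫ r in Ioo 0 t, ‖F r s‖ = ‖h s‖ := by
    obtain ⟨h1, h2⟩ := setIntegral_omega_mul_omega ha hb hs.2
    -- Because `a + b = 1`, the inner integral over `r` is `ω_1 = 1`; this gives the value and the
    -- `L¹` bound required by Fubini.
    rw [hab, omega_one] at h2
    refine ⟨?_, ?_, ?_⟩
    · simp only [hF]
      rw [integrableOn_indicator_iff measurableSet_Ioi, inter_comm, hinter s hs]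
      exact h1.mul_const _
    · simp only [hF]
      rw [setIntegral_indicator measurableSet_Ioi, hinter s hs, integral_mul_const, h2, one_mul]
    · simp only [hF, norm_indicator_eq_indicator_norm]
      rw [setIntegral_indicator measurableSet_Ioi, hinter s hs]
      have e : ∀ r ∈ Ioo s t, ‖omega a (t - r) * omega b (r - s) * h s‖ =
          omega a (t - r) * omega b (r - s) * ‖h s‖ := by
        intro r hr
        rw [norm_mul, Real.norm_of_nonneg (mul_nonneg (omega_nonneg ha (by linarith [hr.2]))
          (omega_nonneg hb (by linarith [hr.1])))]
      rw [setIntegral_congr_fun measurableSet_Ioo e, integral_mul_const, h2, one_mul]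
  have hFint : Integrable (Function.uncurry F)
      ((volume.restrict (Ioo 0 t)).prod (volume.restrict (Ioo 0 t))) := by
    rw [integrable_prod_iff' hFmeas.aestronglyMeasurable]
    constructor
    · filter_upwards [ae_restrict_mem measurableSet_Ioo] with s hs using (hFr s hs).1
    · refine hi.norm.congr ?_
      filter_upwards [ae_restrict_mem measurableSet_Ioo] with s hs using (hFr s hs).2.2.symm
  have hswap := integral_integral_swap hFint
  have hl : ∫ r in Ioo 0 t, ∫ s in Ioo 0 t, F r s =
      ∫ r in Ioo 0 t, omega a (t - r) * ∫ s in Ioo 0 r, omega b (r - s) * h s := by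
    refine setIntegral_congr_fun measurableSet_Ioo fun r hr => ?_
    rw [← integral_const_mul]
    have e : (fun s => F r s) = (Iio r).indicator
        (fun s => omega a (t - r) * (omega b (r - s) * h s)) := by
      ext s
      simp only [hF, indicator, mem_Ioi, mem_Iio, mul_assoc]
    rw [e, setIntegral_indicator measurableSet_Iio]
    congr 2
    ext x; simp only [mem_inter_iff, mem_Ioo, mem_Iio]
    exact ⟨fun h => ⟨h.1.1, h.2⟩, fun h => ⟨⟨h.1, h.2.trans hr.2⟩, h.2⟩⟩
  rw [← hl, hswap]
  exact setIntegral_congr_fun measurableSet_Ioo fun s hs => (hFr s hs).2.1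

theorem rlIntegral_eq_setIntegral {E : Type*} [NormedAddCommGroup E] [NormedSpace ℝ E]
    (γ : ℝ) (v : ℝ → E) {t : ℝ} (ht : 0 ≤ t) :
    rlIntegral γ v t = ∫ s in Ioo 0 t, omega γ (t - s) • v s := by
  rw [rlIntegral, intervalIntegral.integral_of_le ht, integral_Ioc_eq_integral_Ioo]

theorem rlIntegral_congr {E : Type*} [NormedAddCommGroup E] [NormedSpace ℝ E]
    {γ : ℝ} {v w : ℝ → E} {t : ℝ} (ht : 0 ≤ t) (h : ∀ s ∈ Ioo 0 t, v s = w s) :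
    rlIntegral γ v t = rlIntegral γ w t := by
  rw [rlIntegral_eq_setIntegral _ _ ht, rlIntegral_eq_setIntegral _ _ ht]
  exact setIntegral_congr_fun measurableSet_Ioo fun s hs => by simp only [h s hs]

theorem CaputoRegular.hasDerivAt {E : Type*} [NormedAddCommGroup E] [NormedSpace ℝ E]
    {T : ℝ} {v : ℝ → E} (hv : CaputoRegular T v) {t : ℝ} (ht : t ∈ Ioo 0 T) :
    HasDerivAt v (deriv v t) t :=
  ((hv.contDiffOn.differentiableOn one_ne_zero).differentiableAt (Ioo_mem_nhds ht.1 ht.2)).hasDerivAt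

/-- The fractional integral inverts the Caputo derivative up to the initial value. -/
theorem rlIntegral_caputo {β : ℝ} (hβ : β ∈ Ioo (0 : ℝ) 1) {T : ℝ} {v : ℝ → ℝ}
    (hv : CaputoRegular T v) {t : ℝ} (ht : t ∈ Ioo 0 T) :
    rlIntegral β (caputo β v) t = v t - v 0 := by
  have hsub : Ioo 0 t ⊆ Ioo 0 T := Ioo_subset_Ioo_right ht.2.le
  have hi := hv.integrableOn_deriv.mono_set hsub
  have h1 := integral_omega_mul_integral_omega hβ.1 (sub_pos.2 hβ.2) (by ring)
    (measurable_deriv v) hi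
  have h2 : ∫ s in (0 : ℝ)..t, deriv v s = v t - v 0 :=
    intervalIntegral.integral_eq_sub_of_hasDerivAt_of_le ht.1.le
      (hv.continuousOn.mono (Icc_subset_Icc_right ht.2.le))
      (fun x hx => hv.hasDerivAt (hsub hx))
      ((intervalIntegrable_iff_integrableOn_Ioo_of_le ht.1.le).2 hi)
  rw [intervalIntegral.integral_of_le ht.1.le, integral_Ioc_eq_integral_Ioo] at h2
  rw [← h2, ← h1, rlIntegral_eq_setIntegral _ _ ht.1.le]
  refine setIntegral_congr_fun measurableSet_Ioo fun r hr => ?_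
  simp only [caputo, smul_eq_mul]
  rw [rlIntegral_eq_setIntegral _ _ hr.1.le]
  simp only [smul_eq_mul]

/-- Split at `t / 2`: on the left the kernel is continuous and `v'` integrable; on the right the
kernel is integrable and `v'` continuous, as `t < T`. It allows functionals to pass through the
Caputo derivative. -/
theorem CaputoRegular.intervalIntegrable_omega_smul {E : Type*} [NormedAddCommGroup E]
    [NormedSpace ℝ E] {T : ℝ} {v : ℝ → E} (hv : CaputoRegular T v) {γ : ℝ} (hγ : 0 < γ)
    {t : ℝ} (ht : t ∈ Ioo 0 T) :
    IntervalIntegrable (fun s => omega γ (t - s) • deriv v s) volume 0 t := by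
  have ht2 : 0 < t / 2 := by linarith [ht.1]
  have hd : ContinuousOn (deriv v) (Ioo 0 T) :=
    hv.contDiffOn.continuousOn_deriv_of_isOpen isOpen_Ioo le_rfl
  have h1 : IntervalIntegrable (fun s => omega γ (t - s) • deriv v s) volume 0 (t / 2) := by
    have hi : IntervalIntegrable (deriv v) volume 0 (t / 2) :=
      (intervalIntegrable_iff_integrableOn_Ioo_of_le ht2.le).2
        (hv.integrableOn_deriv.mono_set (Ioo_subset_Ioo_right (by linarith [ht.2])))
    refine hi.continuousOn_smul ?_
    rw [uIcc_of_le ht2.le]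
    unfold omega
    refine ContinuousOn.div_const (ContinuousOn.rpow_const (by fun_prop) fun s hs => Or.inl ?_) _
    linarith [hs.2]
  have h2 : IntervalIntegrable (fun s => omega γ (t - s) • deriv v s) volume (t / 2) t := by
    have hi := (intervalIntegrable_omega_sub hγ ht.1).mono_set (c := t / 2) (d := t) (by
      rw [uIcc_of_le (by linarith), uIcc_of_le ht.1.le]; exact Icc_subset_Icc_left ht2.le)
    refine hi.smul_continuousOn (hd.mono ?_)
    rw [uIcc_of_le (by linarith)]
    exact fun s hs => ⟨by linarith [hs.1], hs.2.trans_lt ht.2⟩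
  exact h1.trans h2

theorem CaputoRegular.clm_comp {E : Type*} [NormedAddCommGroup E] [NormedSpace ℝ E]
    {T : ℝ} {v : ℝ → E} (hv : CaputoRegular T v) (φ : E →L[ℝ] ℝ) :
    CaputoRegular T (fun t => φ (v t)) where
  continuousOn := φ.continuous.comp_continuousOn hv.continuousOn
  contDiffOn := φ.contDiff.comp_contDiffOn hv.contDiffOn
  integrableOn_deriv := by
    refine (φ.integrable_comp hv.integrableOn_deriv).congr ?_
    filter_upwards [ae_restrict_mem measurableSet_Ioo] with t ht
    exact ((φ.hasFDerivAt.comp_hasDerivAt t (hv.hasDerivAt ht)).deriv).symm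

theorem CaputoRegular.caputo_clm_comp {E : Type*} [NormedAddCommGroup E] [NormedSpace ℝ E]
    [CompleteSpace E] {β : ℝ} (hβ : β < 1)
    {T : ℝ} {v : ℝ → E} (hv : CaputoRegular T v) (φ : E →L[ℝ] ℝ) {t : ℝ} (ht : t ∈ Ioo 0 T) :
    caputo β (fun t => φ (v t)) t = φ (caputo β v t) := by
  unfold caputo
  rw [rlIntegral_congr (v := deriv fun t => φ (v t)) (w := fun s => φ (deriv v s)) ht.1.le fun s hs => show deriv (φ ∘ v) s = _ from
    (φ.hasFDerivAt.comp_hasDerivAt s (hv.hasDerivAt ⟨hs.1, hs.2.trans ht.2⟩)).deriv]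
  unfold rlIntegral
  rw [← φ.intervalIntegral_comp_comm (hv.intervalIntegrable_omega_smul (sub_pos.2 hβ) ht)]
  simp only [map_smul]

/-! ### The scalar Volterra system -/

theorem intervalIntegrable_omega_mul_continuousOn {β : ℝ} (hβ : 0 < β) {v : ℝ → ℝ} {t : ℝ}
    (ht : 0 < t) (hv : ContinuousOn v (Icc 0 t)) :
    IntervalIntegrable (fun s => omega β (t - s) • v s) volume 0 t :=
  (intervalIntegrable_omega_sub hβ ht).smul_continuousOn (by rwa [uIcc_of_le ht.le])

/-- `I^β` is positive and maps `ω_γ` to `ω_{β+γ}`, so each use of an equation gains `β` in the order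
of the error. -/
theorem abs_rlIntegral_sub_le {β γ K : ℝ} (hβ : 0 < β) (hγ : 0 < γ) {v Q : ℝ → ℝ} {t : ℝ}
    (ht : 0 < t) (hv : ContinuousOn v (Icc 0 t)) (hQ : ContinuousOn Q (Icc 0 t))
    (h : ∀ s ∈ Ioo 0 t, |v s - Q s| ≤ K * omega γ s) :
    |rlIntegral β v t - rlIntegral β Q t| ≤ K * omega (β + γ) t := by
  have hiv := intervalIntegrable_omega_mul_continuousOn hβ ht hv
  have hiQ := intervalIntegrable_omega_mul_continuousOn hβ ht hQ
  rw [rlIntegral, rlIntegral, ← intervalIntegral.integral_sub hiv hiQ, ← Real.norm_eq_abs,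
    ← integral_omega_mul_omega hβ hγ ht, ← intervalIntegral.integral_const_mul]
  have hI := (intervalIntegrable_omega_mul_omega hβ hγ ht).const_mul K
  rw [intervalIntegral.integral_of_le ht.le, intervalIntegral.integral_of_le ht.le,
    integral_Ioc_eq_integral_Ioo, integral_Ioc_eq_integral_Ioo]
  refine norm_integral_le_of_norm_le
    ((intervalIntegrable_iff_integrableOn_Ioo_of_le ht.le).1 hI) ?_
  filter_upwards [ae_restrict_mem measurableSet_Ioo] with s hs
  have ho : 0 ≤ omega β (t - s) := omega_nonneg hβ (by linarith [hs.2])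
  rw [smul_eq_mul, smul_eq_mul, ← mul_sub, norm_mul, Real.norm_of_nonneg ho, Real.norm_eq_abs,
    mul_left_comm]
  exact mul_le_mul_of_nonneg_left (h s hs) ho

theorem rlIntegral_sum_omega {β : ℝ} (hβ : 0 < β) (a b : ℝ) (c γ : ℕ → ℝ) (hγ : ∀ k, 0 < γ k)
    (N : ℕ) {t : ℝ} (ht : 0 < t) :
    rlIntegral β (fun s => ∑ k ∈ Finset.range N, c k * (a * omega (γ k) s + b * omega (γ k + 1) s)) t =
      ∑ k ∈ Finset.range N, c k * (a * omega (β + γ k) t + b * omega (β + γ k + 1) t) := by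
  have h1 (k : ℕ) := intervalIntegrable_omega_mul_omega hβ (hγ k) ht
  have h2 (k : ℕ) := intervalIntegrable_omega_mul_omega hβ (b := γ k + 1)
    (by linarith [hγ k]) ht
  have e : (fun s => omega β (t - s) •
      ∑ k ∈ Finset.range N, c k * (a * omega (γ k) s + b * omega (γ k + 1) s)) =
      fun s => ∑ k ∈ Finset.range N, c k * (a * (omega β (t - s) * omega (γ k) s) +
        b * (omega β (t - s) * omega (γ k + 1) s)) := by
    ext s
    rw [smul_eq_mul, Finset.mul_sum]
    exact Finset.sum_congr rfl fun k _ => by ring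
  rw [rlIntegral, e, intervalIntegral.integral_finsetSum fun k _ =>
    ((((h1 k).const_mul a).add ((h2 k).const_mul b)).const_mul (c k))]
  refine Finset.sum_congr rfl fun k _ => ?_
  rw [intervalIntegral.integral_const_mul, intervalIntegral.integral_add ((h1 k).const_mul a)
    ((h2 k).const_mul b), intervalIntegral.integral_const_mul,
    intervalIntegral.integral_const_mul, integral_omega_mul_omega hβ (hγ k) ht,
    integral_omega_mul_omega hβ (by linarith [hγ k]) ht, add_assoc]

theorem continuous_sum_omega (a b : ℝ) (c γ : ℕ → ℝ) (hγ : ∀ k, 1 ≤ γ k) (N : ℕ) :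
    Continuous fun s => ∑ k ∈ Finset.range N, c k * (a * omega (γ k) s + b * omega (γ k + 1) s) := by
  refine continuous_finsetSum _ fun k _ => ?_
  have h1 := continuous_omega (hγ k)
  have h2 := continuous_omega (γ := γ k + 1) (by linarith [hγ k])
  fun_prop

/-- Picard iteration for the system `u = a + b t + I^β z`, `z = -lam I^β u`. -/
theorem abs_sub_picard_le {β : ℝ} (hβ : 0 < β) {T : ℝ} {lam a b M : ℝ} {u z : ℝ → ℝ}
    (hu : ContinuousOn u (Icc 0 T)) (hz : ContinuousOn z (Icc 0 T))
    (hM : ∀ t ∈ Ioo 0 T, |z t| ≤ M)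
    (equ : ∀ t ∈ Ioo 0 T, u t = a + b * t + rlIntegral β z t)
    (eqz : ∀ t ∈ Ioo 0 T, z t = -lam * rlIntegral β u t) (N : ℕ) :
    ∀ t ∈ Ioo 0 T, |z t - ∑ k ∈ Finset.range N, (-lam) ^ (k + 1) *
      (a * omega (2 * β * k + β + 1) t + b * omega (2 * β * k + β + 1 + 1) t)| ≤
      M * |lam| ^ N * omega (2 * β * N + 1) t := by
  induction N with
  | zero => intro t ht; simpa [omega_one] using hM t ht
  | succ N ih =>
    set Q : ℝ → ℝ := fun t => ∑ k ∈ Finset.range N, (-lam) ^ (k + 1) *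
      (a * omega (2 * β * k + β + 1) t + b * omega (2 * β * k + β + 1 + 1) t) with hQ
    -- `P` is the `u`-iterate produced by the `z`-iterate `Q`; a passage through both equations adds
    -- one term and raises the order of the error by `2β`.
    set P : ℝ → ℝ := fun t => ∑ k ∈ Finset.range (N + 1), (-lam) ^ k *
      (a * omega (2 * β * k + 1) t + b * omega (2 * β * k + 1 + 1) t) with hP
    have hnn (k : ℕ) : 0 ≤ 2 * β * k := by positivity
    have hQc : Continuous Q := continuous_sum_omega a b (fun k => (-lam) ^ (k + 1))
      (fun k => 2 * β * k + β + 1) (fun k => by linarith [hnn k]) N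
    have hPc : Continuous P := continuous_sum_omega a b (fun k => (-lam) ^ k)
      (fun k => 2 * β * k + 1) (fun k => by linarith [hnn k]) (N + 1)
    have hPQ (t : ℝ) (ht : 0 < t) : P t = a + b * t + rlIntegral β Q t := by
      rw [hQ, rlIntegral_sum_omega hβ a b (fun k => (-lam) ^ (k + 1))
        (fun k => 2 * β * k + β + 1) (fun k => by linarith [hnn k]) N ht, hP]
      simp only
      rw [Finset.sum_range_succ', add_comm]
      congr 1
      · simp [omega_one, one_add_one_eq_two, omega_two]
      · refine Finset.sum_congr rfl fun k _ => ?_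
        rw [show 2 * β * ((k + 1 : ℕ) : ℝ) + 1 = β + (2 * β * k + β + 1) by push_cast; ring]
    have hQP (t : ℝ) (ht : 0 < t) : ∑ k ∈ Finset.range (N + 1), (-lam) ^ (k + 1) *
        (a * omega (2 * β * k + β + 1) t + b * omega (2 * β * k + β + 1 + 1) t) =
        -lam * rlIntegral β P t := by
      rw [hP, rlIntegral_sum_omega hβ a b (fun k => (-lam) ^ k)
        (fun k => 2 * β * k + 1) (fun k => by linarith [hnn k]) (N + 1) ht, Finset.mul_sum]
      refine Finset.sum_congr rfl fun k _ => ?_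
      rw [show β + (2 * β * (k : ℝ) + 1) = 2 * β * k + β + 1 by ring, pow_succ]
      ring
    have hu1 (t : ℝ) (ht : t ∈ Ioo 0 T) :
        |u t - P t| ≤ M * |lam| ^ N * omega (β + (2 * β * N + 1)) t := by
      rw [equ t ht, hPQ t ht.1, add_sub_add_left_eq_sub]
      exact abs_rlIntegral_sub_le hβ (by linarith [hnn N]) ht.1
        (hz.mono (Icc_subset_Icc_right ht.2.le)) hQc.continuousOn
        fun s hs => ih s ⟨hs.1, hs.2.trans ht.2⟩
    intro t ht
    rw [hQP t ht.1, eqz t ht, ← mul_sub, abs_mul, abs_neg]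
    have h3 := abs_rlIntegral_sub_le hβ (γ := β + (2 * β * N + 1)) (by linarith [hnn N]) ht.1
        (hu.mono (Icc_subset_Icc_right ht.2.le)) hPc.continuousOn
        fun s hs => hu1 s ⟨hs.1, hs.2.trans ht.2⟩
    refine (mul_le_mul_of_nonneg_left h3 (abs_nonneg lam)).trans_eq ?_
    rw [show β + (β + (2 * β * (N : ℝ) + 1)) = 2 * β * ((N + 1 : ℕ) : ℝ) + 1 by push_cast; ring,
      pow_succ]
    ring

/-- The Picard remainder `M |lam|^N ω_{2βN+1}(t)` is dominated by the terms of a convergent series,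
so it tends to zero; this gives uniqueness and the formula at once. -/
theorem volterra_solution {β : ℝ} (hβ : 1 / 2 ≤ β) {T : ℝ} {lam a b : ℝ} {u z : ℝ → ℝ}
    (hu : ContinuousOn u (Icc 0 T)) (hz : ContinuousOn z (Icc 0 T))
    (equ : ∀ t ∈ Ioo 0 T, u t = a + b * t + rlIntegral β z t)
    (eqz : ∀ t ∈ Ioo 0 T, z t = -lam * rlIntegral β u t) {t : ℝ} (ht : t ∈ Ioc 0 T) :
    z t = -lam * (a * mlSeries β (β + 1) lam t + b * mlSeries β (β + 2) lam t) := by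
  have hb : 0 < β := by linarith
  obtain ⟨M, hM⟩ := isCompact_Icc.exists_bound_of_continuousOn hz
  have hopen : ∀ t ∈ Ioo 0 T,
      z t = -lam * (a * mlSeries β (β + 1) lam t + b * mlSeries β (β + 2) lam t) := by
    intro t ht
    have hP := fun N => abs_sub_picard_le hb (M := M) hu hz
      (fun t ht => hM t (Ioo_subset_Icc_self ht)) equ eqz N t ht
    have h1 := (summable_mlSeries hβ hb.le 0 lam ht.1).hasSum
    have h2 := (summable_mlSeries hβ (by linarith : 0 ≤ β + 1) 0 lam ht.1).hasSum
    have e1 : β + 1 - ((0 : ℕ) : ℝ) = β + 1 := by simp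
    have e2 : β + 1 + 1 - ((0 : ℕ) : ℝ) = β + 2 := by push_cast; ring
    rw [e1] at h1
    rw [e2] at h2
    have h3 := (((h1.mul_left a).add (h2.mul_left b)).mul_left (-lam)).tendsto_sum_nat
    obtain ⟨w, hw, hbd⟩ := exists_summable_omega_bound (α := 2 * β) (b := 0) (by linarith)
      le_rfl |lam| (abs_nonneg _) ht.1.le
    have h4 : Tendsto (fun N => M * (t ^ (0 : ℝ) * w N)) atTop (𝓝 0) := by
      simpa using ((hw.tendsto_atTop_zero).const_mul (t ^ (0 : ℝ))).const_mul M
    have hM0 : 0 ≤ M := (norm_nonneg _).trans (hM t (Ioo_subset_Icc_self ht))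
    have h5 : Tendsto (fun N => z t - ∑ k ∈ Finset.range N, (-lam) ^ (k + 1) *
      (a * omega (2 * β * k + β + 1) t + b * omega (2 * β * k + β + 1 + 1) t)) atTop (𝓝 0) := by
      refine squeeze_zero_norm (fun N => (hP N).trans ?_) h4
      rw [mul_assoc]
      refine mul_le_mul_of_nonneg_left ?_ hM0
      have := hbd N t ⟨ht.1.le, le_rfl⟩
      rwa [add_zero] at this
    have h6 := (tendsto_const_nhds (x := z t)).sub h5
    rw [sub_zero] at h6
    refine tendsto_nhds_unique h6 (h3.congr fun N => ?_)
    rw [sub_sub_cancel]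
    refine Finset.sum_congr rfl fun k _ => ?_
    rw [pow_succ, add_assoc (2 * β * (k : ℝ)), add_assoc (2 * β * (k : ℝ)),
      show β + 1 + 1 = β + 2 by ring]
    ring
  -- The equations hold only for `t < T`; the value at `T` follows by continuity of both sides.
  rcases ht.2.lt_or_eq with h | rfl
  · exact hopen t ⟨ht.1, h⟩
  · have hcl : t ∈ closure (Ioo 0 t) := by
      rw [closure_Ioo ht.1.ne]; exact right_mem_Icc.2 ht.1.le
    have : (𝓝[Ioo 0 t] t).NeBot := mem_closure_iff_nhdsWithin_neBot.1 hcl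
    have hl : Tendsto z (𝓝[Ioo 0 t] t) (𝓝 (z t)) :=
      (hz t (right_mem_Icc.2 ht.1.le)).mono_left (nhdsWithin_mono _ Ioo_subset_Icc_self)
    have c1 := (hasDerivAt_mlSeries hβ hb.le 0 lam ht.1).continuousAt
    have c2 := (hasDerivAt_mlSeries hβ (by linarith : 0 ≤ β + 1) 0 lam ht.1).continuousAt
    have e1 : β + 1 - ((0 : ℕ) : ℝ) = β + 1 := by simp
    have e2 : β + 1 + 1 - ((0 : ℕ) : ℝ) = β + 2 := by push_cast; ring
    rw [e1] at c1
    rw [e2] at c2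
    have hr := ((((c1.const_mul a).add (c2.const_mul b)).const_mul (-lam)).tendsto).mono_left
      (nhdsWithin_le_nhds (s := Ioo 0 t))
    exact tendsto_nhds_unique (hl.congr' (by
      filter_upwards [self_mem_nhdsWithin] with s hs using hopen s hs)) hr

/-! ### Testing weak derivatives against functions vanishing at the boundary -/

theorem integrable_L2 {L : ℝ} (ψ : L2 L) : Integrable ψ (volume.restrict (Ioo 0 L)) :=
  (Lp.memLp ψ).integrable one_le_two

theorem deriv_smoothTransition_eq_zero {x : ℝ} (hx : x < 0 ∨ 1 < x) :
    deriv Real.smoothTransition x = 0 := by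
  rcases hx with hx | hx
  · have : Real.smoothTransition =ᶠ[𝓝 x] fun _ => 0 := by
      filter_upwards [Iio_mem_nhds hx] with y hy
        using Real.smoothTransition.zero_of_nonpos (le_of_lt hy)
    rw [this.deriv_eq, deriv_const]
  · have : Real.smoothTransition =ᶠ[𝓝 x] fun _ => 1 := by
      filter_upwards [Ioi_mem_nhds hx] with y hy
        using Real.smoothTransition.one_of_one_le (le_of_lt hy)
    rw [this.deriv_eq, deriv_const]

theorem exists_deriv_smoothTransition_le :
    ∃ D : ℝ, 0 ≤ D ∧ ∀ x, |deriv Real.smoothTransition x| ≤ D := by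
  have hc : Continuous (deriv Real.smoothTransition) :=
    (Real.smoothTransition.contDiff (n := 1)).continuous_deriv_one
  obtain ⟨D, hD⟩ := isCompact_Icc.exists_bound_of_continuousOn (s := Icc (0 : ℝ) 1)
    hc.continuousOn
  have hD0 : 0 ≤ D := (norm_nonneg _).trans (hD 0 (by simp))
  refine ⟨D, hD0, fun x => ?_⟩
  by_cases hx : x ∈ Icc (0 : ℝ) 1
  · exact hD x hx
  · rw [deriv_smoothTransition_eq_zero, abs_zero]
    · exact hD0
    · by_contra h
      push Not at h
      exact hx ⟨h.1, h.2⟩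

/-- Smooth cutoff functions exhausting the interval `(0, L)`. -/
noncomputable def cutoff (L : ℝ) (k : ℕ) (x : ℝ) : ℝ :=
  Real.smoothTransition ((k + 1) * x - 1) * Real.smoothTransition ((k + 1) * (L - x) - 1)

theorem contDiff_cutoff (L : ℝ) (k : ℕ) : ContDiff ℝ ∞ (cutoff L k) := by
  have h : ContDiff ℝ ∞ Real.smoothTransition := Real.smoothTransition.contDiff
  exact (h.comp (by fun_prop)).mul (h.comp (by fun_prop))

theorem abs_smoothTransition_le (x : ℝ) : |Real.smoothTransition x| ≤ 1 := by
  rw [abs_of_nonneg (Real.smoothTransition.nonneg x)]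
  exact Real.smoothTransition.le_one x

theorem abs_cutoff_le (L : ℝ) (k : ℕ) (x : ℝ) : |cutoff L k x| ≤ 1 := by
  rw [cutoff, abs_mul]
  exact mul_le_one₀ (abs_smoothTransition_le _) (abs_nonneg _) (abs_smoothTransition_le _)

theorem tsupport_cutoff_subset (L : ℝ) (k : ℕ) :
    tsupport (cutoff L k) ⊆ Icc (1 / ((k : ℝ) + 1)) (L - 1 / ((k : ℝ) + 1)) := by
  have hk : (0 : ℝ) < k + 1 := by positivity
  refine closure_minimal (fun x hx => ?_) isClosed_Icc
  by_contra hx'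
  refine hx ?_
  rw [mem_Icc, not_and_or, not_le, not_le] at hx'
  rw [cutoff]
  rcases hx' with h | h
  · rw [Real.smoothTransition.zero_of_nonpos, zero_mul]
    rw [lt_div_iff₀ hk] at h; linarith
  · rw [Real.smoothTransition.zero_of_nonpos (x := ((k : ℝ) + 1) * (L - x) - 1), mul_zero]
    have : L - x < 1 / ((k : ℝ) + 1) := by linarith
    rw [lt_div_iff₀ hk] at this; linarith

theorem isTest_mul_cutoff (L : ℝ) (k : ℕ) {φ : ℝ → ℝ} (hφ : ContDiff ℝ ∞ φ) :
    IsTest L (fun x => φ x * cutoff L k x) := by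
  have hk : (0 : ℝ) < 1 / ((k : ℝ) + 1) := by positivity
  have hsub : tsupport (fun x => φ x * cutoff L k x) ⊆
      Icc (1 / ((k : ℝ) + 1)) (L - 1 / ((k : ℝ) + 1)) :=
    (tsupport_mul_subset_right (f := φ) (g := cutoff L k)).trans (tsupport_cutoff_subset L k)
  refine ⟨hφ.mul (contDiff_cutoff L k), ?_, hsub.trans fun x hx => ?_⟩
  · exact isCompact_Icc.of_isClosed_subset (isClosed_tsupport _) hsub
  · exact ⟨hk.trans_le hx.1, by linarith [hx.2]⟩

theorem hasDerivAt_cutoff (L : ℝ) (k : ℕ) (x : ℝ) :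
    HasDerivAt (cutoff L k)
      (deriv Real.smoothTransition ((k + 1) * x - 1) * (k + 1) *
        Real.smoothTransition ((k + 1) * (L - x) - 1) +
      Real.smoothTransition ((k + 1) * x - 1) *
        (deriv Real.smoothTransition ((k + 1) * (L - x) - 1) * (-(k + 1)))) x := by
  have hd (y : ℝ) : HasDerivAt Real.smoothTransition (deriv Real.smoothTransition y) y :=
    ((Real.smoothTransition.contDiff (n := 1)).differentiable one_ne_zero y).hasDerivAt
  have h1 : HasDerivAt (fun x : ℝ => ((k : ℝ) + 1) * x - 1) (k + 1) x := by
    simpa using ((hasDerivAt_id x).const_mul ((k : ℝ) + 1)).sub_const 1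
  have h2 : HasDerivAt (fun x : ℝ => ((k : ℝ) + 1) * (L - x) - 1) (-(k + 1)) x := by
    simpa using (((hasDerivAt_id x).const_sub L).const_mul ((k : ℝ) + 1)).sub_const 1
  exact ((hd _).comp x h1).mul ((hd _).comp x h2)

/-- The derivative of the cutoff has size `O(k+1)` but lives within distance `2/(k+1)` of the end
points, where `|φ|` is at most `B` times that distance; the product is bounded uniformly in `k`. -/
theorem exists_mul_deriv_cutoff_le (L : ℝ) {φ : ℝ → ℝ} {B : ℝ} (hB : 0 ≤ B)
    (h0 : ∀ x, |φ x| ≤ B * |x|) (hL : ∀ x, |φ x| ≤ B * |L - x|) :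
    ∃ C : ℝ, ∀ (k : ℕ), ∀ x ∈ Ioo 0 L, |φ x * deriv (cutoff L k) x| ≤ C := by
  obtain ⟨D, hD, hd⟩ := exists_deriv_smoothTransition_le
  have key (k : ℕ) (p y : ℝ) (hy : 0 < y) (hp : |p| ≤ B * |y|) :
      |p| * (|deriv Real.smoothTransition ((k + 1) * y - 1)| * (k + 1)) ≤ 2 * B * D := by
    have hk : (0 : ℝ) < k + 1 := by positivity
    rw [abs_of_pos hy] at hp
    rcases le_or_gt (((k : ℝ) + 1) * y) 2 with h | h
    · calc |p| * (|deriv Real.smoothTransition ((k + 1) * y - 1)| * (k + 1))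
          ≤ (B * y) * (D * (k + 1)) := by gcongr; exact hd _
        _ = B * D * ((k + 1) * y) := by ring
        _ ≤ B * D * 2 := by gcongr
        _ = _ := by ring
    · rw [deriv_smoothTransition_eq_zero (Or.inr (by linarith))]
      simp; positivity
  refine ⟨2 * B * D + 2 * B * D, fun k x hx => ?_⟩
  have hk : (0 : ℝ) < k + 1 := by positivity
  rw [(hasDerivAt_cutoff L k x).deriv, mul_add]
  refine (abs_add_le _ _).trans (add_le_add ?_ ?_)
  · refine le_trans ?_ (key k (φ x) x hx.1 (h0 x))
    rw [abs_mul, abs_mul, abs_mul, abs_of_pos hk]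
    refine mul_le_mul_of_nonneg_left ?_ (abs_nonneg _)
    exact mul_le_of_le_one_right (by positivity) (abs_smoothTransition_le _)
  · refine le_trans ?_ (key k (φ x) (L - x) (by linarith [hx.2]) (hL x))
    rw [abs_mul, abs_mul, abs_mul, abs_neg, abs_of_pos hk]
    refine mul_le_mul_of_nonneg_left ?_ (abs_nonneg _)
    exact mul_le_of_le_one_left (by positivity) (abs_smoothTransition_le _)

theorem eventually_cutoff_eq {L x : ℝ} (hx : x ∈ Ioo 0 L) :
    ∀ᶠ k : ℕ in atTop, cutoff L k x = 1 ∧ deriv (cutoff L k) x = 0 := by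
  have hev (y : ℝ) (hy : 0 < y) : ∀ᶠ k : ℕ in atTop, 1 < ((k : ℝ) + 1) * y - 1 := by
    have : Tendsto (fun k : ℕ => (k : ℝ) * y) atTop atTop :=
      tendsto_natCast_atTop_atTop.atTop_mul_const hy
    filter_upwards [this.eventually_gt_atTop 2] with k hk
    linarith
  filter_upwards [hev x hx.1, hev (L - x) (by linarith [hx.2])] with k h1 h2
  constructor
  · rw [cutoff, Real.smoothTransition.one_of_one_le h1.le,
      Real.smoothTransition.one_of_one_le h2.le, one_mul]
  · rw [(hasDerivAt_cutoff L k x).deriv, deriv_smoothTransition_eq_zero (Or.inr h1),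
      deriv_smoothTransition_eq_zero (Or.inr h2)]
    ring

/-- The defining identity of the weak derivative holds for smooth functions that vanish at the end
points. -/
theorem HasWeakDeriv.integral_mul_deriv {L : ℝ} {ψ g : L2 L} (h : HasWeakDeriv ψ g)
    {φ : ℝ → ℝ} (hφ : ContDiff ℝ ∞ φ) {B : ℝ} (hB : 0 ≤ B) (h0 : ∀ x, |φ x| ≤ B * |x|)
    (hL : ∀ x, |φ x| ≤ B * |L - x|) (hφB : ∀ x, |φ x| ≤ B) (hφ' : ∀ x, |deriv φ x| ≤ B) :
    ∫ x in Ioo 0 L, ψ x * deriv φ x = -∫ x in Ioo 0 L, g x * φ x := by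
  obtain ⟨C, hC⟩ := exists_mul_deriv_cutoff_le L hB h0 hL
  have hder (k : ℕ) (x : ℝ) : deriv (fun x => φ x * cutoff L k x) x =
      deriv φ x * cutoff L k x + φ x * deriv (cutoff L k) x :=
    (((hφ.differentiable (by simp)) x).hasDerivAt.mul
      (((contDiff_cutoff L k).differentiable (by simp)) x).hasDerivAt).deriv
  have hmeas (f : L2 L) (q : ℝ → ℝ) (hq : Continuous q) :
      AEStronglyMeasurable (fun x => f x * q x) (volume.restrict (Ioo 0 L)) :=
    (Lp.aestronglyMeasurable f).mul hq.aestronglyMeasurable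
  -- Dominated convergence: the boundary-layer term with the derivative of the cutoff is bounded and
  -- eventually zero at each interior point.
  have h1 : Tendsto (fun k : ℕ => ∫ x in Ioo 0 L, ψ x * deriv (fun x => φ x * cutoff L k x) x)
      atTop (𝓝 (∫ x in Ioo 0 L, ψ x * deriv φ x)) := by
    refine tendsto_integral_of_dominated_convergence (fun x => ‖ψ x‖ * (B + C)) (fun k => ?_)
      ((integrable_L2 ψ).norm.mul_const _) (fun k => ?_) ?_
    · exact hmeas ψ _ ((isTest_mul_cutoff L k hφ).1.continuous_deriv (by simp))
    · filter_upwards [ae_restrict_mem measurableSet_Ioo] with x hx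
      rw [norm_mul, hder]
      refine mul_le_mul_of_nonneg_left ?_ (norm_nonneg _)
      refine (abs_add_le _ _).trans (add_le_add ?_ (hC k x hx))
      rw [abs_mul]
      exact (mul_le_of_le_one_right (abs_nonneg _) (abs_cutoff_le _ _ _)).trans (hφ' x)
    · filter_upwards [ae_restrict_mem measurableSet_Ioo] with x hx
      refine tendsto_const_nhds.congr' ?_
      filter_upwards [eventually_cutoff_eq hx] with k hk
      rw [hder, hk.1, hk.2]; ring
  have h2 : Tendsto (fun k : ℕ => ∫ x in Ioo 0 L, g x * (φ x * cutoff L k x))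
      atTop (𝓝 (∫ x in Ioo 0 L, g x * φ x)) := by
    refine tendsto_integral_of_dominated_convergence (fun x => ‖g x‖ * B) (fun k => ?_)
      ((integrable_L2 g).norm.mul_const _) (fun k => ?_) ?_
    · exact hmeas g _ (isTest_mul_cutoff L k hφ).1.continuous
    · refine ae_of_all _ fun x => ?_
      rw [norm_mul]
      refine mul_le_mul_of_nonneg_left ?_ (norm_nonneg _)
      rw [Real.norm_eq_abs, abs_mul]
      exact (mul_le_of_le_one_right (abs_nonneg _) (abs_cutoff_le _ _ _)).trans (hφB x)
    · filter_upwards [ae_restrict_mem measurableSet_Ioo] with x hx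
      refine tendsto_const_nhds.congr' ?_
      filter_upwards [eventually_cutoff_eq hx] with k hk
      rw [hk.1, mul_one]
  refine tendsto_nhds_unique h1 (h2.neg.congr fun k => ?_)
  exact (h _ (isTest_mul_cutoff L k hφ)).symm

/-- Needed to identify the first derivative occurring in `HasSecondWeakDeriv` with the one occurring
in `H10`. -/
theorem HasWeakDeriv.unique {L : ℝ} {ψ g g' : L2 L} (h : HasWeakDeriv ψ g)
    (h' : HasWeakDeriv ψ g') : g = g' := by
  have hint (f : L2 L) (η : ℝ → ℝ) (hη : IsTest L η) :
      Integrable (fun x => f x * η x) (volume.restrict (Ioo 0 L)) := by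
    obtain ⟨K, hK⟩ := hη.1.continuous.bounded_above_of_compact_support hη.2.1
    exact (integrable_L2 f).mul_bdd (c := K) hη.1.continuous.aestronglyMeasurable (ae_of_all _ hK)
  have h1 := isOpen_Ioo.ae_eq_zero_of_integral_contDiff_smul_eq_zero
    (U := Ioo (0 : ℝ) L) (f := fun x => g x - g' x) (μ := volume.restrict (Ioo 0 L))
    (((integrable_L2 g).sub (integrable_L2 g')).locallyIntegrable.locallyIntegrableOn _)
    (fun η h1 h2 h3 => by
      have hη : IsTest L η := ⟨h1, h2, h3⟩
      have e1 := h η hη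
      have e2 := h' η hη
      simp only [smul_eq_mul, mul_sub]
      rw [integral_sub]
      · simp only [mul_comm (η _)]
        linarith
      · simpa only [mul_comm] using hint g η hη
      · simpa only [mul_comm] using hint g' η hη)
  refine Lp.ext ?_
  filter_upwards [h1, ae_restrict_mem measurableSet_Ioo] with x hx hx'
  exact sub_eq_zero.1 (hx hx')

/-- On a bounded interval `L²` convergence implies `L¹` convergence, which can be tested against
bounded functions. -/
theorem tendsto_integral_mul_of_eLpNorm {L : ℝ} {ψ : ℝ → ℝ} {F : ℕ → ℝ → ℝ} {q : ℝ → ℝ}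
    (hψ : MemLp ψ 2 (volume.restrict (Ioo 0 L)))
    (hF : ∀ k, MemLp (F k) 2 (volume.restrict (Ioo 0 L))) (hq : Continuous q) {B : ℝ}
    (hB : ∀ x, |q x| ≤ B)
    (h : Tendsto (fun k => eLpNorm (fun x => ψ x - F k x) 2 (volume.restrict (Ioo 0 L)))
      atTop (𝓝 0)) :
    Tendsto (fun k => ∫ x in Ioo 0 L, F k x * q x) atTop (𝓝 (∫ x in Ioo 0 L, ψ x * q x)) := by
  have hint (f : ℝ → ℝ) (hf : MemLp f 2 (volume.restrict (Ioo 0 L))) :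
      Integrable (fun x => f x * q x) (volume.restrict (Ioo 0 L)) :=
    (hf.integrable one_le_two).mul_bdd (c := B) hq.aestronglyMeasurable (ae_of_all _ hB)
  refine tendsto_integral_of_L1' _ (hint ψ hψ).1 (Eventually.of_forall fun k => hint _ (hF k)) ?_
  set c : ENNReal := ENNReal.ofReal B *
    (volume.restrict (Ioo 0 L) univ) ^ (1 / (1 : ENNReal).toReal - 1 / (2 : ENNReal).toReal)
  have hc : c ≠ ⊤ := by
    refine ENNReal.mul_ne_top ENNReal.ofReal_ne_top (ENNReal.rpow_ne_top_of_nonneg ?_ ?_)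
    · norm_num
    · simp
  have hlim : Tendsto (fun k => c * eLpNorm (fun x => ψ x - F k x) 2 (volume.restrict (Ioo 0 L)))
      atTop (𝓝 0) := by
    simpa using ENNReal.Tendsto.const_mul h (Or.inr hc)
  refine tendsto_of_tendsto_of_tendsto_of_le_of_le tendsto_const_nhds hlim (fun _ => zero_le)
    fun k => ?_
  have hm : AEStronglyMeasurable (fun x => ψ x - F k x) (volume.restrict (Ioo 0 L)) :=
    hψ.1.sub (hF k).1
  calc eLpNorm ((fun x => F k x * q x) - fun x => ψ x * q x) 1 (volume.restrict (Ioo 0 L))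
      ≤ ENNReal.ofReal B * eLpNorm (fun x => ψ x - F k x) 1 (volume.restrict (Ioo 0 L)) := by
        refine eLpNorm_le_mul_eLpNorm_of_ae_le_mul (ae_of_all _ fun x => ?_) 1
        simp only [Pi.sub_apply]
        rw [← sub_mul, norm_mul, mul_comm, norm_sub_rev]
        exact mul_le_mul_of_nonneg_right (hB x) (norm_nonneg _)
    _ ≤ ENNReal.ofReal B * (eLpNorm (fun x => ψ x - F k x) 2 (volume.restrict (Ioo 0 L)) *
          (volume.restrict (Ioo 0 L) univ) ^
            (1 / (1 : ENNReal).toReal - 1 / (2 : ENNReal).toReal)) := by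
        gcongr
        exact eLpNorm_le_eLpNorm_mul_rpow_measure_univ one_le_two hm
    _ = _ := by simp only [c]; ring

theorem IsTest.memLp {L : ℝ} {η : ℝ → ℝ} (hη : IsTest L η) :
    MemLp η 2 (volume.restrict (Ioo 0 L)) := by
  obtain ⟨K, hK⟩ := hη.1.continuous.bounded_above_of_compact_support hη.2.1
  exact MemLp.of_bound hη.1.continuous.aestronglyMeasurable K (ae_of_all _ hK)

theorem IsTest.isTest_deriv {L : ℝ} {η : ℝ → ℝ} (hη : IsTest L η) : IsTest L (deriv η) := by
  refine ⟨?_, hη.2.1.deriv, (tsupport_deriv_subset).trans hη.2.2⟩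
  exact (contDiff_infty_iff_deriv.1 hη.1).2

theorem IsTest.integral_deriv_mul {L : ℝ} (hL : 0 ≤ L) {η q : ℝ → ℝ} (hη : IsTest L η)
    (hq : ContDiff ℝ 1 q) :
    ∫ x in Ioo 0 L, deriv η x * q x = -∫ x in Ioo 0 L, η x * deriv q x := by
  have h0 : η 0 = 0 := image_eq_zero_of_notMem_tsupport fun h => (hη.2.2 h).1.ne rfl
  have h1 : η L = 0 := image_eq_zero_of_notMem_tsupport fun h => (hη.2.2 h).2.ne rfl
  have := intervalIntegral.integral_mul_deriv_eq_deriv_mul (a := 0) (b := L) (u := q)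
    (v := η) (u' := deriv q) (v' := deriv η)
    (fun x _ => (hq.differentiable one_ne_zero x).hasDerivAt)
    (fun x _ => (hη.1.differentiable (by simp) x).hasDerivAt)
    (hq.continuous_deriv_one.intervalIntegrable _ _)
    ((hη.isTest_deriv.1.continuous).intervalIntegrable _ _)
  rw [h0, h1, mul_zero, mul_zero, sub_zero, zero_sub, intervalIntegral.integral_of_le hL,
    intervalIntegral.integral_of_le hL, integral_Ioc_eq_integral_Ioo,
    integral_Ioc_eq_integral_Ioo] at this
  simpa only [mul_comm] using this

/-! ### The Dirichlet eigensystem -/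

/-- The frequency `(n+1)π/L`, the square root of the eigenvalue. -/
noncomputable def freq (L : ℝ) (n : ℕ) : ℝ := ((n : ℝ) + 1) * Real.pi / L

theorem freq_pos {L : ℝ} (hL : 0 < L) (n : ℕ) : 0 < freq L n := by
  have := Real.pi_pos
  unfold freq; positivity

theorem eigenvalue_eq (L : ℝ) (n : ℕ) : eigenvalue L n = freq L n ^ 2 := rfl

theorem eigenvalue_pos {L : ℝ} (hL : 0 < L) (n : ℕ) : 0 < eigenvalue L n := by
  rw [eigenvalue_eq]; exact pow_pos (freq_pos hL n) 2

theorem eigenfun_eq (L : ℝ) (n : ℕ) :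
    eigenfun L n = fun x => √(2 / L) * Real.sin (freq L n * x) := rfl

theorem contDiff_eigenfun (L : ℝ) (n : ℕ) : ContDiff ℝ ∞ (eigenfun L n) := by
  rw [eigenfun_eq]; fun_prop

theorem hasDerivAt_eigenfun (L : ℝ) (n : ℕ) (x : ℝ) :
    HasDerivAt (eigenfun L n) (√(2 / L) * (Real.cos (freq L n * x) * freq L n)) x := by
  have h : HasDerivAt (fun x => freq L n * x) (freq L n) x := by
    simpa using (hasDerivAt_id x).const_mul (freq L n)
  exact h.sin.const_mul _

theorem deriv_eigenfun (L : ℝ) (n : ℕ) :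
    deriv (eigenfun L n) = fun x => √(2 / L) * (Real.cos (freq L n * x) * freq L n) :=
  funext fun x => (hasDerivAt_eigenfun L n x).deriv

theorem deriv_deriv_eigenfun (L : ℝ) (n : ℕ) (x : ℝ) :
    deriv (deriv (eigenfun L n)) x = -eigenvalue L n * eigenfun L n x := by
  have h : HasDerivAt (fun x => freq L n * x) (freq L n) x := by
    simpa using (hasDerivAt_id x).const_mul (freq L n)
  rw [deriv_eigenfun, ((h.cos.mul_const (freq L n)).const_mul √(2 / L)).deriv, eigenvalue_eq,
    eigenfun_eq]
  ring

theorem inner_L2 {L : ℝ} (ψ χ : L2 L) :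
    inner ℝ ψ χ = ∫ x in Ioo 0 L, ψ x * χ x := by
  rw [L2.inner_def]
  congr 1; ext x
  simp [mul_comm]

theorem inner_eigenvec {L : ℝ} (ψ : L2 L) (n : ℕ) :
    inner ℝ ψ (eigenvec L n) = ∫ x in Ioo 0 L, ψ x * eigenfun L n x := by
  rw [inner_L2]
  refine integral_congr_ae ?_
  filter_upwards [(memLp_eigenfun L n).coeFn_toLp] with x hx
  rw [eigenvec, hx]

theorem sin_freq_mul_right {L : ℝ} (hL : 0 < L) (n : ℕ) : Real.sin (freq L n * L) = 0 := by
  have : freq L n * L = ((n + 1 : ℕ) : ℝ) * Real.pi := by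
    unfold freq; push_cast; field_simp
  rw [this, Real.sin_nat_mul_pi]

theorem integral_cos_int_mul {L : ℝ} (hL : 0 < L) {k : ℤ} (hk : k ≠ 0) :
    ∫ x in (0 : ℝ)..L, Real.cos (k * Real.pi / L * x) = 0 := by
  have hk' : (k : ℝ) * Real.pi / L ≠ 0 := by
    have := Real.pi_ne_zero
    have : (k : ℝ) ≠ 0 := by exact_mod_cast hk
    positivity
  rw [intervalIntegral.integral_comp_mul_left _ hk', integral_cos, mul_zero, Real.sin_zero,
    div_mul_cancel₀ _ hL.ne', Real.sin_int_mul_pi]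
  simp

theorem orthonormal_eigenvec {L : ℝ} (hL : 0 < L) : Orthonormal ℝ (eigenvec L) := by
  rw [orthonormal_iff_ite]
  intro m n
  have e : inner ℝ (eigenvec L m) (eigenvec L n) =
      -- Product-to-sum formula. As the frequencies are indexed from `n + 1`, the sum frequency is
      -- `m + n + 2`, never zero.
      ∫ x in (0 : ℝ)..L, (1 / L) * (Real.cos ((((m : ℤ) - n : ℤ) : ℝ) * Real.pi / L * x) -
        Real.cos ((((m : ℤ) + n + 2 : ℤ) : ℝ) * Real.pi / L * x)) := by
    rw [inner_eigenvec, intervalIntegral.integral_of_le hL.le, integral_Ioc_eq_integral_Ioo]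
    refine integral_congr_ae ?_
    filter_upwards [(memLp_eigenfun L m).coeFn_toLp] with x hx
    rw [eigenvec, hx, eigenfun_eq, eigenfun_eq]
    simp only
    have e1 : (((m : ℤ) - n : ℤ) : ℝ) * Real.pi / L * x = freq L m * x - freq L n * x := by
      unfold freq; push_cast; ring
    have e2 : (((m : ℤ) + n + 2 : ℤ) : ℝ) * Real.pi / L * x = freq L m * x + freq L n * x := by
      unfold freq; push_cast; ring
    rw [e1, e2, Real.cos_sub, Real.cos_add]
    have hs : √(2 / L) * √(2 / L) = 2 / L := Real.mul_self_sqrt (by positivity)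
    linear_combination (Real.sin (freq L m * x) * Real.sin (freq L n * x)) * hs
  have hi (c : ℝ) : IntervalIntegrable (fun x => Real.cos (c * x)) volume 0 L :=
    Continuous.intervalIntegrable (by fun_prop) _ _
  rw [e, intervalIntegral.integral_const_mul, intervalIntegral.integral_sub (hi _) (hi _),
    integral_cos_int_mul hL (k := (m : ℤ) + n + 2) (by omega), sub_zero]
  split_ifs with h
  · subst h
    simp [hL.ne']
  · rw [integral_cos_int_mul hL (by omega), mul_zero]

/-- The sine system is complete. -/
theorem eq_zero_of_inner_eigenvec {L : ℝ} (hL : 0 < L) {ψ : L2 L}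
    (h : ∀ n, inner ℝ ψ (eigenvec L n) = 0) : ψ = 0 := by
  set ψ₀ : ℝ → ℝ := (Ioo 0 L).indicator ψ with hψ₀
  have hψ₀m : MemLp ψ₀ 2 volume := (memLp_indicator_iff_restrict measurableSet_Ioo).2 (Lp.memLp ψ)
  have hψ₀n : MemLp (fun x => ψ₀ (-x)) 2 volume :=
    hψ₀m.comp_measurePreserving (Measure.measurePreserving_neg volume)
  -- The odd extension. Its `2L`-periodic Fourier coefficients are multiples of the sine
  -- coefficients of `ψ`, hence zero, and Parseval gives `f = 0`.
  set f : ℝ → ℂ := fun x => ((ψ₀ x - ψ₀ (-x) : ℝ) : ℂ) with hf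
  have hfm : MemLp f 2 volume := (hψ₀m.sub hψ₀n).ofReal
  have hψ₀i : Integrable ψ₀ volume :=
    (integrable_indicator_iff measurableSet_Ioo).2 (integrable_L2 ψ)
  have hsin (k : ℤ) : ∫ x, ψ₀ x * Real.sin (k * Real.pi / L * x) = 0 := by
    have h1 (n : ℕ) : ∫ x, ψ₀ x * Real.sin (freq L n * x) = 0 := by
      have h2 := h n
      rw [inner_eigenvec, eigenfun_eq] at h2
      have e : (fun x => ψ x * (√(2 / L) * Real.sin (freq L n * x))) =
          fun x => √(2 / L) * (ψ x * Real.sin (freq L n * x)) := by ext x; ring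
      simp only [e] at h2
      rw [integral_const_mul, mul_eq_zero] at h2
      have h3 := h2.resolve_left (Real.sqrt_pos.2 (by positivity)).ne'
      rw [← integral_indicator measurableSet_Ioo] at h3
      rw [← h3]
      congr 1; ext x
      simp only [hψ₀, indicator]
      split_ifs <;> simp
    obtain ⟨n, hn | hn⟩ := k.eq_nat_or_neg
    · rcases n with _ | n
      · simp [hn]
      · rw [← h1 n, hn]; unfold freq; push_cast; rfl
    · rcases n with _ | n
      · simp [hn]
      · have e : (fun x => ψ₀ x * Real.sin (k * Real.pi / L * x)) =
            fun x => -(ψ₀ x * Real.sin (freq L n * x)) := by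
          ext x
          rw [← mul_neg, ← Real.sin_neg, hn]
          unfold freq; push_cast; congr 2; ring
        rw [e, integral_neg, h1, neg_zero]
  have hab : -L < L := by linarith
  have hcoeff (k : ℤ) : fourierCoeffOn hab f k = 0 := by
    rw [fourierCoeffOn_eq_integral]
    have hsupp : ∀ x ∉ Ioc (-L) L, (fourier (-k)) ((x : ℝ) : AddCircle (L - -L)) • f x = 0 := by
      intro x hx
      rcases eq_or_ne x (-L) with rfl | hx1
      · have e1 : ψ₀ (-L) = 0 := indicator_of_notMem (fun hx2 => by linarith [hx2.1]) _
        have e2 : ψ₀ L = 0 := indicator_of_notMem (fun hx2 => hx2.2.ne rfl) _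
        simp [hf, e1, e2]
      have e1 : ψ₀ x = 0 := indicator_of_notMem (fun hx2 => hx ⟨by linarith [hx2.1], hx2.2.le⟩) _
      have e2 : ψ₀ (-x) = 0 := indicator_of_notMem (fun hx2 => hx
        ⟨by linarith [hx2.2], by linarith [hx2.1, hx2.2]⟩) _
      simp [hf, e1, e2]
    rw [intervalIntegral.integral_of_le hab.le, setIntegral_eq_integral_of_forall_compl_eq_zero hsupp]
    set θ : ℝ := ((-k : ℤ) : ℝ) * Real.pi / L with hθ
    have hfour (x : ℝ) : (fourier (-k)) ((x : ℝ) : AddCircle (L - -L)) =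
        Complex.exp ((θ * x : ℝ) * Complex.I) := by
      rw [fourier_coe_apply]
      congr 1
      have hLc : (L : ℂ) ≠ 0 := by exact_mod_cast hL.ne'
      rw [hθ]; push_cast; field_simp; ring
    simp only [hfour]
    have hEi (g : ℝ → ℝ) (hg : Integrable g volume) (c : ℝ) :
        Integrable (fun x => Complex.exp ((c * x : ℝ) * Complex.I) • (g x : ℂ)) volume := by
      refine hg.ofReal.bdd_mul (c := 1) ?_ (ae_of_all _ fun x => ?_)
      · exact Continuous.aestronglyMeasurable (by fun_prop)
      · rw [Complex.norm_exp_ofReal_mul_I]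
    have hsplit : (fun x => Complex.exp ((θ * x : ℝ) * Complex.I) • f x) = fun x =>
        Complex.exp ((θ * x : ℝ) * Complex.I) • (ψ₀ x : ℂ) -
        Complex.exp ((θ * x : ℝ) * Complex.I) • (ψ₀ (-x) : ℂ) := by
      ext x; simp [hf, mul_sub]
    have hneg : ∫ x, Complex.exp ((θ * x : ℝ) * Complex.I) • (ψ₀ (-x) : ℂ) =
        ∫ x, Complex.exp ((-θ * x : ℝ) * Complex.I) • (ψ₀ x : ℂ) := by
      rw [← integral_neg_eq_self]
      congr 1; ext x
      rw [neg_neg]; congr 4; ring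
    rw [hsplit, integral_sub (hEi ψ₀ hψ₀i θ) (hEi (fun x => ψ₀ (-x)) hψ₀i.comp_neg θ), hneg,
      ← integral_sub (hEi ψ₀ hψ₀i θ) (hEi ψ₀ hψ₀i (-θ))]
    have hfin : (fun x => Complex.exp ((θ * x : ℝ) * Complex.I) • (ψ₀ x : ℂ) -
        Complex.exp ((-θ * x : ℝ) * Complex.I) • (ψ₀ x : ℂ)) = fun x =>
        (2 * Complex.I) * ((ψ₀ x * Real.sin (θ * x) : ℝ) : ℂ) := by
      ext x
      rw [Complex.exp_mul_I, Complex.exp_mul_I, ← Complex.ofReal_cos, ← Complex.ofReal_sin,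
        ← Complex.ofReal_cos, ← Complex.ofReal_sin, neg_mul, Real.cos_neg, Real.sin_neg]
      simp only [smul_eq_mul]; push_cast; ring
    rw [hfin, integral_const_mul, integral_complex_ofReal, hθ, hsin (-k)]
    simp
  have hsq := hasSum_sq_fourierCoeffOn hab (f := f) (hfm.restrict _)
  simp only [hcoeff] at hsq
  have hzero : ∫ x in (-L)..L, ‖f x‖ ^ 2 = 0 := by
    have hz : HasSum (fun _ : ℤ => ‖(0 : ℂ)‖ ^ 2) 0 := by simp [hasSum_zero]
    have := hsq.unique hz
    rw [smul_eq_mul, mul_eq_zero] at this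
    exact this.resolve_left (inv_ne_zero (by linarith))
  rw [intervalIntegral.integral_of_le hab.le, setIntegral_eq_zero_iff_of_nonneg_ae
    (ae_of_all _ fun x => by positivity) (hfm.integrable_norm_pow two_ne_zero).integrableOn] at hzero
  rw [Lp.eq_zero_iff_ae_eq_zero]
  have hz2 := ae_restrict_of_ae_restrict_of_subset
    (fun x (hx : x ∈ Ioo 0 L) => (⟨by linarith [hx.1], hx.2.le⟩ : x ∈ Ioc (-L) L)) hzero
  filter_upwards [hz2, ae_restrict_mem measurableSet_Ioo] with x hx hx'
  have e1 : ψ₀ x = ψ x := indicator_of_mem hx' _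
  have e2 : ψ₀ (-x) = 0 := indicator_of_notMem (fun h => by linarith [h.1, hx'.1]) _
  have : f x = 0 := by simpa using hx
  simpa [hf, e1, e2] using this

/-- The Hilbert basis of `L²(0, L)` formed by the eigenfunctions. -/
noncomputable def eigenbasis {L : ℝ} (hL : 0 < L) : HilbertBasis ℕ ℝ (L2 L) :=
  HilbertBasis.mkOfOrthogonalEqBot (orthonormal_eigenvec hL) (by
    rw [Submodule.eq_bot_iff]
    intro ψ hψ
    refine eq_zero_of_inner_eigenvec hL fun n => ?_
    rw [real_inner_comm]
    exact (Submodule.mem_orthogonal _ _).1 hψ _ (Submodule.subset_span ⟨n, rfl⟩))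

theorem hasSum_inner_smul_eigenvec {L : ℝ} (hL : 0 < L) (ψ : L2 L) :
    HasSum (fun n => (inner ℝ ψ (eigenvec L n) : ℝ) • eigenvec L n) ψ := by
  have h := (eigenbasis hL).hasSum_repr ψ
  refine h.congr_fun fun n => ?_
  rw [HilbertBasis.repr_apply_apply, eigenbasis, HilbertBasis.coe_mkOfOrthogonalEqBot,
    real_inner_comm]

/-- The Dirichlet Laplacian acts diagonally in the eigenbasis. -/
theorem inner_secondWeakDeriv_eigenvec {L : ℝ} (hL : 0 < L) {ψ w : L2 L} (hψ : ψ ∈ H10 L)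
    (hw : HasSecondWeakDeriv ψ w) (n : ℕ) :
    inner ℝ w (eigenvec L n) = -eigenvalue L n * inner ℝ ψ (eigenvec L n) := by
  obtain ⟨g, hg, hgw⟩ := hw
  obtain ⟨g', hg', η, hη, hη0, hη1⟩ := hψ
  obtain rfl := hg.unique hg'
  have hc : 0 ≤ √(2 / L) := Real.sqrt_nonneg _
  have hκ := freq_pos hL n
  set B := √(2 / L) * freq L n + √(2 / L) with hB
  have hlip (a b : ℝ) : |Real.sin a - Real.sin b| ≤ |a - b| := by
    have := Real.lipschitzWith_sin.dist_le_mul a b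
    simpa [Real.dist_eq] using this
  have hb (y x : ℝ) (hy : Real.sin (freq L n * y) = 0) : |eigenfun L n x| ≤ B * |y - x| := by
    rw [eigenfun_eq]
    simp only
    rw [abs_mul, abs_of_nonneg hc]
    have h1 := hlip (freq L n * x) (freq L n * y)
    rw [hy, sub_zero, ← mul_sub, abs_mul, abs_of_pos hκ, abs_sub_comm] at h1
    calc √(2 / L) * |Real.sin (freq L n * x)| ≤ √(2 / L) * (freq L n * |y - x|) := by gcongr
      _ ≤ B * |y - x| := by
        rw [← mul_assoc]
        exact mul_le_mul_of_nonneg_right (by rw [hB]; linarith) (abs_nonneg _)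
  have hfB (x : ℝ) : |eigenfun L n x| ≤ B := by
    rw [eigenfun_eq]
    simp only
    rw [abs_mul, abs_of_nonneg hc]
    refine (mul_le_of_le_one_right hc (Real.abs_sin_le_one _)).trans ?_
    rw [hB]; nlinarith
  have hdB (x : ℝ) : |deriv (eigenfun L n) x| ≤ B := by
    rw [deriv_eigenfun]
    simp only
    rw [abs_mul, abs_mul, abs_of_nonneg hc, abs_of_pos hκ, hB]
    have : |Real.cos (freq L n * x)| * freq L n ≤ freq L n :=
      mul_le_of_le_one_left hκ.le (Real.abs_cos_le_one _)
    nlinarith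
  -- First integration by parts: `φ_n` is not a test function, but it vanishes at both end points.
  have h1 := hgw.integral_mul_deriv (contDiff_eigenfun L n) (B := B) (by positivity)
    (fun x => by simpa using hb 0 x (by simp)) (fun x => hb L x (sin_freq_mul_right hL n)) hfB hdB
  have hcd : ContDiff ℝ 1 (deriv (eigenfun L n)) :=
    ((contDiff_infty_iff_deriv.1 (contDiff_eigenfun L n)).2).of_le (by exact_mod_cast le_top)
  have l1 := tendsto_integral_mul_of_eLpNorm (Lp.memLp g) (fun k => (hη k).isTest_deriv.memLp)
    hcd.continuous hdB hη1
  have l0 := tendsto_integral_mul_of_eLpNorm (Lp.memLp ψ) (fun k => (hη k).memLp)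
    (contDiff_eigenfun L n).continuous hfB hη0
  -- Second integration by parts: `φ_n'` does not vanish at the boundary, so the boundary condition
  -- on `ψ` enters, through its approximation by test functions.
  have h2 : ∫ x in Ioo 0 L, g x * deriv (eigenfun L n) x =
      eigenvalue L n * ∫ x in Ioo 0 L, ψ x * eigenfun L n x := by
    refine tendsto_nhds_unique l1 ((l0.const_mul (eigenvalue L n)).congr fun k => ?_)
    rw [(hη k).integral_deriv_mul hL.le hcd, ← integral_neg, ← integral_const_mul]
    congr 1; ext x
    rw [deriv_deriv_eigenfun]; ring
  rw [inner_eigenvec, inner_eigenvec]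
  linarith

/-! ### Orthonormal series depending on a parameter -/

section OrthonormalSeries

variable {H : Type*} [NormedAddCommGroup H] [InnerProductSpace ℝ H] {e : ℕ → H}

theorem Orthonormal.norm_sq_sum (he : Orthonormal ℝ e) (c : ℕ → ℝ) (s : Finset ℕ) :
    ‖∑ n ∈ s, c n • e n‖ ^ 2 = ∑ n ∈ s, c n ^ 2 := by
  rw [← real_inner_self_eq_norm_sq, he.inner_sum]
  exact Finset.sum_congr rfl fun n _ => by simp [sq]

theorem Orthonormal.norm_le_of_hasSum (he : Orthonormal ℝ e) {c d : ℕ → ℝ} {x y : H} {K : ℝ}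
    (hK : 0 ≤ K) (hx : HasSum (fun n => c n • e n) x) (hy : HasSum (fun n => d n • e n) y)
    (h : ∀ n, |c n| ≤ K * |d n|) : ‖x‖ ≤ K * ‖y‖ := by
  refine le_of_tendsto_of_tendsto' hx.norm (hy.norm.const_mul K) fun s => ?_
  refine abs_le_of_sq_le_sq' ?_ (by positivity) |>.2
  rw [mul_pow, Orthonormal.norm_sq_sum he, Orthonormal.norm_sq_sum he, Finset.mul_sum]
  refine Finset.sum_le_sum fun n _ => ?_
  rw [← sq_abs (c n), ← sq_abs (d n), ← mul_pow]
  exact pow_le_pow_left₀ (abs_nonneg _) (h n) 2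

variable [CompleteSpace H]

theorem Orthonormal.summable_smul (he : Orthonormal ℝ e) {c : ℕ → ℝ}
    (hc : Summable fun n => c n ^ 2) : Summable fun n => c n • e n := by
  have h := (he.orthogonalFamily.summable_iff_norm_sq_summable c).2 (by simpa using hc)
  simpa using h

/-- A Weierstrass test with an `ℓ²` majorant instead of an `ℓ¹` one: by orthogonality each tail is
no longer than the corresponding tail of `∑ w n • e n`. -/
theorem Orthonormal.tendstoUniformlyOn_series (he : Orthonormal ℝ e) {c : ℕ → ℝ → ℝ} {w : ℕ → ℝ}
    (hw : Summable fun n => w n ^ 2) {U : Set ℝ} (h : ∀ n, ∀ t ∈ U, |c n t| ≤ w n) :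
    TendstoUniformlyOn (fun N t => ∑ n ∈ Finset.range N, c n t • e n)
      (fun t => ∑' n, c n t • e n) atTop U := by
  have hW := (Orthonormal.summable_smul he hw).hasSum
  set W := ∑' n, w n • e n
  have hlim : Tendsto (fun N => ‖W - ∑ n ∈ Finset.range N, w n • e n‖) atTop (𝓝 0) := by
    simpa using ((tendsto_const_nhds (x := W)).sub hW.tendsto_sum_nat).norm
  have htail {d : ℕ → ℝ} {x : H} (hx : HasSum (fun n => d n • e n) x) (N : ℕ) :
      HasSum (fun n => (if n ∈ Finset.range N then 0 else d n) • e n)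
        (x - ∑ n ∈ Finset.range N, d n • e n) := by
    have h1 : HasSum (fun n => (if n ∈ Finset.range N then d n else 0) • e n)
        (∑ n ∈ Finset.range N, (if n ∈ Finset.range N then d n else 0) • e n) :=
      hasSum_sum_of_ne_finset_zero fun n hn => by rw [if_neg hn, zero_smul]
    rw [Finset.sum_congr rfl fun n hn => by rw [if_pos hn]] at h1
    refine (hx.sub h1).congr_fun fun n => ?_
    split_ifs <;> simp
  rw [Metric.tendstoUniformlyOn_iff]
  intro ε hε
  filter_upwards [hlim.eventually_lt_const hε] with N hN t ht
  rw [dist_eq_norm]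
  have hsum : Summable fun n => c n t ^ 2 :=
    Summable.of_nonneg_of_le (fun n => sq_nonneg _)
      (fun n => by rw [← sq_abs]; exact pow_le_pow_left₀ (abs_nonneg _) (h n t ht) 2) hw
  have := Orthonormal.norm_le_of_hasSum he zero_le_one
    (htail (Orthonormal.summable_smul he hsum).hasSum N) (htail hW N) (fun n => by
      split_ifs
      · simp
      · rw [one_mul]; exact (h n t ht).trans (le_abs_self _))
  rw [one_mul] at this
  exact this.trans_lt hN

theorem Orthonormal.continuousOn_series (he : Orthonormal ℝ e) {c : ℕ → ℝ → ℝ} {w : ℕ → ℝ}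
    (hw : Summable fun n => w n ^ 2) {U : Set ℝ} (h : ∀ n, ∀ t ∈ U, |c n t| ≤ w n)
    (hc : ∀ n, ContinuousOn (c n) U) : ContinuousOn (fun t => ∑' n, c n t • e n) U :=
  (Orthonormal.tendstoUniformlyOn_series he hw h).continuousOn
    (Frequently.of_forall fun _ => continuousOn_finsetSum _ fun n _ => (hc n).smul continuousOn_const)

theorem Orthonormal.hasDerivAt_series (he : Orthonormal ℝ e) {c c' : ℕ → ℝ → ℝ} {w w' : ℕ → ℝ}
    (hw : Summable fun n => w n ^ 2) (hw' : Summable fun n => w' n ^ 2) {U : Set ℝ} (hU : IsOpen U)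
    (h : ∀ n, ∀ t ∈ U, |c n t| ≤ w n) (h' : ∀ n, ∀ t ∈ U, |c' n t| ≤ w' n)
    (hc : ∀ n, ∀ t ∈ U, HasDerivAt (c n) (c' n t) t) {t : ℝ} (ht : t ∈ U) :
    HasDerivAt (fun t => ∑' n, c n t • e n) (∑' n, c' n t • e n) t :=
  hasDerivAt_of_tendstoUniformlyOn hU (Orthonormal.tendstoUniformlyOn_series he hw' h')
    (Eventually.of_forall fun _ s hs => HasDerivAt.fun_sum fun n _ => (hc n s hs).smul_const (e n))
    (fun _ hs => (Orthonormal.tendstoUniformlyOn_series he hw h).tendsto_at hs) ht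

end OrthonormalSeries

/-! ### Time regularity from chains of derivatives. -/

theorem contDiffOn_of_hasDerivAt_succ {E : Type*} [NormedAddCommGroup E] [NormedSpace ℝ E]
    {s : Set ℝ} (hs : IsOpen s) (N : ℕ) (Z : ℕ → ℝ → E)
    (hd : ∀ m < N, ∀ t ∈ s, HasDerivAt (Z m) (Z (m + 1) t) t) (hc : ContinuousOn (Z N) s) :
    ContDiffOn ℝ N (Z 0) s := by
  induction N generalizing Z with
  | zero => simpa [contDiffOn_zero] using hc
  | succ N ih =>
    have h1 := ih (fun m => Z (m + 1)) (fun m hm t ht => hd (m + 1) (by omega) t ht) hc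
    have e : ((N + 1 : ℕ) : WithTop ℕ∞) = (N : WithTop ℕ∞) + 1 := by push_cast; rfl
    rw [e, contDiffOn_succ_iff_deriv_of_isOpen hs]
    refine ⟨fun t ht => (hd 0 (by omega) t ht).differentiableAt.differentiableWithinAt,
      by simp, h1.congr fun t ht => (hd 0 (by omega) t ht).deriv⟩

/-- The functions `Z m` have two-sided derivatives even at an end point contained in `s`, whereas
`y` is only known on `s`; unique differentiability identifies the derivatives within `s`. -/
theorem iteratedDerivWithin_eq_of_hasDerivAt_succ {E : Type*} [NormedAddCommGroup E]
    [NormedSpace ℝ E] {s : Set ℝ} (hs : UniqueDiffOn ℝ s) (N : ℕ) (Z : ℕ → ℝ → E) {y : ℝ → E}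
    (hy : ∀ t ∈ s, y t = Z 0 t)
    (hd : ∀ m < N, ∀ t ∈ s, HasDerivAt (Z m) (Z (m + 1) t) t) {m : ℕ} (hm : m ≤ N) :
    ∀ t ∈ s, iteratedDerivWithin m y s t = Z m t := by
  induction m with
  | zero => simpa using hy
  | succ m ih =>
    intro t ht
    have h := ih (by omega)
    rw [iteratedDerivWithin_succ, derivWithin_congr h (h t ht)]
    exact (hd m (by omega) t ht).hasDerivWithinAt.derivWithin (hs t ht)

/-- The sum covers both monotonicity cases, since the exponents `β - m` and `1 - m` change sign with
`m`. -/
theorem rpow_le_add_rpow {r t R : ℝ} (hr : 0 < r) (ht : t ∈ Ioo r R) (x : ℝ) :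
    t ^ x ≤ r ^ x + R ^ x := by
  have ht0 : 0 < t := hr.trans ht.1
  have hR : 0 < R := ht0.trans ht.2
  rcases le_total 0 x with hx | hx
  · have := Real.rpow_le_rpow ht0.le ht.2.le hx
    have : 0 ≤ r ^ x := by positivity
    linarith
  · have := Real.rpow_le_rpow_of_nonpos hr ht.1.le hx
    have : 0 ≤ R ^ x := by positivity
    linarith

/-- Regularity in time of an eigenfunction expansion whose coefficients obey uniform bounds. -/
theorem regularity_of_coeff_bounds {H : Type*} [NormedAddCommGroup H] [InnerProductSpace ℝ H]
    [CompleteSpace H] {e : ℕ → H} (he : Orthonormal ℝ e) {T β C : ℝ} (hC : 0 ≤ C)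
    {a b : ℕ → ℕ → ℝ → ℝ} {p q : ℕ → ℝ} (hp : Summable fun n => p n ^ 2)
    (hq : Summable fun n => q n ^ 2)
    (ha : ∀ m n t, 0 < t → HasDerivAt (a m n) (a (m + 1) n t) t)
    (hb : ∀ m n t, 0 < t → HasDerivAt (b m n) (b (m + 1) n t) t)
    (hpa : ∀ m ≤ 3, ∀ n t, 0 < t → |a m n t| ≤ C * t ^ (β - m) * |p n|)
    (hqb : ∀ m ≤ 3, ∀ n t, 0 < t → |b m n t| ≤ C * t ^ (1 - m : ℝ) * |q n|)
    {y : ℝ → H} (hy : ∀ t ∈ Ioc 0 T, HasSum (fun n => (a 0 n t + b 0 n t) • e n) (y t)) :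
    ContDiffOn ℝ 3 y (Ioc 0 T) ∧ ∀ m ≤ 3, ∀ t ∈ Ioc 0 T,
      ‖iteratedDerivWithin m y (Ioc 0 T) t‖ ≤
        C * t ^ (β - m) * ‖∑' n, p n • e n‖ + C * t ^ (1 - m : ℝ) * ‖∑' n, q n • e n‖ := by
  -- The differentiated series make sense for all `t > 0`, so they extend `y` smoothly beyond `T`
  -- and the end point needs no special care.
  set Z : ℕ → ℝ → H := fun m t => ∑' n, (a m n t + b m n t) • e n with hZ
  have hdom (m : ℕ) (hm : m ≤ 3) (r R : ℝ) (hr : 0 < r) : ∃ w : ℕ → ℝ,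
      (Summable fun n => w n ^ 2) ∧ ∀ n, ∀ t ∈ Ioo r R, |a m n t + b m n t| ≤ w n := by
    set K₁ := C * (r ^ (β - m) + R ^ (β - m))
    set K₂ := C * (r ^ (1 - m : ℝ) + R ^ (1 - m : ℝ))
    refine ⟨fun n => K₁ * |p n| + K₂ * |q n|, ?_, fun n t ht => ?_⟩
    · refine Summable.of_nonneg_of_le (fun n => sq_nonneg _) (fun n => ?_)
        ((hp.mul_left (2 * K₁ ^ 2)).add (hq.mul_left (2 * K₂ ^ 2)))
      rw [← sq_abs (p n), ← sq_abs (q n)]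
      nlinarith [sq_nonneg (K₁ * |p n| - K₂ * |q n|)]
    · have ht0 : 0 < t := hr.trans ht.1
      refine (abs_add_le _ _).trans (add_le_add ((hpa m hm n t ht0).trans ?_)
        ((hqb m hm n t ht0).trans ?_))
      · exact mul_le_mul_of_nonneg_right
          (mul_le_mul_of_nonneg_left (rpow_le_add_rpow hr ht _) hC) (abs_nonneg _)
      · exact mul_le_mul_of_nonneg_right
          (mul_le_mul_of_nonneg_left (rpow_le_add_rpow hr ht _) hC) (abs_nonneg _)
  have hder (m n : ℕ) (t : ℝ) (ht : 0 < t) :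
      HasDerivAt (fun t => a m n t + b m n t) (a (m + 1) n t + b (m + 1) n t) t :=
    (ha m n t ht).add (hb m n t ht)
  have hZd : ∀ m < 3, ∀ t ∈ Ioi (0 : ℝ), HasDerivAt (Z m) (Z (m + 1) t) t := by
    intro m hm t ht
    have ht : 0 < t := ht
    obtain ⟨w, hw, h⟩ := hdom m (by omega) (t / 2) (2 * t) (by linarith)
    obtain ⟨w', hw', h'⟩ := hdom (m + 1) (by omega) (t / 2) (2 * t) (by linarith)
    exact Orthonormal.hasDerivAt_series he hw hw' isOpen_Ioo h h'
      (fun n s hs => hder m n s (by linarith [hs.1])) ⟨by linarith, by linarith⟩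
  have hZc : ContinuousOn (Z 3) (Ioi 0) := by
    intro t ht
    have ht : 0 < t := ht
    obtain ⟨w, hw, h⟩ := hdom 3 le_rfl (t / 2) (2 * t) (by linarith)
    have := Orthonormal.continuousOn_series he hw h
      (fun n s hs => (hder 3 n s (by linarith [hs.1])).continuousAt.continuousWithinAt)
    exact (this.continuousAt (Ioo_mem_nhds (by linarith) (by linarith))).continuousWithinAt
  have hyZ : ∀ t ∈ Ioc 0 T, y t = Z 0 t := fun t ht => (hy t ht).tsum_eq.symm
  constructor
  · exact ((contDiffOn_of_hasDerivAt_succ isOpen_Ioi 3 Z hZd hZc).mono Ioc_subset_Ioi_self).congr hyZ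
  · intro m hm t ht
    rw [iteratedDerivWithin_eq_of_hasDerivAt_succ (uniqueDiffOn_Ioc 0 T) 3 Z hyZ
      (fun m hm t ht => hZd m hm t ht.1) hm t ht]
    have hsq {c d : ℕ → ℝ} {K : ℝ} (hd : Summable fun n => d n ^ 2)
        (h : ∀ n, |c n| ≤ K * |d n|) : Summable fun n => c n ^ 2 := by
      refine Summable.of_nonneg_of_le (fun n => sq_nonneg _) (fun n => ?_) (hd.mul_left (K ^ 2))
      rw [← sq_abs (c n), ← sq_abs (d n), ← mul_pow]
      exact pow_le_pow_left₀ (abs_nonneg _) (h n) 2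
    have hA := (Orthonormal.summable_smul he (hsq hp fun n => hpa m hm n t ht.1)).hasSum
    have hB := (Orthonormal.summable_smul he (hsq hq fun n => hqb m hm n t ht.1)).hasSum
    have hsum : Z m t = ∑' n, a m n t • e n + ∑' n, b m n t • e n := by
      rw [← (hA.add hB).tsum_eq]
      simp only [hZ, add_smul]
    have ht0 := ht.1
    rw [hsum]
    refine (norm_add_le _ _).trans (add_le_add ?_ ?_)
    · exact Orthonormal.norm_le_of_hasSum he (by positivity) hA
        (Orthonormal.summable_smul he hp).hasSum fun n => hpa m hm n t ht0
    · exact Orthonormal.norm_le_of_hasSum he (by positivity) hB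
        (Orthonormal.summable_smul he hq).hasSum fun n => hqb m hm n t ht0

/-! ### Spectral representation of strong solutions -/

theorem summable_powCoeff_sq {L γ : ℝ} {ψ : L2 L} (h : ψ ∈ powDomain L γ) :
    Summable fun n => powCoeff L γ ψ n ^ 2 := by
  have : Summable fun n => |powCoeff L γ ψ n| ^ 2 := h
  simpa only [sq_abs] using this

theorem hasSum_negLapPow {L γ : ℝ} (hL : 0 < L) {ψ : L2 L} (h : ψ ∈ powDomain L γ) :
    HasSum (fun n => powCoeff L γ ψ n • eigenvec L n) (negLapPow L γ ψ) :=
  (Orthonormal.summable_smul (orthonormal_eigenvec hL) (summable_powCoeff_sq h)).hasSum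

theorem powCoeff_add_smul {L γ : ℝ} (ψ χ : L2 L) (c : ℝ) (n : ℕ) :
    powCoeff L γ (ψ + c • χ) n = powCoeff L γ ψ n + c * powCoeff L γ χ n := by
  rw [powCoeff, powCoeff, powCoeff, inner_add_left, real_inner_smul_left]
  ring

theorem add_smul_mem_powDomain {L γ : ℝ} {ψ χ : L2 L} (hψ : ψ ∈ powDomain L γ)
    (hχ : χ ∈ powDomain L γ) (c : ℝ) : ψ + c • χ ∈ powDomain L γ := by
  change Summable fun n => |powCoeff L γ (ψ + c • χ) n| ^ 2
  refine Summable.of_nonneg_of_le (fun n => by positivity) (fun n => ?_)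
    (((summable_powCoeff_sq hψ).mul_left 2).add ((summable_powCoeff_sq hχ).mul_left (2 * c ^ 2)))
  rw [sq_abs, powCoeff_add_smul]
  nlinarith [sq_nonneg (powCoeff L γ ψ n - c * powCoeff L γ χ n)]

theorem norm_negLapPow_add_smul_le {L γ : ℝ} (hL : 0 < L) {ψ χ : L2 L} (hψ : ψ ∈ powDomain L γ)
    (hχ : χ ∈ powDomain L γ) {c : ℝ} (hc : 0 ≤ c) :
    ‖negLapPow L γ (ψ + c • χ)‖ ≤ ‖negLapPow L γ ψ‖ + c * ‖negLapPow L γ χ‖ := by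
  have h := (hasSum_negLapPow hL hψ).add ((hasSum_negLapPow hL hχ).const_smul c)
  have e : negLapPow L γ (ψ + c • χ) = negLapPow L γ ψ + c • negLapPow L γ χ := by
    refine (hasSum_negLapPow hL (add_smul_mem_powDomain hψ hχ c)).unique (h.congr_fun fun n => ?_)
    rw [powCoeff_add_smul, add_smul, mul_smul]
  rw [e]
  refine (norm_add_le _ _).trans_eq ?_
  rw [norm_smul, Real.norm_of_nonneg hc]

theorem negLapPow_zero {L : ℝ} (hL : 0 < L) (ψ : L2 L) : negLapPow L 0 ψ = ψ := by
  rw [negLapPow]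
  simp only [powCoeff, Real.rpow_zero, one_mul]
  exact (hasSum_inner_smul_eigenvec hL ψ).tsum_eq

/-- Pairing with `φ_n` diagonalises `u_xx`; then `I^β` is applied to both equations. The source
order `2 - β` is what makes `I^β ω_{2-β} = ω_2 = t`, so `g` enters as an initial velocity. -/
theorem IsSolution.inner_eigenvec_eq {L T α : ℝ} (hL : 0 < L) (hα : α ∈ Ioo (1 : ℝ) 2)
    {a₀ a₁ f : L2 L} {u z : ℝ → L2 L} (h : IsSolution L T α a₀ a₁ f u z) (n : ℕ) {t : ℝ}
    (ht : t ∈ Ioc 0 T) :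
    inner ℝ (z t) (eigenvec L n) = -eigenvalue L n *
      (inner ℝ a₀ (eigenvec L n) * mlSeries (α / 2) (α / 2 + 1) (eigenvalue L n) t +
       inner ℝ (a₁ + Real.Gamma (2 - α) • f) (eigenvec L n) *
        mlSeries (α / 2) (α / 2 + 2) (eigenvalue L n) t) := by
  set β := α / 2 with hβdef
  have hβ : β ∈ Ioo (0 : ℝ) 1 := ⟨by rw [hβdef]; linarith [hα.1], by rw [hβdef]; linarith [hα.2]⟩
  set φ : L2 L →L[ℝ] ℝ := innerSL ℝ (eigenvec L n) with hφ
  have hφa (ψ : L2 L) : inner ℝ ψ (eigenvec L n) = φ ψ := by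
    rw [hφ, innerSL_apply_apply, real_inner_comm]
  set g := a₁ + Real.Gamma (2 - α) • f
  have ru := h.regular_u.clm_comp φ
  have rz := h.regular_z.clm_comp φ
  simp only [hφa]
  refine volterra_solution (u := fun t => φ (u t)) (z := fun t => φ (z t))
    (by rw [hβdef]; linarith [hα.1]) ru.continuousOn rz.continuousOn ?_ ?_ ht
  · intro t ht
    have h1 := rlIntegral_caputo hβ ru ht
    have h2 : rlIntegral β (caputo β fun t => φ (u t)) t =
        rlIntegral β (fun s => φ (z s)) t + φ g * t := by
      rw [rlIntegral_congr (w := fun s => φ (z s) + φ g * omega (2 - β) s) ht.1.le]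
      · have i1 := intervalIntegrable_omega_mul_continuousOn hβ.1 ht.1
          (rz.continuousOn.mono (Icc_subset_Icc_right ht.2.le))
        have i2 := intervalIntegrable_omega_mul_omega hβ.1 (b := 2 - β) (by linarith [hβ.2]) ht.1
        have e : (fun s => omega β (t - s) • (φ (z s) + φ g * omega (2 - β) s)) =
            fun s => omega β (t - s) • φ (z s) + φ g * (omega β (t - s) * omega (2 - β) s) := by
          ext s; simp only [smul_eq_mul]; ring
        rw [rlIntegral, e, intervalIntegral.integral_add i1 (i2.const_mul _),
          intervalIntegral.integral_const_mul,
          integral_omega_mul_omega hβ.1 (by linarith [hβ.2]) ht.1, add_sub_cancel, omega_two]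
        rfl
      · intro s hs
        have hsT : s ∈ Ioo 0 T := ⟨hs.1, hs.2.trans ht.2⟩
        rw [h.regular_u.caputo_clm_comp hβ.2 φ hsT, h.eq_u s hsT, map_sub, map_smul, smul_eq_mul]
        ring
    rw [h2, h.init_u] at h1
    linarith
  · intro t ht
    have h1 := rlIntegral_caputo hβ rz ht
    have h2 : rlIntegral β (caputo β fun t => φ (z t)) t =
        -eigenvalue L n * rlIntegral β (fun s => φ (u s)) t := by
      rw [rlIntegral_congr (w := fun s => -eigenvalue L n * φ (u s)) ht.1.le]
      · rw [rlIntegral, rlIntegral, ← intervalIntegral.integral_const_mul]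
        congr 1; ext s
        simp only [smul_eq_mul]; ring
      · intro s hs
        have hsT : s ∈ Ioo 0 T := ⟨hs.1, hs.2.trans ht.2⟩
        obtain ⟨w, hw, hcw⟩ := h.eq_z s hsT
        rw [h.regular_z.caputo_clm_comp hβ.2 φ hsT, sub_eq_zero.1 hcw, ← hφa, ← hφa,
          inner_secondWeakDeriv_eigenvec hL (h.boundary_u s hsT) hw]
    rw [h2, h.init_z, map_zero, sub_zero] at h1
    exact h1.symm

/-- Regularity of `(-Δ)^γ z` for data `a₀ ∈ D((-Δ)^{γ+1})`, `a₁, f ∈ D((-Δ)^{γ+1/2})`. -/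
theorem exists_regularity_const {α : ℝ} (hα : α ∈ Ioo (1 : ℝ) 2) :
    ∃ C : ℝ, 0 < C ∧ ∀ γ γ₁ γ₂ L T : ℝ, γ₁ = γ + 1 → γ₂ = γ + 1 / 2 → 0 < L →
      ∀ (a₀ a₁ f : L2 L) (u z : ℝ → L2 L),
        a₀ ∈ powDomain L γ₁ → a₁ ∈ powDomain L γ₂ → f ∈ powDomain L γ₂ →
        IsSolution L T α a₀ a₁ f u z →
        (∀ t ∈ Ioc 0 T, z t ∈ powDomain L γ) ∧
        ContDiffOn ℝ 3 (fun t => negLapPow L γ (z t)) (Ioc 0 T) ∧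
        ∀ m : ℕ, m ≤ 3 → ∀ t ∈ Ioc 0 T,
          ‖iteratedDerivWithin m (fun s => negLapPow L γ (z s)) (Ioc 0 T) t‖ ≤
            C * t ^ (α / 2 - m) * ‖negLapPow L γ₁ a₀‖ +
            C * t ^ (1 - m : ℝ) * (‖negLapPow L γ₂ a₁‖ + ‖negLapPow L γ₂ f‖) := by
  have hβ : α / 2 ∈ Ioo (1 / 2 : ℝ) 1 := ⟨by linarith [hα.1], by linarith [hα.2]⟩
  obtain ⟨C, hC, hml⟩ := exists_mlSeries_le hβ
  have hG : 0 < Real.Gamma (2 - α) := Real.Gamma_pos_of_pos (by linarith [hα.2])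
  -- The factor `1 + Γ(2-α)` comes from splitting the norm of `g` into those of `a₁` and `f`.
  refine ⟨C * (1 + Real.Gamma (2 - α)), by positivity, ?_⟩
  rintro γ γ₁ γ₂ L T rfl rfl hL a₀ a₁ f u z ha₀ ha₁ hf h
  set β := α / 2
  set g := a₁ + Real.Gamma (2 - α) • f with hg
  have hgd : g ∈ powDomain L (γ + 1 / 2) := add_smul_mem_powDomain ha₁ hf _
  set lam := eigenvalue L with hlam
  have hl (n : ℕ) : 0 < lam n := eigenvalue_pos hL n
  set a : ℕ → ℕ → ℝ → ℝ := fun m n t =>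
    -powCoeff L (γ + 1) a₀ n * mlSeries β (β + 1 - m) (lam n) t with ha
  -- The factor `λ^{γ+1}` is shared out: `λ^{γ+1/2}` goes to the data and the remaining `λ^{1/2}` to
  -- the Mittag-Leffler series, where the second bound of `exists_mlSeries_le` absorbs it.
  set b : ℕ → ℕ → ℝ → ℝ := fun m n t =>
    -powCoeff L (γ + 1 / 2) g n * (lam n ^ (1 / 2 : ℝ) * mlSeries β (β + 2 - m) (lam n) t) with hb
  have hbpos : 0 ≤ β := by linarith [hβ.1]
  have hder_a (m n : ℕ) (t : ℝ) (ht : 0 < t) : HasDerivAt (a m n) (a (m + 1) n t) t :=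
    (hasDerivAt_mlSeries hβ.1.le hbpos m (lam n) ht).const_mul _
  have hder_b (m n : ℕ) (t : ℝ) (ht : 0 < t) : HasDerivAt (b m n) (b (m + 1) n t) t := by
    have h1 := hasDerivAt_mlSeries hβ.1.le (by linarith : 0 ≤ β + 1) m (lam n) ht
    rw [show β + 1 + 1 = β + 2 by ring] at h1
    exact (h1.const_mul _).const_mul _
  have hba (m : ℕ) (hm : m ≤ 3) (n : ℕ) (t : ℝ) (ht : 0 < t) :
      |a m n t| ≤ C * t ^ (β - m) * |powCoeff L (γ + 1) a₀ n| := by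
    simp only [ha]
    rw [abs_mul, abs_neg, mul_comm]
    exact mul_le_mul_of_nonneg_right (hml (lam n) t (hl n) ht m hm).1 (abs_nonneg _)
  have hbb (m : ℕ) (hm : m ≤ 3) (n : ℕ) (t : ℝ) (ht : 0 < t) :
      |b m n t| ≤ C * t ^ (1 - m : ℝ) * |powCoeff L (γ + 1 / 2) g n| := by
    simp only [hb]
    rw [abs_mul, abs_neg, mul_comm, abs_mul, abs_of_nonneg (Real.rpow_nonneg (hl n).le _)]
    exact mul_le_mul_of_nonneg_right (hml (lam n) t (hl n) ht m hm).2 (abs_nonneg _)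
  have hcoeff (t : ℝ) (ht : t ∈ Ioc 0 T) (n : ℕ) :
      powCoeff L γ (z t) n = a 0 n t + b 0 n t := by
    have e1 : lam n ^ (γ + 1) = lam n ^ γ * lam n := by
      rw [Real.rpow_add (hl n), Real.rpow_one]
    have e2 : lam n ^ (γ + 1 / 2) * lam n ^ (1 / 2 : ℝ) = lam n ^ γ * lam n := by
      rw [← Real.rpow_add (hl n), ← e1]; congr 1; ring
    simp only [ha, hb, powCoeff]
    rw [h.inner_eigenvec_eq hL hα n ht, e1, Nat.cast_zero, sub_zero, sub_zero]
    linear_combination (inner ℝ g (eigenvec L n) * mlSeries β (β + 2) (lam n) t) * e2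
  have hzd (t : ℝ) (ht : t ∈ Ioc 0 T) : z t ∈ powDomain L γ := by
    change Summable fun n => |powCoeff L γ (z t) n| ^ 2
    refine Summable.of_nonneg_of_le (fun n => by positivity) (fun n => ?_)
      (((summable_powCoeff_sq ha₀).mul_left (2 * (C * t ^ (β - (0 : ℕ))) ^ 2)).add
        ((summable_powCoeff_sq hgd).mul_left (2 * (C * t ^ (1 - (0 : ℕ) : ℝ)) ^ 2)))
    have h1 := hba 0 (by norm_num) n t ht.1
    have h2 := hbb 0 (by norm_num) n t ht.1
    have h3 : |powCoeff L γ (z t) n| ≤ C * t ^ (β - (0 : ℕ)) * |powCoeff L (γ + 1) a₀ n| +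
        C * t ^ (1 - (0 : ℕ) : ℝ) * |powCoeff L (γ + 1 / 2) g n| := by
      rw [hcoeff t ht]
      exact (abs_add_le _ _).trans (add_le_add h1 h2)
    refine (pow_le_pow_left₀ (abs_nonneg _) h3 2).trans ?_
    rw [← sq_abs (powCoeff L (γ + 1) a₀ n), ← sq_abs (powCoeff L (γ + 1 / 2) g n)]
    nlinarith [sq_nonneg (C * t ^ (β - (0 : ℕ)) * |powCoeff L (γ + 1) a₀ n| -
        C * t ^ (1 - (0 : ℕ) : ℝ) * |powCoeff L (γ + 1 / 2) g n|)]
  have hreg := regularity_of_coeff_bounds (orthonormal_eigenvec hL) hC.le (T := T)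
    (summable_powCoeff_sq ha₀) (summable_powCoeff_sq hgd) hder_a hder_b hba hbb
    (y := fun t => negLapPow L γ (z t)) (fun t ht =>
      (hasSum_negLapPow hL (hzd t ht)).congr_fun fun n => by rw [hcoeff t ht n])
  refine ⟨hzd, hreg.1, fun m hm t ht => (hreg.2 m hm t ht).trans (add_le_add ?_ ?_)⟩
  · have ht0 := ht.1
    change C * t ^ (β - m) * ‖negLapPow L (γ + 1) a₀‖ ≤ _
    refine mul_le_mul_of_nonneg_right (mul_le_mul_of_nonneg_right ?_ (by positivity))
      (norm_nonneg _)
    nlinarith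
  · have ht0 := ht.1
    change C * t ^ (1 - m : ℝ) * ‖negLapPow L (γ + 1 / 2) g‖ ≤ _
    have h1 := norm_negLapPow_add_smul_le hL ha₁ hf hG.le
    have h2 : ‖negLapPow L (γ + 1 / 2) g‖ ≤ (1 + Real.Gamma (2 - α)) *
        (‖negLapPow L (γ + 1 / 2) a₁‖ + ‖negLapPow L (γ + 1 / 2) f‖) := by
      refine h1.trans ?_
      nlinarith [mul_nonneg hG.le (norm_nonneg (negLapPow L (γ + 1 / 2) a₁)),
        norm_nonneg (negLapPow L (γ + 1 / 2) f)]
    calc C * t ^ (1 - m : ℝ) * ‖negLapPow L (γ + 1 / 2) g‖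
        ≤ C * t ^ (1 - m : ℝ) * ((1 + Real.Gamma (2 - α)) *
          (‖negLapPow L (γ + 1 / 2) a₁‖ + ‖negLapPow L (γ + 1 / 2) f‖)) :=
          mul_le_mul_of_nonneg_left h2 (by positivity)
      _ = _ := by ring

end DiffusionWave

/-! ### The two cases of the theorem. -/

theorem lemma3p7 (α : ℝ) (hα : α ∈ Set.Ioo (1 : ℝ) 2) :
    (∃ C : ℝ, 0 < C ∧ ∀ (L T : ℝ), 0 < L → 0 < T →
      ∀ (a₀ a₁ f : L2 L) (u z : ℝ → L2 L),
        a₀ ∈ powDomain L 1 → a₁ ∈ powDomain L (1 / 2) → f ∈ powDomain L (1 / 2) →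
        IsSolution L T α a₀ a₁ f u z →
        ContDiffOn ℝ 3 z (Set.Ioc 0 T) ∧
        ∀ m : ℕ, m ≤ 3 → ∀ t ∈ Set.Ioc 0 T,
          ‖iteratedDerivWithin m z (Set.Ioc 0 T) t‖ ≤
            C * t ^ (α / 2 - (m : ℝ)) * ‖negLapPow L 1 a₀‖ +
            C * t ^ (1 - (m : ℝ)) *
              (‖negLapPow L (1 / 2) a₁‖ + ‖negLapPow L (1 / 2) f‖)) ∧
    (∀ T : ℝ, 0 < T → ∃ C : ℝ, 0 < C ∧ ∀ L : ℝ, 0 < L →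
      ∀ (a₀ a₁ f : L2 L) (u z : ℝ → L2 L),
        a₀ ∈ powDomain L (3 / 2) → a₁ ∈ powDomain L 1 → f ∈ powDomain L 1 →
        IsSolution L T α a₀ a₁ f u z →
        (∀ t ∈ Set.Ioc 0 T, z t ∈ powDomain L (1 / 2)) ∧
        ContDiffOn ℝ 3 (fun t => negLapPow L (1 / 2) (z t)) (Set.Ioc 0 T) ∧
        ∀ m : ℕ, m ≤ 3 → ∀ t ∈ Set.Ioc 0 T,
          ‖iteratedDerivWithin m (fun s => negLapPow L (1 / 2) (z s)) (Set.Ioc 0 T) t‖ ≤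
            C * t ^ (α / 2 - (m : ℝ)) *
              (‖negLapPow L (3 / 2) a₀‖ + ‖negLapPow L 1 a₁‖ + ‖negLapPow L 1 f‖)) := by
  obtain ⟨C, hC, h⟩ := exists_regularity_const hα
  constructor
  · refine ⟨C, hC, fun L T hL _ a₀ a₁ f u z ha₀ ha₁ hf hs => ?_⟩
    have h1 := (h 0 1 (1 / 2) L T (by norm_num) (by norm_num) hL a₀ a₁ f u z ha₀ ha₁ hf hs).2
    simpa only [negLapPow_zero hL] using h1
  · intro T hT
    -- The dependence on `T` comes from merging the two powers: `t^{1-m} = t^{1-β} t^{β-m} ≤ T^{1-β}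
    -- t^{β-m}`, as `β < 1`.
    refine ⟨C * (1 + T ^ (1 - α / 2)), by positivity, fun L hL a₀ a₁ f u z ha₀ ha₁ hf hs => ?_⟩
    obtain ⟨h1, h2, h3⟩ :=
      h (1 / 2) (3 / 2) 1 L T (by norm_num) (by norm_num) hL a₀ a₁ f u z ha₀ ha₁ hf hs
    refine ⟨h1, h2, fun m hm t ht => (h3 m hm t ht).trans ?_⟩
    have ht0 := ht.1
    have e : t ^ (1 - m : ℝ) ≤ T ^ (1 - α / 2) * t ^ (α / 2 - m : ℝ) := by
      have e1 : t ^ (1 - m : ℝ) = t ^ (1 - α / 2) * t ^ (α / 2 - m : ℝ) := by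
        rw [← Real.rpow_add ht0]; congr 1; ring
      rw [e1]
      exact mul_le_mul_of_nonneg_right
        (Real.rpow_le_rpow ht0.le ht.2 (by linarith [hα.2])) (by positivity)
    set A := ‖negLapPow L (3 / 2) a₀‖
    set B := ‖negLapPow L 1 a₁‖ + ‖negLapPow L 1 f‖ with hB
    have hA : 0 ≤ A := norm_nonneg _
    have hB0 : 0 ≤ B := by positivity
    rw [add_assoc A, ← hB]
    have hT' : 0 < T ^ (1 - α / 2) := by positivity
    have ht' : 0 < t ^ (α / 2 - m : ℝ) := by positivity
    calc C * t ^ (α / 2 - m : ℝ) * A + C * t ^ (1 - m : ℝ) * B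
        ≤ C * t ^ (α / 2 - m : ℝ) * A + C * (T ^ (1 - α / 2) * t ^ (α / 2 - m : ℝ)) * B := by
          gcongr
      _ ≤ C * (1 + T ^ (1 - α / 2)) * t ^ (α / 2 - m : ℝ) * (A + B) := by
          have : 0 ≤ C * t ^ (α / 2 - m : ℝ) * B := by positivity
          have : 0 ≤ C * t ^ (α / 2 - m : ℝ) * T ^ (1 - α / 2) * A := by positivity
          nlinarith
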